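/- **Setting.** Let $\mathcal A$ be a commutative $\mathbb Q$-algebra of functions of $t=(t_1=x,t_3,t_5,\dots)$, i.e. one with pairwise commuting derivations $\partial_{2n+1}=\partial/\partial t_{2n+1}$, $n\ge 0$; put $\partial=\partial_1$. A *constant* is an element of $\mathcal A$ killed by all $\partial_{2n+1}$. For formal pseudo-differential operators $P=\sum_{i\le N}a_i\partial^i$ over $\mathcal A$, $P^*=\sum(-\partial)^ia_i$, $P_+$ and $P_-$ are the parts with $i\ge 0$ and $i<0$, and $\mathrm{Res}\,P=a_{-1}$. Write $f(t-2[\lambda^{-1}])=\exp\bigl(-\sum_{n\ge0}\tfrac{2}{2n+1}\lambda^{-(2n+1)}\partial_{2n+1}\bigr)f\in\mathcal A[[\lambda^{-1}]]$. A *BKP dressing operator* is $W=1+\sum_{j\ge1}w_j\partial^{-j}$ with $W^*\partial W=\partial$ and $\partial_{2n+1}W=-(L^{2n+1})_-W$ for all $n\ge0$, where $L=W\partial W^{-1}$. A *tau function of $W$* is an invertible $\tau\in\mathcal A$ with $1+\sum_{j\ge1} w_j\lambda^{-j}=\tau(t-2[\lambda^{-1}])/\tau(t)$; a *BKP tau function*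 is a tau function of some BKP dressing operator. An *eigenfunction* is $\Phi\in\mathcal A$ with $\partial_{2n+1}\Phi=B_{2n+1}(\Phi)$ for all $n$, where $B_{2n+1}=(L^{2n+1})_+$. The squared eigenfunction potential $S(\Phi,\Psi)\in\mathcal A$ is defined, up to a constant, by $\partial_{2n+1}S(\Phi,\Psi)=\mathrm{Res}(\partial^{-1}\Psi B_{2n+1}\Phi\partial^{-1})$ for all $n$, and the BSEP by $\Omega(\Phi_1,\Phi_2)=S(\Phi_2,\Phi_{1,x})-S(\Phi_1,\Phi_{2,x})$. Let $W$ be a BKP dressing operator with tau function $\tau$, let $(\Phi_{1a},\Phi_{2a})_{a\in\{\alpha\}}$ be a finite family of pairs of eigenfunctions, let $\Omega(\Phi_{2a},\Phi_{1a})\in\mathcal A$ be any choice of the BSEPs, and let $$A=\sum_{a}\bigl(\Phi_{2a}\partial^{-1}\Phi_{1a,x}-\Phi_{1a}\partial^{-1}\Phi_{2a,x}\bigr).$$ **Proposition (action of the ghost flow on $\tau$).** 1. Let $\partial_\alpha$ be the ghost flow, i.e. a derivation of $\mathcal A$ that commutes with all $\partial_{2n+1}$ and satisfies $\partial_\alpha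 W=AW$. Then $$\partial_\alpha\tau=\tfrac12\sum_a\Omega(\Phi_{2a},\Phi_{1a})\,\tau,$$ where, the $\Omega$'s being defined up to constants only, equality holds up to adding a constant multiple of $\tau$ to the right-hand side. 2. Conversely, over the dual numbers $\mathcal A[\varepsilon]$, $\varepsilon^2=0$ (with $\partial_{2n+1}\varepsilon=0$), $W+\varepsilon AW$ is a BKP dressing operator with Lax operator $L+\varepsilon[A,L]$, and for every constant $c$, $\tau+\varepsilon\bigl(\tfrac12\sum_a\Omega(\Phi_{2a},\Phi_{1a})+c\bigr)\tau$ is a tau function of it. 3. Consequently, for every invertible constant $C$, $C\tau+\varepsilon\cdot\tfrac12\sum_a\Omega(\Phi_{2a},\Phi_{1a})\tau$ is a BKP tau function over $\mathcal A[\varepsilon]$ (that is, $C\tau+\tfrac12\sum_a\Omega(\Phi_{2a},\Phi_{1a})\tau$ is a BKP tau function to first order in the flow). 4. For a single pair of eigenfunctions this is exact: for each $a$ and every constant $C$ such that $C+\tfrac12\Omega(\Phi_{2a},\Phi_{1a})$ is invertible, $C\tau+\tfrac12\Omega(\Phi_{2a},\Phi_{1a})\tau$ is again a BKP tau function over $\mathcal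 A$. -/

import Mathlib

open scoped PowerSeries DualNumber

noncomputable section

namespace BKP

variable {A : Type*} [CommRing A] [Algebra ℚ A]

/-- Formal pseudo-differential operators `∑_{i ≤ N} a_i ∂^i` with coefficients in `A`, stored as
their coefficient families `i ↦ a_i`, which vanish for all large `i`. -/
def pdoSubgroup (A : Type*) [CommRing A] : AddSubgroup (ℤ → A) where
  carrier := {a | ∃ N : ℤ, ∀ i, N < i → a i = 0}
  zero_mem' := ⟨0, fun _ _ => rfl⟩
  add_mem' := by
    rintro a b ⟨M, hM⟩ ⟨N, hN⟩
    refine ⟨max M N, fun i hi => ?_⟩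
    simp [hM i (lt_of_le_of_lt (le_max_left _ _) hi), hN i (lt_of_le_of_lt (le_max_right _ _) hi)]
  neg_mem' := by
    rintro a ⟨M, hM⟩
    exact ⟨M, fun i hi => by simp [hM i hi]⟩

/-- The additive group of formal pseudo-differential operators over `A`. -/
abbrev PDO (A : Type*) [CommRing A] : Type _ := pdoSubgroup A

namespace PDO

/-- The coefficient of `∂^i`. -/
def coeff (P : PDO A) (i : ℤ) : A := P.1 i

/-- The monomial `f ∂^n`. -/
def monomial (n : ℤ) (f : A) : PDO A :=
  ⟨fun i => if i = n then f else 0, n, fun _ hi => if_neg hi.ne'⟩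

/-- Multiplication by the function `f`, an operator of order zero. -/
def fn (f : A) : PDO A := monomial 0 f

/-- The operator `∂^n`, for an integer `n`. -/
def del (n : ℤ) : PDO A := monomial n 1

/-- Composition, determined by `∂^i ∘ g = ∑_k (i choose k) (∂^k g) ∂^(i-k)`; the sum in each
coefficient is finite, see `comp_finite`. -/
def comp (d : Derivation ℚ A A) (P Q : PDO A) : PDO A :=
  ⟨fun m => ∑ᶠ p : ℤ × ℕ,
      Ring.choose p.1 p.2 • (P.coeff p.1 * d^[p.2] (Q.coeff (m - p.1 + p.2))), by
    obtain ⟨M, hM⟩ := P.2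
    obtain ⟨N, hN⟩ := Q.2
    refine ⟨M + N, fun m hm => finsum_eq_zero_of_forall_eq_zero fun p => ?_⟩
    by_cases h : M < p.1
    · simp [coeff, hM _ h]
    · have h0 : Q.coeff (m - p.1 + p.2) = 0 := hN _ (by omega)
      rw [h0, iterate_map_zero]
      simp⟩

theorem comp_finite (d : Derivation ℚ A A) (P Q : PDO A) (m : ℤ) :
    (Function.support fun p : ℤ × ℕ =>
      Ring.choose p.1 p.2 • (P.coeff p.1 * d^[p.2] (Q.coeff (m - p.1 + p.2)))).Finite := by
  obtain ⟨M, hM⟩ := P.2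
  obtain ⟨N, hN⟩ := Q.2
  refine ((Set.finite_Icc (m - N) M).prod (Set.finite_Iic (N - m + M).toNat)).subset ?_
  rintro ⟨i, k⟩ h
  rw [Function.mem_support] at h
  have h1 : i ≤ M := by
    by_contra hc
    exact h (by simp [coeff, hM i (by omega)])
  have h2 : m - i + k ≤ N := by
    by_contra hc
    have h0 : Q.coeff (m - i + k) = 0 := hN _ (by omega)
    exact h (by simp only [h0, iterate_map_zero, mul_zero, smul_zero])
  simp only [Set.mem_prod, Set.mem_Icc, Set.mem_Iic]
  omega

/-- The powers `P^n`. -/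
def pow (d : Derivation ℚ A A) (P : PDO A) : ℕ → PDO A
  | 0 => del 0
  | n + 1 => comp d P (pow d P n)

/-- The formal adjoint `∑ a_i ∂^i ↦ ∑ (-∂)^i a_i`; the coefficient of `∂^m` is the finite sum
`∑_k (-1)^(m+k) (m+k choose k) ∂^k a_(m+k)`. -/
def adj (d : Derivation ℚ A A) (P : PDO A) : PDO A :=
  ⟨fun m => ∑ᶠ k : ℕ,
      (Int.negOnePow (m + k) : ℤ) • Ring.choose (m + k) k • d^[k] (P.coeff (m + k)), by
    obtain ⟨M, hM⟩ := P.2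
    refine ⟨M, fun m hm => finsum_eq_zero_of_forall_eq_zero fun k => ?_⟩
    have h0 : P.coeff (m + k) = 0 := hM _ (by omega)
    rw [h0, iterate_map_zero]
    simp⟩

/-- The differential operator part `P_+`. -/
def plus (P : PDO A) : PDO A :=
  ⟨fun i => if 0 ≤ i then P.coeff i else 0, by
    obtain ⟨M, hM⟩ := P.2
    exact ⟨M, fun i hi => by simp [coeff, hM i hi]⟩⟩

/-- The integral operator part `P_-`. -/
def minus (P : PDO A) : PDO A :=
  ⟨fun i => if i < 0 then P.coeff i else 0, by
    obtain ⟨M, hM⟩ := P.2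
    exact ⟨M, fun i hi => by simp [coeff, hM i hi]⟩⟩

/-- The residue, i.e. the coefficient of `∂^(-1)`. -/
def res (P : PDO A) : A := P.coeff (-1)

/-- The action of the differential operator `P_+` on a function `f`. -/
def act (d : Derivation ℚ A A) (P : PDO A) (f : A) : A :=
  ∑ᶠ i : ℕ, P.coeff i * d^[i] f

/-- The image of `P` under a derivation `δ` of `A` acting on the coefficients. -/
def mapDer (δ : Derivation ℚ A A) (P : PDO A) : PDO A :=
  ⟨fun i => δ (P.coeff i), by
    obtain ⟨M, hM⟩ := P.2
    exact ⟨M, fun i hi => by simp [coeff, hM i hi]⟩⟩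

/-- The series `∑_{j ≥ 0} P_{-j} z^j`, where `z = 1/λ`. For `W = 1 + ∑ w_j ∂^(-j)` it is
`w(t, λ) = 1 + ∑ w_j λ^(-j)`. -/
def series (P : PDO A) : A⟦X⟧ := PowerSeries.mk fun j => P.coeff (-(j : ℤ))

/-- The operator `P + ε Q` over the dual numbers `A[ε]`. -/
def dual (P Q : PDO A) : PDO A[ε] :=
  ⟨fun i => TrivSqZeroExt.inl (P.coeff i) + TrivSqZeroExt.inr (Q.coeff i), by
    obtain ⟨M, hM⟩ := P.2
    obtain ⟨N, hN⟩ := Q.2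
    refine ⟨max M N, fun i hi => ?_⟩
    simp [coeff, hM i (lt_of_le_of_lt (le_max_left _ _) hi),
      hN i (lt_of_le_of_lt (le_max_right _ _) hi)]⟩

end PDO

open PDO

/-! In what follows `D n` is the derivation `∂/∂t_{2n+1}` of the ring `A` of functions of
`t = (t_1, t_3, t_5, …)`, and `∂ = D 0` is `∂/∂x`, `x = t_1`. -/

/-- `W = 1 + ∑_{j ≥ 1} w_j ∂^(-j)` is a dressing operator of the BKP hierarchy with Lax operator
`L = W ∂ W⁻¹`: Sato's equations and the constraint `W^* ∂ W = ∂` hold. -/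
structure IsDressing (D : ℕ → Derivation ℚ A A) (W L : PDO A) : Prop where
  coeff_zero : W.coeff 0 = 1
  coeff_pos : ∀ i, 0 < i → W.coeff i = 0
  lax : comp (D 0) L W = comp (D 0) W (del 1)
  sato : ∀ n, mapDer (D n) W = -comp (D 0) (minus (pow (D 0) L (2 * n + 1))) W
  constraint : comp (D 0) (adj (D 0) W) (comp (D 0) (del 1) W) = del 1

/-- The differential operator `B_{2n+1} = (L^(2n+1))_+`. -/
def B (D : ℕ → Derivation ℚ A A) (L : PDO A) (n : ℕ) : PDO A := plus (pow (D 0) L (2 * n + 1))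

/-- Eigenfunctions of the hierarchy: `∂_{2n+1} Φ = B_{2n+1}(Φ)`. -/
def IsEigenfunction (D : ℕ → Derivation ℚ A A) (L : PDO A) (Φ : A) : Prop :=
  ∀ n, D n Φ = act (D 0) (B D L n) Φ

/-- `S` is a squared eigenfunction potential `S(Φ, Ψ)`:
`∂S/∂t_{2n+1} = Res(∂⁻¹ Ψ B_{2n+1} Φ ∂⁻¹)` for all `n`. -/
def IsSEP (D : ℕ → Derivation ℚ A A) (L : PDO A) (Φ Ψ S : A) : Prop :=
  ∀ n, D n S = res (comp (D 0) (del (-1)) (comp (D 0) (fn Ψ) (comp (D 0) (B D L n)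
    (comp (D 0) (fn Φ) (del (-1))))))

/-- `Ω` is a B-type squared eigenfunction potential:
`Ω(Φ₁, Φ₂) = S(Φ₂, Φ₁ₓ) - S(Φ₁, Φ₂ₓ)`. -/
def IsBSEP (D : ℕ → Derivation ℚ A A) (L : PDO A) (Φ₁ Φ₂ Ω : A) : Prop :=
  ∃ S S' : A, IsSEP D L Φ₂ (D 0 Φ₁) S ∧ IsSEP D L Φ₁ (D 0 Φ₂) S' ∧ Ω = S - S'

/-- The generator `∑_a (Φ₂ₐ ∂⁻¹ Φ₁ₐ,ₓ - Φ₁ₐ ∂⁻¹ Φ₂ₐ,ₓ)` of the ghost flow. -/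
def ghost (D : ℕ → Derivation ℚ A A) {ι : Type*} [Fintype ι] (Φ₁ Φ₂ : ι → A) : PDO A :=
  ∑ a, (comp (D 0) (monomial (-1) (Φ₂ a)) (fn (D 0 (Φ₁ a)))
    - comp (D 0) (monomial (-1) (Φ₁ a)) (fn (D 0 (Φ₂ a))))

/-- The operator `-∑_n (2 / (2n+1)) z^(2n+1) ∂/∂t_{2n+1}` on power series in `z`. -/
def shiftGen (D : ℕ → Derivation ℚ A A) (g : A⟦X⟧) : A⟦X⟧ :=
  PowerSeries.mk fun m => -∑ n ∈ Finset.range m,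
    if 2 * n + 1 ≤ m then
      (2 / (2 * n + 1) : ℚ) • D n (PowerSeries.coeff (m - (2 * n + 1)) g)
    else 0

/-- The Taylor expansion of `f(t - 2[λ⁻¹])`, `[λ⁻¹] = (λ⁻¹, λ⁻³/3, λ⁻⁵/5, …)`, in `z = 1/λ`,
namely `exp(-∑_n (2 / (2n+1)) z^(2n+1) ∂/∂t_{2n+1}) f`. The `k`-th power of the exponent is
divisible by `z^k`, so that only `k ≤ m` contribute to the coefficient of `z^m`. -/
def shift (D : ℕ → Derivation ℚ A A) (f : A) : A⟦X⟧ :=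
  PowerSeries.mk fun m => ∑ k ∈ Finset.range (m + 1),
    (1 / (Nat.factorial k) : ℚ) •
      PowerSeries.coeff m ((shiftGen D)^[k] (PowerSeries.C f))

/-- `τ` is invertible and `w(t, λ) = τ(t - 2[λ⁻¹]) / τ(t)` is the series of `W`. -/
def IsTauOf (D : ℕ → Derivation ℚ A A) (W : PDO A) (τ : A) : Prop :=
  IsUnit τ ∧ shift D τ = PowerSeries.C τ * series W

/-- `τ` is a tau function of the BKP hierarchy. -/
def IsTau (D : ℕ → Derivation ℚ A A) (τ : A) : Prop :=
  ∃ W L : PDO A, IsDressing D W L ∧ IsTauOf D W τ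

/-- The constants: functions that do not depend on `t`. -/
def IsConst (D : ℕ → Derivation ℚ A A) (c : A) : Prop := ∀ n, D n c = 0

/-- The element `a + ε b` of the dual numbers `A[ε] = A ⊕ εA`, `ε² = 0`. -/
def eps (a b : A) : A[ε] := TrivSqZeroExt.inl a + TrivSqZeroExt.inr b

/-- The extension `a + ε b ↦ d a + ε d b` of a derivation `d` to the dual numbers. -/
def dualDer (d : Derivation ℚ A A) : Derivation ℚ A[ε] A[ε] :=
  Derivation.mk'
    { toFun := fun x => eps (d x.fst) (d x.snd)
      map_add' := fun x y => by ext <;> simp [eps]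
      map_smul' := fun q x => by ext <;> simp [eps] }
    (fun x y => by
      ext
      · simp [eps]
      · simp [eps]; ring)

end BKP

end

open BKP BKP.PDO

set_option linter.unusedSectionVars false

noncomputable section

namespace BKP

variable {A : Type*} [CommRing A] [Algebra ℚ A]

/-! Write z = 1/λ, T for the shift by -2[z], w for the series of W, G for the ghost generator and h
= ½ ∑ Ω. A tau function satisfies Tτ = τ w. All statements about τ rest on one formula,
`IsDressing.series_ghost_mul`: the series of GW is w (Th - h).

Given this formula, a derivation d commuting with the flows commutes with T. Applying d to Tτ = τ w
shows that dτ/τ - h is T-invariant, hence constant, which is part 1. The same computation read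
backwards in the ε-component gives the tau function in part 2, and rescaling Φ₂ by C⁻¹ gives part 3.
For one pair and g = C + ½Ω, the operator V = 1 + g⁻¹G satisfies: the series of VW is w Tg/g, so gτ
is a tau function of VW.

The formula combines two facts about eigenfunctions. First, ∂⁻¹Φ∂W has series w (TΦ + Φ)/2
(`IsDressing.series_mul_shift`). Indeed T(W)(1 - z∂)(1 + z∂)⁻¹W⁻¹ has differential operators as
coefficients and sends Φ to TΦ, while w T(W) takes the value 1 at ∂ = -1/z. Second, TΩ = Ω + Φ₁TΦ₂ -
Φ₂TΦ₁ (`IsDressing.shift_potential`). As ∂⁻¹Φ' = Φ - ∂⁻¹Φ∂, the first fact makes twice the series of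
GW equal to w ∑(Φ₁TΦ₂ - Φ₂TΦ₁), and the second identifies the sum.

It remains to see that the new operators are dressing operators. Infinitesimally, G = K∂ with K
self-adjoint gives the linearized constraint, and ∂ₙG = [Bₙ, G]₋ gives the linearized Sato
equations. For the finite transform V, the constraint is a quadratic identity for K
(`wedge_quadratic`). Sato's equations for VW hold because the obstruction to ∂ₙV + VBₙ being a
differential operator times V is itself a differential operator that kills both eigenfunctions
(`app_darbouxRem`).

Identities for T avoid manipulating exponentials: Tf is the unique series F with constant term f and
z dF/dz = -2 ∑ z^(2n+1) ∂F/∂t_{2n+1} (`IsFlow.ext`). -/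

/-- A commutative `ℚ`-algebra with a distinguished derivation `∂`. -/
class DiffAlg (A : Type*) [CommRing A] [Algebra ℚ A] where
  /-- the derivation `∂` -/
  der : Derivation ℚ A A


/-! ### Coefficients and orders of pseudo-differential operators. -/

namespace PDO

@[ext]
theorem ext_coeff {P Q : PDO A} (h : ∀ i, P.coeff i = Q.coeff i) : P = Q :=
  Subtype.ext (funext h)

@[simp] theorem coeff_zero' (i : ℤ) : (0 : PDO A).coeff i = 0 := rfl
@[simp] theorem coeff_add (P Q : PDO A) (i : ℤ) : (P + Q).coeff i = P.coeff i + Q.coeff i := rfl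
@[simp] theorem coeff_neg (P : PDO A) (i : ℤ) : (-P).coeff i = -P.coeff i := rfl
@[simp] theorem coeff_sub (P Q : PDO A) (i : ℤ) : (P - Q).coeff i = P.coeff i - Q.coeff i := rfl

theorem coeff_monomial (n : ℤ) (f : A) (i : ℤ) :
    (monomial n f).coeff i = if i = n then f else 0 := rfl

theorem coeff_del (n i : ℤ) : (del n : PDO A).coeff i = if i = n then 1 else 0 := rfl

theorem coeff_fn (f : A) (i : ℤ) : (fn f).coeff i = if i = 0 then f else 0 := rfl

theorem coeff_plus (P : PDO A) (i : ℤ) : (plus P).coeff i = if 0 ≤ i then P.coeff i else 0 := rfl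

theorem coeff_minus (P : PDO A) (i : ℤ) : (minus P).coeff i = if i < 0 then P.coeff i else 0 := rfl

/-- The coefficient of `∂^i`, as an additive map. -/
def coeffHom (i : ℤ) : PDO A →+ A where
  toFun P := P.coeff i
  map_zero' := rfl
  map_add' _ _ := rfl

@[simp] theorem coeff_sum {ι : Type*} (s : Finset ι) (P : ι → PDO A) (i : ℤ) :
    (∑ a ∈ s, P a).coeff i = ∑ a ∈ s, (P a).coeff i := map_sum (coeffHom i) P s

@[simp] theorem coeff_zsmul (n : ℤ) (P : PDO A) (i : ℤ) : (n • P).coeff i = n • P.coeff i :=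
  map_zsmul (coeffHom i) n P

@[simp] theorem coeff_nsmul (n : ℕ) (P : PDO A) (i : ℤ) : (n • P).coeff i = n • P.coeff i :=
  map_nsmul (coeffHom i) n P

/-- `P` has order at most `N`. -/
def OrdLE (P : PDO A) (N : ℤ) : Prop := ∀ i, N < i → P.coeff i = 0

theorem exists_ordLE (P : PDO A) : ∃ N, P.OrdLE N := P.2

theorem OrdLE.mono {P : PDO A} {M N : ℤ} (h : P.OrdLE M) (hMN : M ≤ N) : P.OrdLE N :=
  fun i hi => h i (by omega)

theorem OrdLE.add {P Q : PDO A} {N : ℤ} (hP : P.OrdLE N) (hQ : Q.OrdLE N) : (P + Q).OrdLE N :=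
  fun i hi => by simp [hP i hi, hQ i hi]

theorem OrdLE.sub {P Q : PDO A} {N : ℤ} (hP : P.OrdLE N) (hQ : Q.OrdLE N) : (P - Q).OrdLE N :=
  fun i hi => by simp [hP i hi, hQ i hi]

theorem OrdLE.sum {ι : Type*} {s : Finset ι} {P : ι → PDO A} {N : ℤ}
    (h : ∀ a ∈ s, (P a).OrdLE N) : (∑ a ∈ s, P a).OrdLE N :=
  fun i hi => by rw [coeff_sum]; exact Finset.sum_eq_zero fun a ha => h a ha i hi

theorem ordLE_monomial (n : ℤ) (f : A) : (monomial n f).OrdLE n :=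
  fun i hi => by rw [coeff_monomial, if_neg hi.ne']

theorem ordLE_del (n : ℤ) : (del n : PDO A).OrdLE n := ordLE_monomial n 1

theorem ordLE_fn (f : A) : (fn f).OrdLE 0 := ordLE_monomial 0 f

theorem ordLE_minus (P : PDO A) : (minus P).OrdLE (-1) :=
  fun i hi => by rw [coeff_minus, if_neg (by omega)]

theorem monomial_add (n : ℤ) (f g : A) : monomial n (f + g) = monomial n f + monomial n g := by
  ext i; simp only [coeff_monomial, coeff_add]; split_ifs <;> simp

@[simp] theorem monomial_zero (n : ℤ) : (monomial n 0 : PDO A) = 0 := by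
  ext i; simp [coeff_monomial]

/-- An additive map that shifts orders by a bounded amount and kills the monomials is zero. -/
theorem eq_zero_of_monomial (f : PDO A →+ PDO A) (b : ℤ)
    (hb : ∀ P N, P.OrdLE N → (f P).OrdLE (N + b)) (hf : ∀ n a, f (monomial n a) = 0)
    (P : PDO A) : f P = 0 := by
  obtain ⟨N, hN⟩ := exists_ordLE P
  -- Removing the leading monomial k times does not change the value of `f`. Once the order of the
  -- rest plus `b` is below m, the coefficient at m vanishes.
  have key : ∀ k : ℕ, ∃ P', P'.OrdLE (N - k) ∧ f P = f P' := by
    intro k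
    induction k with
    | zero => exact ⟨P, by simpa using hN, rfl⟩
    | succ k ih =>
      obtain ⟨P', h1, h2⟩ := ih
      refine ⟨P' - monomial (N - k) (P'.coeff (N - k)), fun i hi => ?_, ?_⟩
      · rw [coeff_sub, coeff_monomial]
        split_ifs with h
        · rw [h, sub_self]
        · rw [h1 i (by push_cast at hi; omega), sub_zero]
      · rw [map_sub, hf, sub_zero, h2]
  ext m
  obtain ⟨P', h1, h2⟩ := key (N + b - m + 1).toNat
  rw [h2]
  exact hb P' _ h1 m (by omega)

/-! ### The ring of pseudo-differential operators. -/

section comp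

variable [DiffAlg A]

local notation "δ" => (DiffAlg.der : Derivation ℚ A A)

/-- Composition depends on ∂. Fixing ∂ through `DiffAlg` makes it a multiplication, so that ring
identities for operators become available. -/
instance instMul : Mul (PDO A) := ⟨comp δ⟩

theorem mul_def (P Q : PDO A) : P * Q = comp δ P Q := rfl

theorem coeff_mul_eq_finsum (P Q : PDO A) (m : ℤ) : (P * Q).coeff m = ∑ᶠ p : ℤ × ℕ,
    Ring.choose p.1 p.2 • (P.coeff p.1 * δ^[p.2] (Q.coeff (m - p.1 + p.2))) := rfl

theorem iterate_der_add (k : ℕ) (a b : A) : δ^[k] (a + b) = δ^[k] a + δ^[k] b :=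
  iterate_map_add δ k a b

protected theorem add_mul' (P Q R : PDO A) : (P + Q) * R = P * R + Q * R := by
  ext m
  rw [coeff_add]
  simp only [coeff_mul_eq_finsum]
  rw [← finsum_add_distrib (comp_finite δ P R m) (comp_finite δ Q R m)]
  refine finsum_congr fun p => ?_
  rw [coeff_add, add_mul, smul_add]

protected theorem mul_add' (P Q R : PDO A) : P * (Q + R) = P * Q + P * R := by
  ext m
  rw [coeff_add]
  simp only [coeff_mul_eq_finsum]
  rw [← finsum_add_distrib (comp_finite δ P Q m) (comp_finite δ P R m)]
  refine finsum_congr fun p => ?_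
  rw [coeff_add, iterate_der_add, mul_add, smul_add]

instance instNonUnitalNonAssocRing : NonUnitalNonAssocRing (PDO A) where
  left_distrib := PDO.mul_add'
  right_distrib := PDO.add_mul'
  zero_mul P := by
    have h := PDO.add_mul' 0 0 P
    rwa [add_zero, left_eq_add] at h
  mul_zero P := by
    have h := PDO.mul_add' P 0 0
    rwa [add_zero, left_eq_add] at h

theorem coeff_monomial_mul (n : ℤ) (a : A) {Q : PDO A} {N : ℤ} (hQ : Q.OrdLE N) (m : ℤ) (K : ℕ)
    (hK : N < m - n + K) : (monomial n a * Q).coeff m =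
      ∑ k ∈ Finset.range K, Ring.choose n k • (a * δ^[k] (Q.coeff (m - n + k))) := by
  classical
  rw [coeff_mul_eq_finsum,
    finsum_eq_sum_of_support_subset (s := ({n} : Finset ℤ) ×ˢ Finset.range K)]
  · rw [Finset.sum_product, Finset.sum_singleton]
    simp [coeff_monomial]
  · rintro ⟨i, k⟩ h
    rw [Function.mem_support] at h
    simp only [Finset.coe_product, Finset.coe_singleton, Set.mem_prod, Set.mem_singleton_iff,
      Finset.coe_range, Set.mem_Iio]
    have h1 : i = n := by
      by_contra hc
      exact h (by simp [coeff_monomial, hc])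
    refine ⟨h1, ?_⟩
    by_contra hc
    apply h
    simp only
    rw [hQ _ (by omega), iterate_map_zero, mul_zero, smul_zero]

theorem coeff_mul_monomial {P : PDO A} {N : ℤ} (hP : P.OrdLE N) (n : ℤ) (b : A) (m : ℤ) (K : ℕ)
    (hK : N < m - n + K) : (P * monomial n b).coeff m =
      ∑ k ∈ Finset.range K,
        Ring.choose (m - n + k) k • (P.coeff (m - n + k) * δ^[k] b) := by
  classical
  have hinj : Function.Injective (fun k : ℕ => ((m - n + k, k) : ℤ × ℕ)) :=
    fun a b h => (Prod.ext_iff.1 h).2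
  rw [coeff_mul_eq_finsum,
    finsum_eq_sum_of_support_subset (s := (Finset.range K).map ⟨_, hinj⟩)]
  · rw [Finset.sum_map]
    refine Finset.sum_congr rfl fun k _ => ?_
    simp only [Function.Embedding.coeFn_mk, coeff_monomial]
    rw [if_pos (by ring)]
  · rintro ⟨i, k⟩ h
    rw [Function.mem_support] at h
    simp only [Finset.coe_map, Function.Embedding.coeFn_mk, Finset.coe_range, Set.mem_image,
      Set.mem_Iio, Prod.mk.injEq]
    have h1 : m - i + k = n := by
      by_contra hc
      exact h (by simp only [coeff_monomial, if_neg hc, iterate_map_zero, mul_zero, smul_zero])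
    refine ⟨k, ?_, by omega, rfl⟩
    by_contra hc
    apply h
    simp only
    rw [hP _ (by omega), zero_mul, smul_zero]

theorem iterate_der_one {k : ℕ} (hk : k ≠ 0) : δ^[k] 1 = 0 := by
  obtain ⟨j, rfl⟩ := Nat.exists_eq_succ_of_ne_zero hk
  rw [Function.iterate_succ_apply, Derivation.map_one_eq_zero, iterate_map_zero]

@[simp] theorem coeff_mul_del (P : PDO A) (n m : ℤ) : (P * del n).coeff m = P.coeff (m - n) := by
  obtain ⟨N, hN⟩ := exists_ordLE P
  rw [del, coeff_mul_monomial hN n 1 m ((N - m + n).toNat + 1) (by push_cast; omega),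
    Finset.sum_range_succ', Finset.sum_eq_zero]
  · simp
  · intro k _
    rw [iterate_der_one (Nat.succ_ne_zero k), mul_zero, smul_zero]

@[simp] theorem coeff_fn_mul (a : A) (Q : PDO A) (m : ℤ) :
    (fn a * Q).coeff m = a * Q.coeff m := by
  obtain ⟨N, hN⟩ := exists_ordLE Q
  rw [fn, coeff_monomial_mul 0 a hN m ((N - m).toNat + 1) (by push_cast; omega),
    Finset.sum_range_succ', Finset.sum_eq_zero]
  · simp
  · intro k _
    rw [Ring.choose_zero_succ, zero_smul]

theorem coeff_del_one_mul (Q : PDO A) (m : ℤ) :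
    (del 1 * Q).coeff m = Q.coeff (m - 1) + δ (Q.coeff m) := by
  obtain ⟨N, hN⟩ := exists_ordLE Q
  rw [del, coeff_monomial_mul 1 1 hN m ((N - m + 1).toNat + 2) (by push_cast; omega),
    Finset.sum_range_succ', Finset.sum_range_succ', Finset.sum_eq_zero]
  · simp [add_comm]
  · intro k _
    have h : Ring.choose (1 : ℤ) (k + 1 + 1) = 0 := by
      have := Ring.choose_natCast (R := ℤ) 1 (k + 1 + 1)
      rw [Nat.choose_eq_zero_of_lt (by omega)] at this
      simpa using this
    rw [h, zero_smul]

/-- The leading coefficient of ∂Q is that of Q. This cancellation carries facts about ∂ over to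
negative powers of ∂. -/
theorem del_one_mul_injective {Q : PDO A} (h : del 1 * Q = 0) : Q = 0 := by
  obtain ⟨N, hN⟩ := exists_ordLE Q
  have key : ∀ k : ℕ, Q.OrdLE (N - k) := by
    intro k
    induction k with
    | zero => simpa using hN
    | succ k ih =>
      intro i hi
      have h1 := coeff_del_one_mul Q (i + 1)
      rwa [h, coeff_zero', ih (i + 1) (by push_cast at hi; omega), map_zero, add_zero,
        add_sub_cancel_right, eq_comm] at h1
  ext m
  exact key (N - m + 1).toNat m (by omega)

/-- Pascal's rule for the generalized binomial coefficients. -/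
theorem del_succ_mul (n : ℤ) (Q : PDO A) : del (n + 1) * Q = del 1 * (del n * Q) := by
  ext m
  obtain ⟨N, hN⟩ := exists_ordLE Q
  rw [coeff_del_one_mul]
  simp only [del]
  set K := (N - m + n + 1).toNat + 1 with hK
  rw [coeff_monomial_mul (n + 1) 1 hN m (K + 1) (by push_cast; omega),
    coeff_monomial_mul n 1 hN (m - 1) (K + 1) (by push_cast; omega),
    coeff_monomial_mul n 1 hN m K (by omega), Finset.sum_range_succ',
    Finset.sum_range_succ' (fun k => Ring.choose n k • _), map_sum, add_right_comm,
    ← Finset.sum_add_distrib]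
  congr 1
  · refine Finset.sum_congr rfl fun k _ => ?_
    simp only [one_mul]
    rw [Ring.choose_succ_succ, add_smul, map_zsmul,
      show m - (n + 1) + ((k + 1 : ℕ) : ℤ) = m - n + k by
        push_cast; ring, show m - 1 - n + ((k + 1 : ℕ) : ℤ) = m - n + k by push_cast; ring, add_comm, Function.iterate_succ_apply']
  · simp [sub_sub, add_comm]

theorem OrdLE.mul {P Q : PDO A} {M N : ℤ} (hP : P.OrdLE M) (hQ : Q.OrdLE N) :
    (P * Q).OrdLE (M + N) := by
  intro m hm
  refine finsum_eq_zero_of_forall_eq_zero fun p => ?_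
  by_cases h : M < p.1
  · rw [hP _ h, zero_mul, smul_zero]
  · rw [hQ _ (by omega), iterate_map_zero, mul_zero, smul_zero]

theorem coeff_mul_top {P Q : PDO A} {M N : ℤ} (hP : P.OrdLE M) (hQ : Q.OrdLE N) :
    (P * Q).coeff (M + N) = P.coeff M * Q.coeff N := by
  rw [coeff_mul_eq_finsum, finsum_eq_single _ ((M, 0) : ℤ × ℕ)]
  · simp
  · rintro ⟨i, k⟩ hik
    by_cases h : M < i
    · simp only [hP _ h, zero_mul, smul_zero]
    · have : N < M + N - i + k := by
        by_contra hc
        exact hik (by ext <;> simp only <;> omega)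
      simp only [hQ _ this, iterate_map_zero, mul_zero, smul_zero]

theorem fn_mul_monomial (a b : A) (n : ℤ) : fn a * monomial n b = monomial n (a * b) := by
  ext m
  simp [coeff_monomial]

theorem fn_mul_del (a : A) (n : ℤ) : fn a * del n = monomial n a := by
  rw [del, fn_mul_monomial, mul_one]

theorem del_one_mul_monomial (n : ℤ) (b : A) :
    del 1 * monomial n b = monomial (n + 1) b + monomial n (δ b) := by
  ext m
  rw [coeff_del_one_mul, coeff_add]
  simp only [coeff_monomial, sub_eq_iff_eq_add]
  congr 1
  split_ifs <;> simp

theorem del_zero_mul (Q : PDO A) : del 0 * Q = Q := by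
  ext m
  exact (coeff_fn_mul 1 Q m).trans (one_mul _)

theorem fn_mul_assoc (a : A) (Q R : PDO A) : (fn a * Q) * R = fn a * (Q * R) := by
  ext m
  rw [coeff_fn_mul, coeff_mul_eq_finsum, coeff_mul_eq_finsum, mul_finsum' _ _ (comp_finite δ Q R m)]
  refine finsum_congr fun p => ?_
  rw [coeff_fn_mul, mul_assoc, mul_smul_comm]

/-- `Q ↦ (P Q) R - P (Q R)` as an additive map. -/
def assocMid (P R : PDO A) : PDO A →+ PDO A :=
  (AddMonoidHom.mulRight R).comp (AddMonoidHom.mulLeft P) -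
    (AddMonoidHom.mulLeft P).comp (AddMonoidHom.mulRight R)

/-- The middle factor may be taken to be b∂ⁿ, where the claim is the Leibniz rule ∂b = b∂ + b'. -/
theorem del_one_mul_assoc (Q R : PDO A) : (del 1 * Q) * R = del 1 * (Q * R) := by
  obtain ⟨N, hN⟩ := exists_ordLE R
  refine sub_eq_zero.1 (eq_zero_of_monomial (assocMid (del 1) R) (1 + N) (fun P M hP => ?_)
    (fun n b => ?_) Q)
  · refine OrdLE.sub ((((ordLE_del 1).mul hP).mul hN).mono (by omega))
      (((ordLE_del 1).mul (hP.mul hN)).mono (by omega))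
  · change (del 1 * monomial n b) * R - del 1 * (monomial n b * R) = 0
    have h1 : del 1 * (fn b * (del n * R)) = fn b * (del 1 * (del n * R)) +
        fn (δ b) * (del n * R) := by
      ext m
      simp only [coeff_del_one_mul, coeff_fn_mul, coeff_add, Derivation.leibniz, smul_eq_mul]
      ring
    rw [del_one_mul_monomial, ← fn_mul_del b, ← fn_mul_del b, ← fn_mul_del (δ b), add_mul,
      fn_mul_assoc, fn_mul_assoc, fn_mul_assoc, h1, del_succ_mul, sub_self]

/-- Upwards, one more ∂ is split off. Downwards, both sides agree after left multiplication by ∂,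
which is injective. -/
theorem del_mul_assoc (n : ℤ) (Q R : PDO A) : (del n * Q) * R = del n * (Q * R) := by
  induction n using Int.induction_on generalizing Q R with
  | zero => rw [del_zero_mul, del_zero_mul]
  | succ n ih => rw [del_succ_mul, del_succ_mul, del_one_mul_assoc, ih]
  | pred n ih =>
    have h : ∀ Q : PDO A, del 1 * (del (-(n : ℤ) - 1) * Q) = del (-(n : ℤ)) * Q := fun Q => by
      rw [← del_succ_mul, sub_add_cancel]
    rw [← sub_eq_zero]
    refine del_one_mul_injective ?_
    rw [mul_sub, ← del_one_mul_assoc, h, h, ih, sub_self]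

protected theorem mul_assoc' (P Q R : PDO A) : (P * Q) * R = P * (Q * R) := by
  obtain ⟨N, hN⟩ := exists_ordLE R
  obtain ⟨M, hM⟩ := exists_ordLE Q
  refine sub_eq_zero.1 (eq_zero_of_monomial ((AddMonoidHom.mulRight R).comp
    (AddMonoidHom.mulRight Q) - AddMonoidHom.mulRight (Q * R)) (M + N) (fun P K hP => ?_)
    (fun n a => ?_) P)
  · exact OrdLE.sub (((hP.mul hM).mul hN).mono (by omega)) ((hP.mul (hM.mul hN)).mono (by omega))
  · change (monomial n a * Q) * R - monomial n a * (Q * R) = 0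
    rw [← fn_mul_del, fn_mul_assoc, fn_mul_assoc, fn_mul_assoc, del_mul_assoc, sub_self]

instance instRing : Ring (PDO A) where
  one := del 0
  one_mul := del_zero_mul
  mul_one P := by
    ext m
    exact (coeff_mul_del P 0 m).trans (by rw [sub_zero])
  mul_assoc := PDO.mul_assoc'
  __ := (inferInstance : NonUnitalNonAssocRing (PDO A))
  zsmul := (· • ·)
  zsmul_zero' := SubNegMonoid.zsmul_zero'
  zsmul_succ' := SubNegMonoid.zsmul_succ'
  zsmul_neg' := SubNegMonoid.zsmul_neg'
  sub_eq_add_neg := sub_eq_add_neg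
  neg_add_cancel := neg_add_cancel

theorem one_def : (1 : PDO A) = del 0 := rfl

theorem fn_one : (fn 1 : PDO A) = 1 := rfl

theorem coeff_one (i : ℤ) : (1 : PDO A).coeff i = if i = 0 then 1 else 0 := rfl

theorem ordLE_one : (1 : PDO A).OrdLE 0 := ordLE_del 0

theorem del_mul_del (m n : ℤ) : (del m * del n : PDO A) = del (m + n) := by
  ext i
  rw [coeff_mul_del, coeff_del, coeff_del]
  simp only [sub_eq_iff_eq_add]

theorem pow_eq (P : PDO A) (n : ℕ) : pow δ P n = P ^ n := by
  induction n with
  | zero => rfl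
  | succ n ih => rw [pow_succ', ← ih]; rfl

theorem fn_mul_fn (a b : A) : fn a * fn b = fn (a * b) := fn_mul_monomial a b 0

/-- Functions, as a ring homomorphism into the operators. -/
def fnHom : A →+* PDO A where
  toFun := fn
  map_one' := rfl
  map_mul' a b := (fn_mul_fn a b).symm
  map_zero' := monomial_zero 0
  map_add' := monomial_add 0

theorem fn_add (a b : A) : fn (a + b) = fn a + fn b := map_add fnHom a b
theorem fn_sub (a b : A) : fn (a - b) = fn a - fn b := map_sub fnHom a b
theorem fn_neg (a : A) : fn (-a) = -fn a := map_neg fnHom a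
@[simp] theorem fn_zero : (fn 0 : PDO A) = 0 := monomial_zero 0
theorem fn_comm (a b : A) : fn a * fn b = fn b * fn a := by rw [fn_mul_fn, fn_mul_fn, mul_comm]

/-- The Leibniz rule `∂ f = f ∂ + f'`. -/
theorem del_mul_fn (f : A) : del 1 * fn f = fn f * del 1 + fn (δ f) := by
  rw [fn_mul_del, fn, del_one_mul_monomial]; rfl

theorem del_mul_del_neg : (del 1 * del (-1) : PDO A) = 1 := by rw [del_mul_del]; rfl
theorem del_neg_mul_del : (del (-1) * del 1 : PDO A) = 1 := by rw [del_mul_del]; rfl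

end comp
end PDO

section

namespace PDO
variable [DiffAlg A]
local notation "δ" => (DiffAlg.der : Derivation ℚ A A)

/-! ### The formal adjoint. -/

section adjoint

theorem coeff_adj {P : PDO A} {N : ℤ} (hP : P.OrdLE N) (m : ℤ) (K : ℕ) (hK : N < m + K) :
    (adj δ P).coeff m = ∑ k ∈ Finset.range K,
      (Int.negOnePow (m + k) : ℤ) • Ring.choose (m + k) k • δ^[k] (P.coeff (m + k)) := by
  change ∑ᶠ k : ℕ, _ = _
  rw [finsum_eq_sum_of_support_subset (s := Finset.range K)]
  intro k h
  rw [Function.mem_support] at h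
  rw [Finset.coe_range, Set.mem_Iio]
  by_contra hc
  apply h
  rw [hP _ (by omega), iterate_map_zero, smul_zero, smul_zero]

theorem OrdLE.adj {P : PDO A} {N : ℤ} (hP : P.OrdLE N) : (adj δ P).OrdLE N := by
  intro m hm
  rw [coeff_adj hP m 0 (by simpa using hm), Finset.sum_range_zero]

theorem coeff_adj_top {P : PDO A} {N : ℤ} (hP : P.OrdLE N) :
    (adj δ P).coeff N = (Int.negOnePow N : ℤ) • P.coeff N := by
  rw [coeff_adj hP N 1 (by simp), Finset.sum_range_one]
  simp

/-- The formal adjoint as an additive map. -/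
def adjHom : PDO A →+ PDO A :=
  AddMonoidHom.mk' (adj δ) fun P Q => by
    obtain ⟨M, hM⟩ := exists_ordLE P
    obtain ⟨N, hN⟩ := exists_ordLE Q
    have hP := hM.mono (le_max_left M N)
    have hQ := hN.mono (le_max_right M N)
    ext m
    have hK : max M N < m + ((max M N - m).toNat + 1 : ℕ) := by push_cast; omega
    rw [coeff_add, coeff_adj hP m _ hK, coeff_adj hQ m _ hK, coeff_adj (hP.add hQ) m _ hK,
      ← Finset.sum_add_distrib]
    refine Finset.sum_congr rfl fun k _ => ?_
    rw [coeff_add, iterate_der_add, smul_add, smul_add]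

theorem adjHom_apply (P : PDO A) : adjHom P = adj δ P := rfl

theorem adj_add (P Q : PDO A) : adj δ (P + Q) = adj δ P + adj δ Q := map_add adjHom P Q
theorem adj_sub (P Q : PDO A) : adj δ (P - Q) = adj δ P - adj δ Q := map_sub adjHom P Q

theorem adj_monomial (n : ℤ) (b : A) :
    adj δ (monomial n b) = (Int.negOnePow n : ℤ) • (del n * fn b) := by
  ext m
  rw [coeff_zsmul, coeff_adj (ordLE_monomial n b) m ((n - m).toNat + 1) (by push_cast; omega), del,
    coeff_monomial_mul n 1 (ordLE_fn b) m ((n - m).toNat + 1) (by push_cast; omega),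
    Finset.smul_sum]
  refine Finset.sum_congr rfl fun k _ => ?_
  rw [coeff_monomial, coeff_fn, one_mul]
  by_cases h : m + k = n
  · rw [if_pos h, if_pos (by omega), h]
  · simp only [if_neg h, if_neg (show ¬(m - n + k = 0) by omega), iterate_map_zero, smul_zero]

theorem adj_fn (b : A) : adj δ (fn b) = fn b := by
  rw [fn, adj_monomial, Int.negOnePow_zero, Units.val_one, one_smul]
  exact one_mul (fn b)

theorem adj_fn_mul (a : A) (Q : PDO A) : adj δ (fn a * Q) = adj δ Q * fn a := by
  refine sub_eq_zero.1 (eq_zero_of_monomial (adjHom.comp (AddMonoidHom.mulLeft (fn a)) -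
    (AddMonoidHom.mulRight (fn a)).comp adjHom) 0 (fun P N hP => ?_) (fun n b => ?_) Q)
  · exact OrdLE.sub (((ordLE_fn a).mul hP).adj.mono (by omega))
      ((hP.adj.mul (ordLE_fn a)).mono (by omega))
  · change adj δ (fn a * monomial n b) - adj δ (monomial n b) * fn a = 0
    rw [fn_mul_monomial, adj_monomial, adj_monomial, smul_mul_assoc, mul_assoc, fn_mul_fn,
      mul_comm, sub_self]

theorem adj_del_one_mul (Q : PDO A) : adj δ (del 1 * Q) = -(adj δ Q * del 1) := by
  have h := eq_zero_of_monomial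
    (adjHom.comp (AddMonoidHom.mulLeft (del 1 : PDO A)) +
      (AddMonoidHom.mulRight (del 1 : PDO A)).comp (adjHom (A := A))) 1
    (fun P N hP => ?_) (fun n b => ?_) Q
  · exact eq_neg_of_add_eq_zero_left h
  · exact OrdLE.add (((ordLE_del 1).mul hP).adj.mono (by omega))
      ((hP.adj.mul (ordLE_del 1)).mono (by omega))
  · change adj δ (del 1 * monomial n b) + adj δ (monomial n b) * del 1 = 0
    rw [del_one_mul_monomial, adj_add, adj_monomial, adj_monomial, adj_monomial, add_comm n 1,
      ← del_mul_del, add_comm 1 n, Int.negOnePow_succ, mul_assoc, smul_mul_assoc, mul_assoc,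
      Units.val_neg, neg_smul, ← mul_assoc, (del_mul_del 1 n).trans (add_comm n 1 ▸
      (del_mul_del n 1).symm), mul_assoc, del_mul_fn, mul_add, smul_add]
    abel

theorem adj_del_mul (n : ℤ) (Q : PDO A) :
    adj δ (del n * Q) = (Int.negOnePow n : ℤ) • (adj δ Q * del n) := by
  induction n using Int.induction_on generalizing Q with
  | zero => rw [← one_def, one_mul, mul_one, Int.negOnePow_zero, Units.val_one, one_smul]
  | succ n ih =>
    rw [del_succ_mul, adj_del_one_mul, ih, Int.negOnePow_succ, Units.val_neg, neg_smul,
      smul_mul_assoc, mul_assoc, del_mul_del]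
  | pred n ih =>
    have h := adj_del_one_mul (del (-(n : ℤ) - 1) * Q)
    rw [← del_succ_mul, sub_add_cancel, ih] at h
    have h2 := congrArg (· * del (-1)) h
    simp only [neg_mul, mul_assoc, smul_mul_assoc, del_mul_del] at h2
    rw [show (1 : ℤ) + -1 = 0 from rfl, ← one_def, mul_one, ← sub_eq_add_neg] at h2
    rw [Int.negOnePow_sub, Int.negOnePow_one, mul_neg_one, Units.val_neg, neg_smul, h2, neg_neg]

/-- The left factor may be taken to be a∂ⁿ, which leaves the cases of a function and of a power of
∂. -/
theorem adj_mul (P Q : PDO A) : adj δ (P * Q) = adj δ Q * adj δ P := by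
  obtain ⟨N, hN⟩ := exists_ordLE Q
  refine sub_eq_zero.1 (eq_zero_of_monomial (adjHom.comp (AddMonoidHom.mulRight Q) -
    (AddMonoidHom.mulLeft (adj δ Q)).comp adjHom) N (fun P M hP => ?_) (fun n a => ?_) P)
  · exact OrdLE.sub (hP.mul hN).adj ((hN.adj.mul hP.adj).mono (by omega))
  · change adj δ (monomial n a * Q) - adj δ Q * adj δ (monomial n a) = 0
    rw [adj_monomial, ← fn_mul_del, mul_assoc, adj_fn_mul, adj_del_mul, mul_smul_comm,
      smul_mul_assoc, mul_assoc, sub_self]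

theorem adj_del (n : ℤ) : adj δ (del n) = (Int.negOnePow n : ℤ) • del n := by
  rw [del, adj_monomial, fn_one, mul_one, del]

theorem adj_del_one : adj δ (del 1) = -del 1 := by
  rw [adj_del]; simp

theorem adj_del_neg_one : adj δ (del (-1)) = -del (-1) := by
  rw [adj_del]; simp

theorem adj_pow (P : PDO A) (n : ℕ) : adj δ (P ^ n) = adj δ P ^ n := by
  induction n with
  | zero => exact adj_fn 1
  | succ n ih => rw [pow_succ, adj_mul, ih, pow_succ']

/-- At ∂⁻¹ the binomials in front of the derivative terms are (k choose k+1) = 0, so no total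
derivatives appear. This exact antisymmetry drives all residue arguments below. -/
theorem res_adj (P : PDO A) : (adj δ P).coeff (-1) = -P.coeff (-1) := by
  obtain ⟨N, hN⟩ := exists_ordLE P
  rw [coeff_adj hN (-1) ((N + 1).toNat + 1) (by push_cast; omega), Finset.sum_range_succ',
    Finset.sum_eq_zero]
  · simp
  · intro k _
    have h : Ring.choose (-1 + ((k + 1 : ℕ) : ℤ)) (k + 1) = 0 := by
      have := Ring.choose_natCast (R := ℤ) k (k + 1)
      rw [Nat.choose_eq_zero_of_lt (by omega)] at this
      rw [show -1 + ((k + 1 : ℕ) : ℤ) = k by push_cast; ring, this]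
      rfl
    rw [h, zero_smul, smul_zero]

end adjoint

/-! ### Differential operators and their action on functions. -/

section differential

/-- `P` is a differential operator. -/
def IsDiff (P : PDO A) : Prop := ∀ i, i < 0 → P.coeff i = 0

theorem IsDiff.add {P Q : PDO A} (hP : P.IsDiff) (hQ : Q.IsDiff) : (P + Q).IsDiff :=
  fun i hi => by simp [hP i hi, hQ i hi]

theorem IsDiff.sub {P Q : PDO A} (hP : P.IsDiff) (hQ : Q.IsDiff) : (P - Q).IsDiff :=
  fun i hi => by simp [hP i hi, hQ i hi]

theorem isDiff_fn (f : A) : (fn f).IsDiff := fun i hi => by rw [coeff_fn, if_neg hi.ne]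

theorem isDiff_one : (1 : PDO A).IsDiff := isDiff_fn 1

theorem isDiff_del_one : (del 1 : PDO A).IsDiff := fun i hi => by
  rw [coeff_del, if_neg (by omega)]

theorem isDiff_plus (P : PDO A) : (plus P).IsDiff := fun i hi => by
  rw [coeff_plus, if_neg (by omega)]

theorem IsDiff.mul {P Q : PDO A} (hP : P.IsDiff) (hQ : Q.IsDiff) : (P * Q).IsDiff := by
  intro m hm
  refine finsum_eq_zero_of_forall_eq_zero fun ⟨i, k⟩ => ?_
  simp only
  rcases lt_or_ge i 0 with hi | hi
  · rw [hP i hi, zero_mul, smul_zero]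
  rcases lt_or_ge (m - i + k) 0 with hj | hj
  · rw [hQ _ hj, iterate_map_zero, mul_zero, smul_zero]
  · lift i to ℕ using hi
    have := Ring.choose_natCast (R := ℤ) i k
    rw [Nat.choose_eq_zero_of_lt (by omega)] at this
    rw [this, Nat.cast_zero, zero_smul]

theorem plus_add_minus (P : PDO A) : plus P + minus P = P := by
  ext i
  rw [coeff_add, coeff_plus, coeff_minus]
  split_ifs <;> first | omega | simp

theorem plus_sub (P Q : PDO A) : plus (P - Q) = plus P - plus Q := by
  ext i; simp only [coeff_plus, coeff_sub]; split_ifs <;> simp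

theorem minus_sub (P Q : PDO A) : minus (P - Q) = minus P - minus Q := by
  ext i; simp only [coeff_minus, coeff_sub]; split_ifs <;> simp

theorem minus_eq_zero {P : PDO A} (hP : P.IsDiff) : minus P = 0 := by
  ext i; rw [coeff_minus]; split_ifs with h
  · exact hP i h
  · rfl

theorem minus_eq_self {P : PDO A} (hP : P.OrdLE (-1)) : minus P = P := by
  ext i; rw [coeff_minus]; split_ifs with h
  · rfl
  · exact (hP i (by omega)).symm

/-- For m < 0 ≤ m + k the binomial (m+k choose k) vanishes, so the adjoint does not mix the two
parts. -/
theorem adj_plus (P : PDO A) : adj δ (plus P) = plus (adj δ P) := by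
  obtain ⟨N, hN⟩ := exists_ordLE P
  have hN' : (plus P).OrdLE N := fun i hi => by rw [coeff_plus, hN i hi, ite_self]
  ext m
  rw [coeff_plus, coeff_adj hN' m ((N - m).toNat + 1) (by push_cast; omega),
    coeff_adj hN m ((N - m).toNat + 1) (by push_cast; omega)]
  split_ifs with h
  · refine Finset.sum_congr rfl fun k _ => ?_
    rw [coeff_plus, if_pos (by omega)]
  · refine Finset.sum_eq_zero fun k _ => ?_
    rw [coeff_plus]
    split_ifs with h1
    · obtain ⟨j, hj⟩ := Int.eq_ofNat_of_zero_le h1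
      have := Ring.choose_natCast (R := ℤ) j k
      rw [Nat.choose_eq_zero_of_lt (by omega)] at this
      rw [hj, this, Nat.cast_zero, zero_smul, smul_zero]
    · rw [iterate_map_zero, smul_zero, smul_zero]

/-- The function `∑_{i ≥ 0} P_i f^(i)`. -/
def app (P : PDO A) (f : A) : A := (P * fn f).coeff 0

theorem act_eq_app (P : PDO A) (f : A) : act δ P f = app P f := by
  obtain ⟨N, hN⟩ := exists_ordLE P
  rw [app, fn, coeff_mul_monomial hN 0 f 0 (N.toNat + 1) (by push_cast; omega), act,
    finsum_eq_sum_of_support_subset (s := Finset.range (N.toNat + 1))]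
  · refine Finset.sum_congr rfl fun k _ => ?_
    have := Ring.choose_natCast (R := ℤ) k k
    rw [Nat.choose_self] at this
    rw [show (0 : ℤ) - 0 + k = k by ring, this, Nat.cast_one, one_smul]
  · intro k h
    rw [Function.mem_support] at h
    rw [Finset.coe_range, Set.mem_Iio]
    by_contra hc
    exact h (by rw [hN _ (by omega), zero_mul])

theorem app_add (P Q : PDO A) (f : A) : app (P + Q) f = app P f + app Q f := by
  rw [app, add_mul, coeff_add]; rfl

theorem app_sub (P Q : PDO A) (f : A) : app (P - Q) f = app P f - app Q f := by
  rw [app, sub_mul, coeff_sub]; rfl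

theorem app_sub_right (P : PDO A) (f g : A) : app P (f - g) = app P f - app P g := by
  rw [app, fn_sub, mul_sub, coeff_sub]; rfl

theorem app_fn_mul (a : A) (P : PDO A) (f : A) : app (fn a * P) f = a * app P f := by
  rw [app, mul_assoc, coeff_fn_mul]; rfl

theorem app_fn (a f : A) : app (fn a) f = a * f := by
  rw [app, fn_mul_fn, coeff_fn, if_pos rfl]

theorem app_one (f : A) : app 1 f = f := by
  rw [← fn_one, app_fn, one_mul]

theorem app_del_one (f : A) : app (del 1) f = δ f := by
  rw [app, coeff_del_one_mul, coeff_fn, coeff_fn, if_neg (by norm_num), if_pos rfl, zero_add]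

theorem app_eq_zero {P : PDO A} (hP : P.OrdLE (-1)) (f : A) : app P f = 0 :=
  hP.mul (ordLE_fn f) 0 (by norm_num)

theorem app_plus (P : PDO A) (f : A) : app (plus P) f = app P f := by
  conv_rhs => rw [← plus_add_minus P, app_add, app_eq_zero (ordLE_minus P), add_zero]

/-- Q minus its constant term is a differential operator times ∂, and so contributes nothing to the
constant term of PQ. -/
theorem coeff_zero_mul {P Q : PDO A} (hP : P.IsDiff) (hQ : Q.IsDiff) :
    (P * Q).coeff 0 = app P (Q.coeff 0) := by
  have h1 : ((Q - fn (Q.coeff 0)) * del (-1)).IsDiff := by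
    intro i hi
    rw [coeff_mul_del, coeff_sub, coeff_fn]
    split_ifs with h
    · rw [h, sub_self]
    · rw [hQ _ (by omega), sub_zero]
  have h2 : P * Q = P * fn (Q.coeff 0) + P * ((Q - fn (Q.coeff 0)) * del (-1)) * del 1 := by
    rw [mul_assoc, mul_assoc, del_neg_mul_del, mul_one, ← mul_add, add_sub_cancel]
  rw [h2, coeff_add, coeff_mul_del, (hP.mul h1) _ (by norm_num), add_zero, app]

theorem app_mul {P Q : PDO A} (hP : P.IsDiff) (hQ : Q.IsDiff) (f : A) :
    app (P * Q) f = app P (app Q f) := by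
  rw [app, mul_assoc, coeff_zero_mul hP (hQ.mul (isDiff_fn f))]; rfl

end differential

/-! ### Derivations acting on coefficients. -/

section mapDer

/-- Coefficientwise application of an additive map. -/
def mapCoeff (φ : A →+ A) (P : PDO A) : PDO A :=
  ⟨fun i => φ (P.coeff i), by
    obtain ⟨M, hM⟩ := P.2
    exact ⟨M, fun i hi => (congrArg φ (hM i hi)).trans (map_zero φ)⟩⟩

theorem coeff_mapCoeff (φ : A →+ A) (P : PDO A) (i : ℤ) :
    (mapCoeff φ P).coeff i = φ (P.coeff i) := rfl

variable (D : Derivation ℚ A A)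

@[simp] theorem coeff_mapDer (P : PDO A) (i : ℤ) : (mapDer D P).coeff i = D (P.coeff i) := rfl

theorem OrdLE.mapDer {P : PDO A} {N : ℤ} (h : P.OrdLE N) : (mapDer D P).OrdLE N :=
  fun i hi => by rw [coeff_mapDer, h i hi, map_zero]

theorem mapDer_add (P Q : PDO A) : mapDer D (P + Q) = mapDer D P + mapDer D Q := by
  ext i; simp

theorem mapDer_sub (P Q : PDO A) : mapDer D (P - Q) = mapDer D P - mapDer D Q := by
  ext i; simp

theorem mapDer_sum {ι : Type*} (s : Finset ι) (P : ι → PDO A) :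
    mapDer D (∑ a ∈ s, P a) = ∑ a ∈ s, mapDer D (P a) := by
  ext i; simp

theorem mapDer_fn (f : A) : mapDer D (fn f) = fn (D f) := by
  ext i; rw [coeff_mapDer, coeff_fn, coeff_fn]; split_ifs <;> simp

theorem mapDer_del (n : ℤ) : mapDer D (del n) = 0 := by
  ext i; rw [coeff_mapDer, coeff_del]; split_ifs <;> simp

theorem mapDer_one : mapDer D 1 = 0 := mapDer_del D 0

variable {D}

theorem iterate_comm (hD : ∀ f, D (δ f) = δ (D f)) (k : ℕ) (f : A) : D (δ^[k] f) = δ^[k] (D f) :=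
  ((show Function.Commute (⇑D) (⇑δ) from hD).iterate_right k) f

theorem mapDer_mul (hD : ∀ f, D (δ f) = δ (D f)) (P Q : PDO A) :
    mapDer D (P * Q) = mapDer D P * Q + P * mapDer D Q := by
  ext m
  rw [coeff_add, coeff_mapDer, coeff_mul_eq_finsum, coeff_mul_eq_finsum, coeff_mul_eq_finsum,
    ← finsum_add_distrib (comp_finite δ _ Q m) (comp_finite δ P _ m)]
  refine ((D : A →ₗ[ℚ] A).toAddMonoidHom.map_finsum (comp_finite δ P Q m)).trans
    (finsum_congr fun p => ?_)
  change D (_ • _) = _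
  rw [map_zsmul, Derivation.leibniz, coeff_mapDer, coeff_mapDer, iterate_comm hD, smul_add,
    smul_eq_mul, smul_eq_mul, add_comm, mul_comm (δ^[p.2] _)]

end mapDer

end PDO

end

section

/-! ### The shift t ↦ t - 2[z] as the solution of a flow equation in z. -/

section shift

open Finset

theorem sum_antidiagonal_left_comm {M : Type*} [AddCommMonoid M] (F : ℕ → ℕ → ℕ → M) (m : ℕ) :
    ∑ p ∈ antidiagonal m, ∑ q ∈ antidiagonal p.2, F p.1 q.1 q.2 =
      ∑ p ∈ antidiagonal m, ∑ q ∈ antidiagonal p.2, F q.1 p.1 q.2 := by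
  rw [sum_sigma', sum_sigma']
  refine sum_nbij' (fun x => ⟨(x.2.1, x.1.1 + x.2.2), (x.1.1, x.2.2)⟩)
    (fun x => ⟨(x.2.1, x.1.1 + x.2.2), (x.1.1, x.2.2)⟩) ?_ ?_ ?_ ?_ ?_
  all_goals
    rintro ⟨⟨a, b⟩, ⟨c, d⟩⟩ h
    simp only [mem_sigma, HasAntidiagonal.mem_antidiagonal] at h
    obtain ⟨h1, rfl⟩ := h
  · simp only [mem_sigma, HasAntidiagonal.mem_antidiagonal, and_true]; omega
  · simp only [mem_sigma, HasAntidiagonal.mem_antidiagonal, and_true]; omega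
  · rfl
  · rfl
  · rfl

theorem sum_antidiagonal_assoc {M : Type*} [AddCommMonoid M] (F : ℕ → ℕ → ℕ → M) (m : ℕ) :
    ∑ p ∈ antidiagonal m, ∑ q ∈ antidiagonal p.1, F q.1 q.2 p.2 =
      ∑ p ∈ antidiagonal m, ∑ q ∈ antidiagonal p.2, F p.1 q.1 q.2 := by
  rw [sum_sigma', sum_sigma']
  refine sum_nbij' (fun x => ⟨(x.2.1, x.2.2 + x.1.2), (x.2.2, x.1.2)⟩)
    (fun x => ⟨(x.1.1 + x.2.1, x.2.2), (x.1.1, x.2.1)⟩) ?_ ?_ ?_ ?_ ?_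
  all_goals
    rintro ⟨⟨a, b⟩, ⟨c, d⟩⟩ h
    simp only [mem_sigma, HasAntidiagonal.mem_antidiagonal] at h
    obtain ⟨h1, rfl⟩ := h
  · simp only [mem_sigma, HasAntidiagonal.mem_antidiagonal, and_true]; omega
  · simp only [mem_sigma, HasAntidiagonal.mem_antidiagonal, and_true]; omega
  · rfl
  · rfl
  · rfl

theorem nsmul_cancel {m : ℕ} (hm : m ≠ 0) {a b : A} (h : m • a = m • b) : a = b := by
  have h2 : (m : ℚ) • a = (m : ℚ) • b := by rw [Nat.cast_smul_eq_nsmul, Nat.cast_smul_eq_nsmul, h]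
  have h3 := congrArg (((m : ℚ)⁻¹) • ·) h2
  simpa [smul_smul, inv_mul_cancel₀ (Nat.cast_ne_zero.2 hm : (m : ℚ) ≠ 0)] using h3

variable (D : ℕ → Derivation ℚ A A)

/-- The coefficient `-2 ∂/∂t_j` (`j` odd) or `0` (`j` even) of `z^j` in the generator
`-2 ∑_n z^(2n+1) ∂/∂t_{2n+1}` of the flow `z d/dz` of the shift. -/
def flow (j : ℕ) : Derivation ℚ A A := if Odd j then (-2 : ℚ) • D (j / 2) else 0

theorem flow_odd (n : ℕ) : flow D (2 * n + 1) = (-2 : ℚ) • D n := by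
  rw [flow, if_pos ⟨n, rfl⟩, show (2 * n + 1) / 2 = n by omega]

theorem flow_even {j : ℕ} (hj : ¬Odd j) : flow D j = 0 := if_neg hj

theorem flow_zero : flow D 0 = 0 := flow_even D (by decide)

variable {D} in
theorem comm_flow {δ : A → A} (h : ∀ n f, δ (D n f) = D n (δ f)) (hq : ∀ (q : ℚ) f, δ (q • f) = q • δ f)
    (h0 : δ 0 = 0) (j : ℕ) (f : A) : δ (flow D j f) = flow D j (δ f) := by
  rw [flow]
  split_ifs
  · rw [Derivation.smul_apply, hq, h, Derivation.smul_apply]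
  · exact h0

variable {D} in
theorem flow_comm_der (hD : ∀ m n f, D m (D n f) = D n (D m f)) (n j : ℕ) (f : A) :
    D n (flow D j f) = flow D j (D n f) :=
  comm_flow (hD n) (fun q f => (D n).map_smul q f) (map_zero _) j f

variable {D} in
theorem flow_comm (hD : ∀ m n f, D m (D n f) = D n (D m f)) (i j : ℕ) (f : A) :
    flow D i (flow D j f) = flow D j (flow D i f) :=
  comm_flow (fun n f => (flow_comm_der hD n i f).symm) (fun q f => (flow D i).map_smul q f) (map_zero _) j f

/-- The operator `-2 ∑_n z^(2n+1) ∂/∂t_{2n+1}` on power series in `z`. -/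
def flowGen (g : A⟦X⟧) : A⟦X⟧ :=
  PowerSeries.mk fun m => ∑ p ∈ antidiagonal m, flow D p.1 (PowerSeries.coeff p.2 g)

theorem coeff_flowGen (g : A⟦X⟧) (m : ℕ) : PowerSeries.coeff m (flowGen D g) =
    ∑ p ∈ antidiagonal m, flow D p.1 (PowerSeries.coeff p.2 g) := PowerSeries.coeff_mk _ _

theorem flowGen_add (f g : A⟦X⟧) : flowGen D (f + g) = flowGen D f + flowGen D g := by
  ext m
  simp only [coeff_flowGen, map_add, sum_add_distrib]

theorem flowGen_sub (f g : A⟦X⟧) : flowGen D (f - g) = flowGen D f - flowGen D g := by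
  ext m
  simp only [coeff_flowGen, map_sub, sum_sub_distrib]

theorem flowGen_mul (f g : A⟦X⟧) : flowGen D (f * g) = flowGen D f * g + f * flowGen D g := by
  ext m
  rw [map_add, PowerSeries.coeff_mul, PowerSeries.coeff_mul, coeff_flowGen]
  simp only [coeff_flowGen, PowerSeries.coeff_mul, map_sum, Derivation.leibniz, smul_eq_mul,
    sum_add_distrib, sum_mul, mul_sum]
  rw [add_comm]
  congr 1
  · rw [sum_antidiagonal_assoc fun a b c => flow D a (PowerSeries.coeff b f) * PowerSeries.coeff c g]
    exact sum_congr rfl fun p _ => sum_congr rfl fun q _ => mul_comm _ _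
  · exact sum_antidiagonal_left_comm
      (fun a b c => PowerSeries.coeff b f * flow D a (PowerSeries.coeff c g)) m

/-- Solutions of `z dF/dz = -2 ∑_n z^(2n+1) ∂F/∂t_{2n+1}`. -/
def IsFlow (F : A⟦X⟧) : Prop :=
  ∀ m, m • PowerSeries.coeff m F = PowerSeries.coeff m (flowGen D F)

theorem shiftGen_coeff (g : A⟦X⟧) (m : ℕ) : PowerSeries.coeff m (shiftGen D g) =
    ∑ p ∈ antidiagonal m, (1 / p.1 : ℚ) • flow D p.1 (PowerSeries.coeff p.2 g) := by
  rw [shiftGen, PowerSeries.coeff_mk, ← sum_neg_distrib, Nat.sum_antidiagonal_eq_sum_range_succ_mk]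
  refine sum_bij_ne_zero (fun n _ _ => 2 * n + 1) ?_ ?_ ?_ ?_
  · intro n hn h
    have : 2 * n + 1 ≤ m := by
      by_contra hc
      exact h (by rw [if_neg hc, neg_zero])
    simp only [mem_range]; omega
  · intro a _ _ b _ _ h
    omega
  · intro j hj h
    have hodd : Odd j := by
      by_contra hc
      exact h (by rw [flow_even D hc]; simp)
    obtain ⟨n, rfl⟩ := hodd
    rw [mem_range] at hj
    refine ⟨n, by rw [mem_range]; omega, ?_, rfl⟩
    rw [if_pos (by omega)]
    intro h0
    apply h
    rw [flow_odd, Derivation.smul_apply, smul_smul]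
    rw [← neg_smul] at h0
    convert h0 using 2
    push_cast; ring
  · intro n hn h
    have : 2 * n + 1 ≤ m := by
      by_contra hc
      exact h (by rw [if_neg hc, neg_zero])
    rw [if_pos this, flow_odd, Derivation.smul_apply, smul_smul, ← neg_smul]
    congr 1
    push_cast; ring

variable {D}

theorem shiftGen_flowGen (hD : ∀ m n f, D m (D n f) = D n (D m f)) (g : A⟦X⟧) :
    shiftGen D (flowGen D g) = flowGen D (shiftGen D g) := by
  ext m
  simp only [shiftGen_coeff, coeff_flowGen, map_sum, smul_sum, Derivation.map_smul]
  rw [sum_antidiagonal_left_comm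
    fun a b c => (1 / a : ℚ) • flow D a (flow D b (PowerSeries.coeff c g))]
  exact sum_congr rfl fun p _ => sum_congr rfl fun q _ => by rw [flow_comm hD]

/-- Here `h` is z dg/dz. Applying z d/dz to z^(2n+1) cancels the denominators 2n+1 of the generator,
turning `shiftGen` into `flowGen`. -/
theorem coeff_nsmul_shiftGen (g h : A⟦X⟧)
    (hg : ∀ m, m • PowerSeries.coeff m g = PowerSeries.coeff m h) (m : ℕ) :
    m • PowerSeries.coeff m (shiftGen D g) =
      PowerSeries.coeff m (flowGen D g) + PowerSeries.coeff m (shiftGen D h) := by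
  rw [shiftGen_coeff, shiftGen_coeff, coeff_flowGen, ← sum_add_distrib, smul_sum]
  refine sum_congr rfl fun p hp => ?_
  rw [HasAntidiagonal.mem_antidiagonal] at hp
  rw [← hg, map_nsmul, ← hp, add_smul, smul_comm p.2]
  congr 1
  by_cases h0 : p.1 = 0
  · rw [h0, flow_zero]; simp
  · rw [← Nat.cast_smul_eq_nsmul ℚ, smul_smul, mul_one_div_cancel (Nat.cast_ne_zero.2 h0), one_smul]

/-- The exponent commutes with its z d/dz-derivative `flowGen`, so its powers are differentiated as
in the scalar case. -/
theorem nsmul_coeff_iterate (hD : ∀ m n f, D m (D n f) = D n (D m f)) (f : A) (k m : ℕ) :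
    m • PowerSeries.coeff m ((shiftGen D)^[k + 1] (PowerSeries.C f)) =
      PowerSeries.coeff m ((k + 1) • flowGen D ((shiftGen D)^[k] (PowerSeries.C f))) := by
  have hadd : ∀ (n : ℕ) (g : A⟦X⟧), shiftGen D (n • g) = n • shiftGen D g := by
    intro n g
    ext m
    rw [map_nsmul, shiftGen_coeff, shiftGen_coeff, smul_sum]
    refine sum_congr rfl fun p _ => ?_
    rw [map_nsmul, map_nsmul, smul_comm]
  induction k generalizing m with
  | zero =>
    have h0 : shiftGen D 0 = 0 := by simpa using hadd 0 0
    rw [Function.iterate_one, coeff_nsmul_shiftGen (PowerSeries.C f) 0, h0]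
    · simp
    · intro m
      rw [PowerSeries.coeff_C]
      split_ifs with h <;> simp [h]
  | succ k ih =>
    rw [Function.iterate_succ_apply', coeff_nsmul_shiftGen _ _ ih, hadd, shiftGen_flowGen hD,
      ← Function.iterate_succ_apply' (shiftGen D), ← map_add, add_comm, ← succ_nsmul]

theorem coeff_iterate_eq_zero (f : A) (k m : ℕ) (h : m < k) :
    PowerSeries.coeff m ((shiftGen D)^[k] (PowerSeries.C f)) = 0 := by
  induction k generalizing m with
  | zero => omega
  | succ k ih =>
    rw [Function.iterate_succ_apply', shiftGen_coeff]
    refine sum_eq_zero fun p hp => ?_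
    rw [HasAntidiagonal.mem_antidiagonal] at hp
    by_cases h0 : p.1 = 0
    · rw [h0, flow_zero]; simp
    · rw [ih _ (by omega), map_zero, smul_zero]

theorem coeff_shift_of_lt (f : A) {m K : ℕ} (hK : m < K) : PowerSeries.coeff m (shift D f) =
    ∑ k ∈ range K, (1 / (Nat.factorial k) : ℚ) •
      PowerSeries.coeff m ((shiftGen D)^[k] (PowerSeries.C f)) := by
  rw [shift, PowerSeries.coeff_mk]
  refine sum_subset (range_mono hK) fun k _ hk => ?_
  rw [mem_range] at hk
  rw [coeff_iterate_eq_zero f k m (by omega), smul_zero]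

/-- Termwise differentiation of the exponential, with (k+1)/(k+1)! = 1/k!. -/
theorem isFlow_shift (hD : ∀ m n f, D m (D n f) = D n (D m f)) (f : A) : IsFlow D (shift D f) := by
  intro m
  have h : ∀ p ∈ antidiagonal m, flow D p.1 (PowerSeries.coeff p.2 (shift D f)) =
      ∑ k ∈ range m, (1 / (Nat.factorial k) : ℚ) •
        flow D p.1 (PowerSeries.coeff p.2 ((shiftGen D)^[k] (PowerSeries.C f))) := by
    intro p hp
    rw [HasAntidiagonal.mem_antidiagonal] at hp
    by_cases h0 : p.1 = 0
    · rw [h0, flow_zero]; simp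
    · rw [coeff_shift_of_lt f (show p.2 < m by omega), map_sum]
      simp only [Derivation.map_smul]
  rw [coeff_flowGen, sum_congr rfl h, sum_comm, shift, PowerSeries.coeff_mk, smul_sum,
    sum_range_succ']
  simp only [← smul_sum, ← coeff_flowGen]
  have h0 : m • (1 / (Nat.factorial 0) : ℚ) •
      PowerSeries.coeff m ((shiftGen D)^[0] (PowerSeries.C f)) = 0 := by
    rw [Function.iterate_zero, id, PowerSeries.coeff_C]
    split_ifs with h <;> simp [h]
  rw [h0, add_zero, smul_sum]
  refine sum_congr rfl fun k _ => ?_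
  rw [smul_comm, nsmul_coeff_iterate hD, map_nsmul, ← Nat.cast_smul_eq_nsmul ℚ (k + 1), smul_smul,
    Nat.factorial_succ]
  congr 1
  have h1 : ((k : ℚ) + 1) ≠ 0 := by positivity
  have h2 : (Nat.factorial k : ℚ) ≠ 0 := by positivity
  push_cast
  field_simp

theorem coeff_zero_shift (f : A) : PowerSeries.coeff 0 (shift D f) = f := by
  rw [shift, PowerSeries.coeff_mk]
  simp

/-- The generator has no z⁰ term, so m times the m-th coefficient is determined by the earlier ones,
and m is invertible. Most identities for the shift are proved this way. -/
theorem IsFlow.ext {F G : A⟦X⟧} (hF : IsFlow D F) (hG : IsFlow D G)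
    (h : PowerSeries.coeff 0 F = PowerSeries.coeff 0 G) : F = G := by
  ext m
  induction m using Nat.strong_induction_on with
  | _ m ih =>
    rcases Nat.eq_zero_or_pos m with rfl | hm
    · exact h
    · refine nsmul_cancel hm.ne' ?_
      rw [hF, hG, coeff_flowGen, coeff_flowGen]
      refine sum_congr rfl fun p hp => ?_
      rw [HasAntidiagonal.mem_antidiagonal] at hp
      by_cases h0 : p.1 = 0
      · rw [h0, flow_zero]; rfl
      · rw [ih p.2 (by omega)]

theorem IsFlow.add {F G : A⟦X⟧} (hF : IsFlow D F) (hG : IsFlow D G) : IsFlow D (F + G) := by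
  intro m
  rw [flowGen_add, map_add, map_add, smul_add, hF, hG]

theorem IsFlow.mul {F G : A⟦X⟧} (hF : IsFlow D F) (hG : IsFlow D G) : IsFlow D (F * G) := by
  intro m
  rw [flowGen_mul, map_add, PowerSeries.coeff_mul, PowerSeries.coeff_mul, PowerSeries.coeff_mul,
    smul_sum, ← sum_add_distrib]
  refine sum_congr rfl fun p hp => ?_
  rw [HasAntidiagonal.mem_antidiagonal] at hp
  rw [← hF, ← hG, ← hp, add_smul, smul_mul_assoc, mul_smul_comm]

theorem isFlow_C {c : A} (hc : IsConst D c) : IsFlow D (PowerSeries.C c) := by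
  intro m
  rw [PowerSeries.coeff_C, coeff_flowGen, sum_eq_zero]
  · split_ifs with h <;> simp [h]
  · intro p _
    rw [PowerSeries.coeff_C, flow]
    split_ifs
    · rw [Derivation.smul_apply, hc, smul_zero]
    · exact map_zero _
    · rfl
    · rfl

section commuting

variable (hD : ∀ m n f, D m (D n f) = D n (D m f))
include hD

theorem shift_mul (f g : A) : shift D (f * g) = shift D f * shift D g :=
  (isFlow_shift hD _).ext ((isFlow_shift hD f).mul (isFlow_shift hD g)) <| by
    rw [PowerSeries.coeff_mul]
    simp [coeff_zero_shift]

theorem shift_add (f g : A) : shift D (f + g) = shift D f + shift D g :=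
  (isFlow_shift hD _).ext ((isFlow_shift hD f).add (isFlow_shift hD g)) <| by
    rw [map_add, coeff_zero_shift, coeff_zero_shift, coeff_zero_shift]

theorem shift_const {c : A} (hc : IsConst D c) : shift D c = PowerSeries.C c :=
  (isFlow_shift hD c).ext (isFlow_C hc) <| by rw [coeff_zero_shift, PowerSeries.coeff_zero_C]

omit hD in
theorem isConst_one : IsConst D (1 : A) := fun _ => Derivation.map_one_eq_zero _

/-- The coefficients of the shift, as additive maps. -/
def shiftHom (m : ℕ) : A →+ A :=
  AddMonoidHom.mk' (fun f => PowerSeries.coeff m (shift D f)) fun f g => by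
    rw [shift_add hD, map_add]

theorem shiftHom_apply (m : ℕ) (f : A) :
    shiftHom hD m f = PowerSeries.coeff m (shift D f) := rfl

theorem shift_sub (f g : A) : shift D (f - g) = shift D f - shift D g := by
  ext m
  rw [← shiftHom_apply hD, map_sub]; rfl

theorem shift_sum {ι : Type*} (s : Finset ι) (f : ι → A) :
    shift D (∑ a ∈ s, f a) = ∑ a ∈ s, shift D (f a) := by
  ext m
  rw [← shiftHom_apply hD, map_sum, map_sum]; rfl

/-- The shift commutes with the additive maps that commute with the flows. -/
theorem coeff_shift_comm {δ : A →+ A} (h : ∀ n f, δ (D n f) = D n (δ f)) (f : A) (m : ℕ) :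
    PowerSeries.coeff m (shift D (δ f)) = δ (PowerSeries.coeff m (shift D f)) := by
  have hflow : IsFlow D (PowerSeries.mk fun m => δ (PowerSeries.coeff m (shift D f))) := by
    intro m
    rw [coeff_flowGen, PowerSeries.coeff_mk, ← map_nsmul, isFlow_shift hD f m, coeff_flowGen,
      map_sum]
    refine sum_congr rfl fun p _ => ?_
    rw [PowerSeries.coeff_mk]
    exact comm_flow h (fun q f => map_rat_smul δ q f) (map_zero δ) _ _
  rw [(isFlow_shift hD (δ f)).ext hflow, PowerSeries.coeff_mk]
  rw [PowerSeries.coeff_mk, coeff_zero_shift, coeff_zero_shift]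

/-- For an invariant g, the flow equation at z^(2n+1) reads 0 = -2 ∂g/∂t_{2n+1}. -/
theorem isConst_of_shift {g : A} (hg : shift D g = PowerSeries.C g) : IsConst D g := by
  intro n
  have h := isFlow_shift hD g (2 * n + 1)
  rw [hg, PowerSeries.coeff_C, if_neg (by omega), smul_zero, coeff_flowGen,
    sum_eq_single (2 * n + 1, 0)] at h
  · rw [PowerSeries.coeff_zero_C, flow_odd, Derivation.smul_apply] at h
    have h2 := congrArg ((-1 / 2 : ℚ) • ·) h
    simp only [smul_zero, smul_smul] at h2
    norm_num at h2
    exact h2.symm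
  · intro p hp hne
    rw [HasAntidiagonal.mem_antidiagonal] at hp
    rw [PowerSeries.coeff_C, if_neg, map_zero]
    intro h0
    exact hne (by ext <;> simp only <;> omega)
  · intro h
    exact absurd (HasAntidiagonal.mem_antidiagonal.2 (by simp)) h

/-- The shift, extended to power series by linearity over the powers of `z`. -/
def shiftSeries (g : A⟦X⟧) : A⟦X⟧ :=
  PowerSeries.mk fun m => ∑ p ∈ antidiagonal m, shiftHom hD p.1 (PowerSeries.coeff p.2 g)

theorem shiftSeries_C_mul (a : A) (g : A⟦X⟧) :
    shiftSeries hD (PowerSeries.C a * g) = shift D a * shiftSeries hD g := by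
  ext m
  rw [shiftSeries, PowerSeries.coeff_mk, PowerSeries.coeff_mul]
  simp only [shiftSeries, PowerSeries.coeff_mk, PowerSeries.coeff_C_mul, shiftHom_apply,
    shift_mul hD]
  simp only [PowerSeries.coeff_mul, mul_sum]
  exact sum_antidiagonal_assoc (fun a' b c => PowerSeries.coeff a' (shift D a) *
    PowerSeries.coeff b (shift D (PowerSeries.coeff c g))) m

/-- The series `F(-z)`. -/
def negVar (F : A⟦X⟧) : A⟦X⟧ := PowerSeries.rescale (-1 : A) F

omit hD in
theorem coeff_negVar (F : A⟦X⟧) (m : ℕ) :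
    PowerSeries.coeff m (negVar F) = (-1) ^ m * PowerSeries.coeff m F := PowerSeries.coeff_rescale _ _ _

/-- Only odd powers of z occur in the exponent, so z ↦ -z inverts the shift. Differentiating in z,
the outer and the inner shift contribute the same flows with opposite signs. -/
theorem shiftSeries_negVar (f : A) : shiftSeries hD (negVar (shift D f)) = PowerSeries.C f := by
  have hcomm : ∀ i j (g : A), shiftHom hD i (flow D j g) = flow D j (shiftHom hD i g) := by
    intro i j g
    exact coeff_shift_comm (δ := (flow D j : A →ₗ[ℚ] A).toAddMonoidHom) hD
      (fun n f => (flow_comm_der hD n j f).symm) g i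
  have key : ∀ m, m • PowerSeries.coeff m (shiftSeries hD (negVar (shift D f))) = 0 := by
    intro m
    rw [shiftSeries, PowerSeries.coeff_mk, smul_sum]
    have h : ∀ p ∈ antidiagonal m,
        m • shiftHom hD p.1 (PowerSeries.coeff p.2 (negVar (shift D f))) =
          (∑ q ∈ antidiagonal p.1, flow D q.1 (shiftHom hD q.2 ((-1) ^ p.2 *
            PowerSeries.coeff p.2 (shift D f)))) +
          ∑ q ∈ antidiagonal p.2, shiftHom hD p.1 ((-1) ^ (q.1 + q.2) *
            flow D q.1 (PowerSeries.coeff q.2 (shift D f))) := by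
      intro p hp
      rw [HasAntidiagonal.mem_antidiagonal] at hp
      rw [← hp, add_smul, coeff_negVar]
      congr 1
      · rw [shiftHom_apply, isFlow_shift hD, coeff_flowGen]; rfl
      · rw [← map_nsmul, ← mul_smul_comm, isFlow_shift hD, coeff_flowGen, mul_sum, map_sum]
        refine sum_congr rfl fun q hq => ?_
        rw [HasAntidiagonal.mem_antidiagonal.1 hq]
    rw [sum_congr rfl h, sum_add_distrib,
      sum_antidiagonal_assoc fun a b c => flow D a (shiftHom hD b ((-1) ^ c *
        PowerSeries.coeff c (shift D f))),
      sum_antidiagonal_left_comm fun a b c => flow D a (shiftHom hD b ((-1) ^ c *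
        PowerSeries.coeff c (shift D f))), ← sum_add_distrib]
    refine sum_eq_zero fun p _ => ?_
    rw [← sum_add_distrib]
    refine sum_eq_zero fun q _ => ?_
    have hneg : ∀ (k : ℕ) (x : A), (-1) ^ k * x = ((-1 : ℤ) ^ k) • x := by
      intro k x; rw [zsmul_eq_mul]; push_cast; rfl
    rw [hneg, hneg, map_zsmul, map_zsmul, map_zsmul, hcomm, ← add_smul]
    by_cases hq : Odd q.1
    · rw [pow_add, hq.neg_one_pow]; simp
    · rw [flow_even D hq]; simp
  ext m
  rcases Nat.eq_zero_or_pos m with rfl | hm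
  · rw [shiftSeries, PowerSeries.coeff_mk]
    simp [shiftHom_apply, coeff_negVar, coeff_zero_shift]
  · rw [PowerSeries.coeff_C, if_neg hm.ne']
    exact nsmul_cancel hm.ne' (by rw [key, smul_zero])

end commuting

end shift

end

section

open PDO Finset
variable [DiffAlg A]
local notation "δ" => (DiffAlg.der : Derivation ℚ A A)

/-! ### Dressing operators, the Lax operator and the B-type symmetry. -/

section dressing

theorem PDO.eq_zero_of_monic_mul {V Q : PDO A} (hV : V.OrdLE 0) (h1 : V.coeff 0 = 1)
    (h : V * Q = 0) : Q = 0 := by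
  obtain ⟨N, hN⟩ := exists_ordLE Q
  have key : ∀ k : ℕ, Q.OrdLE (N - k) := by
    intro k
    induction k with
    | zero => simpa using hN
    | succ k ih =>
      intro i hi
      rcases eq_or_lt_of_le (show N - k ≤ i by push_cast at hi; omega) with rfl | hlt
      · have h2 := coeff_mul_top hV ih
        rwa [zero_add, h, coeff_zero', h1, one_mul, eq_comm] at h2
      · exact ih i hlt
  ext m
  exact key (N - m + 1).toNat m (by omega)

/-- The inverse of an operator `W` with `W^* ∂ W = ∂`. -/
def dressInv (W : PDO A) : PDO A := del (-1) * adj δ W * del 1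

theorem dressInv_mul {W : PDO A} (h : adj δ W * (del 1 * W) = del 1) : dressInv W * W = 1 := by
  rw [dressInv, mul_assoc, mul_assoc, h, del_neg_mul_del]

theorem ordLE_dressInv {W : PDO A} (hW : W.OrdLE 0) : (dressInv W).OrdLE 0 :=
  (((ordLE_del (-1)).mul hW.adj).mul (ordLE_del 1)).mono (by norm_num)

theorem coeff_zero_dressInv {W : PDO A} (hW : W.OrdLE 0) (h1 : W.coeff 0 = 1) :
    (dressInv W).coeff 0 = 1 := by
  have h2 := coeff_mul_top (ordLE_del (A := A) (-1)) hW.adj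
  have h3 := coeff_adj_top hW
  rw [dressInv, coeff_mul_del, show (0 : ℤ) - 1 = -1 + 0 by norm_num, h2, h3, h1]
  simp [coeff_del]

/-- The left inverse V of W is monic, so V(WV - 1) = 0 forces WV = 1. -/
theorem mul_dressInv {W : PDO A} (hW : W.OrdLE 0) (h1 : W.coeff 0 = 1)
    (h : adj δ W * (del 1 * W) = del 1) : W * dressInv W = 1 := by
  refine sub_eq_zero.1 (eq_zero_of_monic_mul (ordLE_dressInv hW) (coeff_zero_dressInv hW h1) ?_)
  rw [mul_sub, ← mul_assoc, dressInv_mul h, one_mul, mul_one, sub_self]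

variable {D : ℕ → Derivation ℚ A A} {W L : PDO A} (h0 : D 0 = DiffAlg.der) (hW : IsDressing D W L)
include h0 hW

omit h0 in
theorem IsDressing.ordLE : W.OrdLE 0 := hW.coeff_pos

theorem IsDressing.lax_eq : L * W = W * del 1 := by
  have h := hW.lax
  rwa [h0] at h

theorem IsDressing.sato_eq (n : ℕ) : mapDer (D n) W = -(minus (L ^ (2 * n + 1)) * W) := by
  have h := hW.sato n
  rwa [h0, pow_eq] at h

theorem IsDressing.constraint_eq : adj δ W * (del 1 * W) = del 1 := by
  have h := hW.constraint
  rwa [h0] at h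

theorem IsDressing.inv_mul : dressInv W * W = 1 := dressInv_mul (hW.constraint_eq h0)

theorem IsDressing.mul_inv : W * dressInv W = 1 :=
  mul_dressInv hW.ordLE hW.coeff_zero (hW.constraint_eq h0)

theorem IsDressing.lax_pow_mul (n : ℕ) : L ^ n * W = W * del n := by
  induction n with
  | zero => rw [pow_zero, one_mul]; exact (mul_one W).symm
  | succ n ih =>
    rw [pow_succ, mul_assoc, hW.lax_eq h0, ← mul_assoc, ih, mul_assoc, del_mul_del]; norm_cast

theorem IsDressing.lax_pow (n : ℕ) : L ^ n = W * del n * dressInv W := by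
  rw [← hW.lax_pow_mul h0, mul_assoc, hW.mul_inv h0, mul_one]

/-- Take the adjoint of LW = W∂ and substitute W^* = ∂W⁻¹∂⁻¹, which is the constraint. -/
theorem IsDressing.adj_lax : adj δ L * del 1 = -(del 1 * L) := by
  have h1 := congrArg (adj δ) (hW.lax_eq h0)
  rw [adj_mul, adj_mul, adj_del_one] at h1
  have h2 : adj δ W = del 1 * dressInv W * del (-1) := by
    rw [dressInv, mul_assoc, mul_assoc, mul_assoc, del_mul_del_neg, mul_one, ← mul_assoc,
      del_mul_del_neg, one_mul]
  rw [h2] at h1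
  have h3 := congrArg (fun P => del 1 * W * (del (-1) * P) * del 1) h1
  have h4 : del 1 * W * (del (-1) * (del 1 * dressInv W * del (-1) * adj δ L)) = adj δ L := by
    rw [mul_assoc (del 1 * dressInv W), mul_assoc (del 1) (dressInv W), ← mul_assoc (del (-1)),
      del_neg_mul_del, one_mul, mul_assoc (del 1) W, ← mul_assoc W, hW.mul_inv h0, one_mul,
      ← mul_assoc, del_mul_del_neg, one_mul]
  have h5 := hW.lax_pow h0 1
  rw [pow_one] at h5
  simp only [h4] at h3
  rw [h3, h5]
  simp only [mul_assoc, neg_mul, mul_neg, del_neg_mul_del, mul_one, Nat.cast_one]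
  rw [← mul_assoc (del (-1)) (del 1), del_neg_mul_del, one_mul]

theorem IsDressing.adj_lax_pow (n : ℕ) :
    adj δ (L ^ (2 * n + 1)) * del 1 = -(del 1 * L ^ (2 * n + 1)) := by
  have h2 : adj δ L * (adj δ L * del 1) = del 1 * (L * L) := by
    rw [hW.adj_lax h0, mul_neg, ← mul_assoc, hW.adj_lax h0, neg_mul, neg_neg, mul_assoc]
  rw [adj_pow]
  induction n with
  | zero => simpa using hW.adj_lax h0
  | succ n ih =>
    rw [show 2 * (n + 1) + 1 = (2 * n + 1) + 1 + 1 by ring, pow_succ, pow_succ, mul_assoc,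
      mul_assoc, h2, ← mul_assoc, ih, neg_mul, mul_assoc, ← mul_assoc _ L L, pow_succ _ (2 * n + 1 + 1),
      pow_succ _ (2 * n + 1)]

theorem IsDressing.B_eq (n : ℕ) : B D L n = plus (L ^ (2 * n + 1)) := by
  rw [B, h0, pow_eq]

theorem IsDressing.adj_lax_pow_mul_del (n : ℕ) :
    adj δ (L ^ (2 * n + 1) * del (-1)) = L ^ (2 * n + 1) * del (-1) := by
  have h2 := congrArg (fun P => del (-1) * P * del (-1)) (hW.adj_lax_pow h0 n)
  simp only [mul_assoc, mul_neg, neg_mul] at h2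
  rw [del_mul_del_neg, mul_one, ← mul_assoc (del (-1)) (del 1), del_neg_mul_del, one_mul] at h2
  rw [adj_mul, adj_del_neg_one, neg_mul, h2, neg_neg]

/-- L^(2n+1)∂⁻¹ is self-adjoint, while the adjoint reverses the sign of the residue. -/
theorem IsDressing.coeff_zero_lax_pow (n : ℕ) : (L ^ (2 * n + 1)).coeff 0 = 0 := by
  have h1 := hW.adj_lax_pow_mul_del h0 n
  have h3 := res_adj (L ^ (2 * n + 1) * del (-1))
  rw [h1, coeff_mul_del] at h3
  norm_num at h3
  have h4 : (2 : ℕ) • (L ^ (2 * n + 1)).coeff 0 = (2 : ℕ) • 0 := by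
    rw [two_nsmul, smul_zero]
    nth_rewrite 1 [h3]
    exact neg_add_cancel _
  exact nsmul_cancel two_ne_zero h4

theorem IsDressing.isDiff_B (n : ℕ) : (B D L n).IsDiff := isDiff_plus _

/-- Since L^(2n+1) has no constant term, B∂⁻¹ is the differential part of L^(2n+1)∂⁻¹ and inherits
its self-adjointness. -/
theorem IsDressing.adj_B (n : ℕ) : adj δ (B D L n) * del 1 = -(del 1 * B D L n) := by
  have h1 : B D L n * del (-1) = plus (L ^ (2 * n + 1) * del (-1)) := by
    ext i
    rw [coeff_mul_del, coeff_plus, coeff_mul_del, hW.B_eq h0, coeff_plus]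
    rcases lt_trichotomy i (-1) with hi | rfl | hi
    · rw [if_neg (by omega), if_neg (by omega)]
    · simp [hW.coeff_zero_lax_pow h0]
    · rw [if_pos (by omega), if_pos (by omega)]
  have h2 := hW.adj_lax_pow_mul_del h0 n
  have h3 := adj_plus (L ^ (2 * n + 1) * del (-1))
  rw [h2, ← h1, adj_mul, adj_del_neg_one, neg_mul] at h3
  have h4 := congrArg (fun P => del 1 * P * del 1) h3
  simp only [mul_neg, neg_mul, mul_assoc, del_neg_mul_del, mul_one] at h4
  rw [← mul_assoc, del_mul_del_neg, one_mul] at h4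
  rw [← h4, neg_neg]

theorem IsDressing.mapDer_eq (n : ℕ) :
    mapDer (D n) W = B D L n * W - W * del ((2 * n + 1 : ℕ) : ℤ) := by
  rw [hW.sato_eq h0, hW.B_eq h0, ← hW.lax_pow_mul h0]
  nth_rewrite 3 [← plus_add_minus (L ^ (2 * n + 1))]
  rw [add_mul]
  abel

theorem IsDressing.mapDer_inv (hD : ∀ m n f, D m (D n f) = D n (D m f)) (n : ℕ) :
    mapDer (D n) (dressInv W) =
      del ((2 * n + 1 : ℕ) : ℤ) * dressInv W - dressInv W * B D L n := by
  have hd : ∀ f, D n (δ f) = δ (D n f) := fun f => by rw [← h0, hD]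
  have h1 := mapDer_mul hd (dressInv W) W
  rw [hW.inv_mul h0, mapDer_one, hW.mapDer_eq h0] at h1
  have h2 := congrArg (· * dressInv W) h1
  simp only [zero_mul, add_mul, mul_sub, sub_mul, mul_assoc, hW.mul_inv h0, mul_one] at h2
  rw [← mul_assoc (dressInv W) W, hW.inv_mul h0, one_mul] at h2
  rw [eq_comm, add_eq_zero_iff_eq_neg] at h2
  rw [h2]
  abel

end dressing

theorem isEigenfunction_iff {D : ℕ → Derivation ℚ A A} (h0 : D 0 = δ) (L : PDO A) (Φ : A) :
    IsEigenfunction D L Φ ↔ ∀ n, D n Φ = app (B D L n) Φ := by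
  simp only [IsEigenfunction, h0, act_eq_app]

end

section

open PDO Finset
variable [DiffAlg A]
local notation "δ" => (DiffAlg.der : Derivation ℚ A A)

/-! ### Shifted eigenfunctions and the series of ∂⁻¹Φ∂W. -/

section spectral

/-- The coefficients of the series `(1 - z) / (1 + z)`. -/
def cayleyCoeff (k : ℕ) : ℤ := if k = 0 then 1 else 2 * (-1) ^ k

/-- The coefficients of the series `-2 ∑_n z^(2n+1)`. -/
def oddCoeff (k : ℕ) : ℤ := if Odd k then -2 else 0

/-- The logarithmic derivative z d/dz of (1 - z)/(1 + z) is -2z/(1 - z²). -/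
theorem natCast_mul_cayleyCoeff (k : ℕ) :
    (k : ℤ) * cayleyCoeff k = ∑ p ∈ antidiagonal k, oddCoeff p.1 * cayleyCoeff p.2 := by
  have hs : ∀ k, ∑ p ∈ antidiagonal (k + 2), oddCoeff p.1 * cayleyCoeff p.2 =
      -2 * cayleyCoeff (k + 1) + ∑ p ∈ antidiagonal k, oddCoeff p.1 * cayleyCoeff p.2 := by
    intro k
    have h2 : ∀ i, oddCoeff (i + 1 + 1) = oddCoeff i := fun i => by
      simp [oddCoeff, Nat.odd_add_one]
    rw [Nat.sum_antidiagonal_succ, Nat.sum_antidiagonal_succ]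
    simp only [h2]
    simp [oddCoeff]
  induction k using Nat.twoStepInduction with
  | zero => simp [oddCoeff]
  | one => simp [Nat.sum_antidiagonal_succ, oddCoeff, cayleyCoeff]
  | more k ih _ =>
    rw [hs, ← ih]
    rcases k with _ | k
    · simp [cayleyCoeff]
    · simp only [cayleyCoeff, if_neg (Nat.succ_ne_zero _)]
      push_cast
      ring

variable {D : ℕ → Derivation ℚ A A} {W L : PDO A} (h0 : D 0 = DiffAlg.der)
  (hD : ∀ m n f, D m (D n f) = D n (D m f))

/-- The coefficients of `T(W) (1 - z∂) (1 + z∂)⁻¹ W⁻¹`, where `T` is the shift. For an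
eigenfunction `Φ` this operator sends `Φ` to `T(Φ)`. -/
def transfer (W : PDO A) (m : ℕ) : PDO A :=
  ∑ p ∈ antidiagonal m,
    mapCoeff (shiftHom hD p.1) W * (cayleyCoeff p.2 • del p.2) * dressInv W

/-- The coefficients of `-2 ∑_n z^(2n+1) B_{2n+1}`. -/
def flowOp (L : PDO A) (j : ℕ) : PDO A := if Odd j then (-2 : ℤ) • plus (L ^ j) else 0

theorem nsmul_mapCoeff_shift (W : PDO A) (m : ℕ) : m • mapCoeff (shiftHom hD m) W =
    ∑ p ∈ antidiagonal m, mapDer (flow D p.1) (mapCoeff (shiftHom hD p.2) W) := by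
  ext i
  rw [coeff_nsmul, coeff_sum, coeff_mapCoeff, shiftHom_apply, isFlow_shift hD, coeff_flowGen]
  rfl

include h0 hD in
theorem flow_comm_der' (j : ℕ) (f : A) : flow D j (δ f) = δ (flow D j f) := by
  rw [← h0]; exact (flow_comm_der hD 0 j f).symm

theorem neg_two_qsmul (x : A) : (-2 : ℚ) • x = (-2 : ℤ) • x := by
  rw [← Int.cast_smul_eq_zsmul ℚ]; norm_num

variable (hW : IsDressing D W L)

include h0 hW hD in
theorem IsDressing.flow_inv (j : ℕ) : mapDer (flow D j) (dressInv W) =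
    (oddCoeff j • del j) * dressInv W - dressInv W * flowOp L j := by
  by_cases hj : Odd j
  · obtain ⟨n, rfl⟩ := hj
    have h1 : mapDer (flow D (2 * n + 1)) (dressInv W) =
        (-2 : ℤ) • mapDer (D n) (dressInv W) := by
      ext i
      rw [flow_odd, coeff_zsmul, coeff_mapDer, Derivation.smul_apply, neg_two_qsmul]; rfl
    rw [h1, hW.mapDer_inv h0 hD, hW.B_eq h0, oddCoeff, flowOp, if_pos ⟨n, rfl⟩, if_pos ⟨n, rfl⟩,
      smul_sub, smul_mul_assoc, mul_smul_comm]
  · rw [oddCoeff, flowOp, if_neg hj, if_neg hj, zero_smul, zero_mul, mul_zero, sub_zero,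
      flow_even D hj]
    rfl

include h0 hW in
-- Differentiating T(W) in z produces its flows, and differentiating the Cayley factor produces -2 ∑
-- z^(2n+1)∂^(2n+1). The flow of W⁻¹ supplies that same term, leaving B on the right.
theorem IsDressing.nsmul_transfer (m : ℕ) : m • transfer hD W m =
    ∑ p ∈ antidiagonal m, (mapDer (flow D p.1) (transfer hD W p.2) +
      transfer hD W p.2 * flowOp L p.1) := by
  have hc : ∀ k : ℕ, k • (cayleyCoeff k • del k : PDO A) = ∑ p ∈ antidiagonal k,
      (cayleyCoeff p.2 • del p.2) * (oddCoeff p.1 • del p.1) := by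
    intro k
    rw [← natCast_zsmul, smul_smul, natCast_mul_cayleyCoeff, sum_smul]
    refine sum_congr rfl fun p hp => ?_
    rw [smul_mul_smul_comm, del_mul_del, mul_comm, ← HasAntidiagonal.mem_antidiagonal.1 hp]
    push_cast
    rw [add_comm (p.1 : ℤ)]
  have hl : m • transfer hD W m = ∑ p ∈ antidiagonal m,
      ((∑ q ∈ antidiagonal p.1, mapDer (flow D q.1) (mapCoeff (shiftHom hD q.2) W) *
        (cayleyCoeff p.2 • del p.2) * dressInv W) +
      ∑ q ∈ antidiagonal p.2, mapCoeff (shiftHom hD p.1) W *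
        ((cayleyCoeff q.2 • del q.2) * (oddCoeff q.1 • del q.1)) * dressInv W) := by
    rw [transfer, smul_sum]
    refine sum_congr rfl fun p hp => ?_
    rw [← sum_mul, ← sum_mul, ← nsmul_mapCoeff_shift, ← sum_mul, ← mul_sum, ← hc,
      smul_mul_assoc, smul_mul_assoc, mul_smul_comm p.2, smul_mul_assoc, ← add_smul,
      HasAntidiagonal.mem_antidiagonal.1 hp]
  have hr : ∀ p ∈ antidiagonal m, mapDer (flow D p.1) (transfer hD W p.2) +
      transfer hD W p.2 * flowOp L p.1 =
      (∑ q ∈ antidiagonal p.2, mapDer (flow D p.1) (mapCoeff (shiftHom hD q.1) W) *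
        (cayleyCoeff q.2 • del q.2) * dressInv W) +
      ∑ q ∈ antidiagonal p.2, mapCoeff (shiftHom hD q.1) W *
        ((cayleyCoeff q.2 • del q.2) * (oddCoeff p.1 • del p.1)) * dressInv W := by
    intro p _
    rw [transfer, mapDer_sum, sum_mul, ← sum_add_distrib, ← sum_add_distrib]
    refine sum_congr rfl fun q _ => ?_
    have hd : mapDer (flow D p.1) (cayleyCoeff q.2 • del q.2 : PDO A) = 0 := by
      ext i
      rw [coeff_mapDer, coeff_zsmul, map_zsmul, ← coeff_mapDer, mapDer_del, coeff_zero', smul_zero]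
    rw [mapDer_mul (flow_comm_der' h0 hD _), mapDer_mul (flow_comm_der' h0 hD _), hd,
      hW.flow_inv h0 hD]
    simp only [mul_zero, add_zero, mul_sub, mul_assoc]
    abel
  rw [hl, sum_congr rfl hr, sum_add_distrib, sum_add_distrib,
    sum_antidiagonal_assoc fun a b c => mapDer (flow D a) (mapCoeff (shiftHom hD b) W) *
      (cayleyCoeff c • del c) * dressInv W,
    sum_antidiagonal_left_comm fun a b c => mapCoeff (shiftHom hD a) W *
      ((cayleyCoeff c • del c) * (oddCoeff b • del b)) * dressInv W]

include h0 hW in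
theorem IsDressing.transfer_zero : transfer hD W 0 = 1 := by
  have h : mapCoeff (shiftHom hD 0) W = W := by
    ext i; rw [coeff_mapCoeff, shiftHom_apply, coeff_zero_shift]
  rw [transfer, Nat.antidiagonal_zero, sum_singleton, h, cayleyCoeff, if_pos rfl, one_smul,
    Nat.cast_zero, ← one_def, mul_one, hW.mul_inv h0]

theorem isDiff_flowOp (j : ℕ) : (flowOp L j).IsDiff := by
  intro i hi
  rw [flowOp]
  split_ifs
  · rw [coeff_zsmul, isDiff_plus _ i hi, smul_zero]
  · rfl

include h0 hW in
-- The factors are not differential, but `IsDressing.nsmul_transfer` builds each coefficient from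
-- earlier ones by operations that preserve differential operators, starting from 1.
theorem IsDressing.isDiff_transfer (m : ℕ) : (transfer hD W m).IsDiff := by
  induction m using Nat.strong_induction_on with
  | _ m ih =>
    rcases Nat.eq_zero_or_pos m with rfl | hm
    · rw [hW.transfer_zero h0]; exact isDiff_one
    · intro i hi
      refine nsmul_cancel hm.ne' ?_
      rw [← coeff_nsmul, hW.nsmul_transfer h0, smul_zero, coeff_sum]
      refine sum_eq_zero fun p hp => ?_
      rw [HasAntidiagonal.mem_antidiagonal] at hp
      by_cases hp0 : p.1 = 0
      · rw [hp0, flow_zero, flowOp, if_neg (by decide), mul_zero, add_zero]; rfl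
      · have h1 := ih p.2 (by omega)
        rw [coeff_add, (h1.mul (isDiff_flowOp _)) i hi, coeff_mapDer, h1 i hi, map_zero, add_zero]

include h0 hW in
-- As B acts on Φ as the flow does, both sides solve the same flow equation with initial value Φ.
theorem IsDressing.app_transfer {Φ : A} (hΦ : IsEigenfunction D L Φ) (m : ℕ) :
    app (transfer hD W m) Φ = PowerSeries.coeff m (shift D Φ) := by
  have hΦ' : ∀ j, app (flowOp L j) Φ = flow D j Φ := by
    intro j
    by_cases hj : Odd j
    · obtain ⟨n, rfl⟩ := hj
      rw [flow_odd, Derivation.smul_apply, (isEigenfunction_iff h0 L Φ).1 hΦ, flowOp,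
        if_pos ⟨n, rfl⟩, hW.B_eq h0, neg_two_qsmul, app, app, smul_mul_assoc, coeff_zsmul]
    · rw [flow_even D hj, flowOp, if_neg hj, app, zero_mul]; rfl
  have hf : IsFlow D (PowerSeries.mk fun m => app (transfer hD W m) Φ) := by
    intro m
    rw [coeff_flowGen, PowerSeries.coeff_mk, app, ← coeff_nsmul, ← smul_mul_assoc,
      hW.nsmul_transfer h0, sum_mul, coeff_sum]
    refine sum_congr rfl fun p _ => ?_
    rw [PowerSeries.coeff_mk, add_mul, coeff_add]
    change _ + app (transfer hD W p.2 * flowOp L p.1) Φ = _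
    rw [app_mul (hW.isDiff_transfer h0 hD _) (isDiff_flowOp _), hΦ', app, app, ← coeff_mapDer,
      mapDer_mul (flow_comm_der' h0 hD _), mapDer_fn, coeff_add]
  rw [← (hf.ext (isFlow_shift hD Φ) _), PowerSeries.coeff_mk]
  rw [PowerSeries.coeff_mk, hW.transfer_zero h0, app_one, coeff_zero_shift]

theorem coeff_series (P : PDO A) (m : ℕ) :
    PowerSeries.coeff m (series P) = P.coeff (-(m : ℤ)) := PowerSeries.coeff_mk _ _

variable {τ : A} (hτ : IsTauOf D W τ)

include hτ in
-- Here w = Tτ/τ, and shifting w(-z) gives τ/Tτ. This is where the existence of τ enters.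
theorem series_mul_shiftSeries :
    series W * shiftSeries hD (negVar (series W)) = 1 := by
  obtain ⟨⟨u, rfl⟩, h⟩ := hτ
  have h1 : series W = PowerSeries.C (↑u⁻¹ : A) * shift D (u : A) := by
    rw [h, ← mul_assoc, ← map_mul, Units.inv_mul, map_one, one_mul]
  have h2 : negVar (series W) = PowerSeries.C (↑u⁻¹ : A) * negVar (shift D (u : A)) := by
    rw [h1, negVar, map_mul]
    congr 1
    ext m
    rw [PowerSeries.coeff_rescale, PowerSeries.coeff_C]
    split_ifs with hm <;> simp [hm]
  rw [h2, shiftSeries_C_mul, shiftSeries_negVar, h1]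
  calc _ = PowerSeries.C (↑u⁻¹ * (u : A)) * (shift D (u : A) * shift D (↑u⁻¹ : A)) := by
        rw [map_mul]; ring
    _ = 1 := by
        rw [← shift_mul hD, Units.inv_mul, Units.mul_inv, shift_const hD isConst_one, map_one,
          one_mul]

/-- The coefficients of `w T(W)`, where `w` is the series of `W` and `T` the shift. -/
def normShift (W : PDO A) (m : ℕ) : PDO A :=
  ∑ p ∈ antidiagonal m, fn (PowerSeries.coeff p.1 (series W)) * mapCoeff (shiftHom hD p.2) W

include hW in
theorem IsDressing.ordLE_normShift (m : ℕ) : (normShift hD W m).OrdLE 0 := by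
  intro i hi
  rw [normShift, coeff_sum]
  refine sum_eq_zero fun p _ => ?_
  rw [coeff_fn_mul, coeff_mapCoeff, hW.coeff_pos i hi, map_zero, mul_zero]

include hW in
theorem IsDressing.coeff_zero_normShift (m : ℕ) :
    (normShift hD W m).coeff 0 = PowerSeries.coeff m (series W) := by
  rw [normShift, coeff_sum, sum_eq_single (m, 0)]
  · rw [coeff_fn_mul, coeff_mapCoeff, hW.coeff_zero, shiftHom_apply, coeff_zero_shift, mul_one]
  · intro p hp hne
    rw [HasAntidiagonal.mem_antidiagonal] at hp
    rw [coeff_fn_mul, coeff_mapCoeff, hW.coeff_zero, shiftHom_apply, shift_const hD isConst_one,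
      PowerSeries.coeff_C, if_neg, mul_zero]
    intro h
    exact hne (by ext <;> simp only <;> omega)
  · intro h
    exact absurd (HasAntidiagonal.mem_antidiagonal.2 (by simp)) h

include hτ in
/-- The value of `w T(W)` at `∂ = -1/z` is one. -/
theorem sum_normShift (s : ℕ) : ∑ p ∈ antidiagonal s,
    (-1) ^ p.2 * (normShift hD W p.1).coeff (-(p.2 : ℤ)) = if s = 0 then 1 else 0 := by
  have h := congrArg (PowerSeries.coeff s) (series_mul_shiftSeries hD hτ)
  rw [PowerSeries.coeff_one, PowerSeries.coeff_mul] at h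
  rw [← h]
  simp only [normShift, coeff_sum, mul_sum]
  rw [sum_antidiagonal_assoc fun a b c => (-1) ^ c * (fn (PowerSeries.coeff a (series W)) *
    mapCoeff (shiftHom hD b) W).coeff (-(c : ℤ))]
  refine sum_congr rfl fun p _ => ?_
  rw [shiftSeries, PowerSeries.coeff_mk, mul_sum]
  refine sum_congr rfl fun q _ => ?_
  rw [coeff_fn_mul, coeff_mapCoeff, coeff_negVar, coeff_series W q.2]
  rcases neg_one_pow_eq_or A q.2 with h | h <;> rw [h] <;> simp

include hW hτ in
-- A remainder theorem: since w T(W) is 1 at ∂ = -1/z, right division by 1 + z∂ gives (1 + z∂)⁻¹ up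
-- to terms of negative order. The coefficient of ∂^k in degree k + s is, up to sign, the s-th
-- coefficient of that value.
theorem IsDressing.ordLE_normShift_conv (m : ℕ) :
    (∑ p ∈ antidiagonal m, normShift hD W p.1 * ((-1 : ℤ) ^ p.2 • del p.2) -
      (-1 : ℤ) ^ m • del m).OrdLE (-1) := by
  intro i hi
  rw [coeff_sub, coeff_sum, coeff_zsmul, coeff_del]
  simp only [mul_smul_comm, coeff_zsmul, coeff_mul_del]
  by_cases him : (m : ℤ) < i
  · rw [if_neg him.ne', smul_zero, sub_zero]
    refine sum_eq_zero fun p hp => ?_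
    rw [HasAntidiagonal.mem_antidiagonal] at hp
    rw [hW.ordLE_normShift hD _ _ (by omega), smul_zero]
  · obtain ⟨k, rfl⟩ := Int.eq_ofNat_of_zero_le (show 0 ≤ i by omega)
    obtain ⟨s, rfl⟩ := Nat.exists_eq_add_of_le (show k ≤ m by omega)
    have h1 : ∑ p ∈ antidiagonal (k + s),
        (-1 : ℤ) ^ p.2 • (normShift hD W p.1).coeff ((k : ℤ) - p.2) =
        ∑ p ∈ antidiagonal s, (-1 : ℤ) ^ k •
          ((-1) ^ p.2 * (normShift hD W p.1).coeff (-(p.2 : ℤ))) := by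
      symm
      refine sum_of_injOn (fun p => (p.1, p.2 + k)) ?_ ?_ ?_ ?_
      · intro p _ q _ h
        simp only [Prod.mk.injEq, add_left_inj] at h
        exact Prod.ext h.1 h.2
      · intro p hp
        simp only [mem_coe, HasAntidiagonal.mem_antidiagonal] at hp ⊢
        omega
      · intro p hp hn
        rw [HasAntidiagonal.mem_antidiagonal] at hp
        rw [hW.ordLE_normShift hD, smul_zero]
        by_contra hc
        refine hn ⟨(p.1, p.2 - k), ?_, ?_⟩
        · simp only [mem_coe, HasAntidiagonal.mem_antidiagonal]; omega
        · ext <;> simp only; omega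
      · intro p _
        simp only
        rw [pow_add, mul_comm ((-1 : ℤ) ^ p.2), mul_smul,
          show (k : ℤ) - ((p.2 + k : ℕ) : ℤ) = -(p.2 : ℤ) by push_cast; ring, zsmul_eq_mul _
            ((-1 : ℤ) ^ p.2)]
        push_cast
        rfl
    rw [h1, ← smul_sum, sum_normShift hD hτ]
    by_cases hs : s = 0
    · subst hs
      simp
    · rw [if_neg hs, if_neg (by push_cast; omega)]
      simp

/-- The series of `∂⁻¹ Φ ∂ W`, the spectral representation of the primitive of `Φ ψ_x`. -/
def primSeries (W : PDO A) (Φ : A) : A⟦X⟧ := series (del (-1) * fn Φ * del 1 * W)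

theorem neg_one_pow_mul_comm_coeff (m : ℕ) :
    ((Int.negOnePow ((m : ℤ) - 1) : ℤˣ) : ℤ) = -(-1) ^ m := by
  rw [Int.negOnePow_sub, Int.negOnePow_one, mul_neg_one, Units.val_neg]
  rcases m.even_or_odd with h | h
  · rw [Int.negOnePow_even _ (by exact_mod_cast h), h.neg_one_pow, Units.val_one]
  · rw [Int.negOnePow_odd _ (by exact_mod_cast h), h.neg_one_pow, Units.val_neg, Units.val_one]

/-- By the constraint, ∂⁻¹Φ∂W has adjoint ∂W⁻¹Φ∂⁻¹. Its coefficients are residues after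
multiplication by a power of ∂, hence can be read off the adjoint. -/
theorem coeff_primSeries (W : PDO A) (Φ : A) (m : ℕ) : PowerSeries.coeff m (primSeries W Φ) =
    (-1 : ℤ) ^ m • (del m * (dressInv W * fn Φ)).coeff 0 := by
  have h1 : adj δ (del (-1) * fn Φ * del 1 * W) = del 1 * dressInv W * fn Φ * del (-1) := by
    rw [adj_mul, adj_mul, adj_mul, adj_fn, adj_del_one, adj_del_neg_one, dressInv]
    simp only [mul_neg, neg_mul, neg_neg, mul_assoc]
    rw [← mul_assoc (del 1) (del (-1)), del_mul_del_neg, one_mul]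
  have h2 := res_adj (del (-1) * fn Φ * del 1 * W * del ((m : ℤ) - 1))
  rw [coeff_mul_del, adj_mul, h1, adj_del, neg_one_pow_mul_comm_coeff, smul_mul_assoc,
    coeff_zsmul, ← mul_assoc, coeff_mul_del, mul_assoc (del 1), ← mul_assoc, ← mul_assoc,
    del_mul_del, mul_assoc] at h2
  rw [primSeries, coeff_series, show -(m : ℤ) = -1 - ((m : ℤ) - 1) by ring, ← neg_inj, ← h2,
    neg_smul]
  norm_num

include h0 hD hW hτ in
/-- For an eigenfunction `Φ` the series of `∂⁻¹ Φ ∂ W` is `w (T(Φ) + Φ) / 2`. -/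
theorem IsDressing.series_mul_shift {Φ : A} (hΦ : IsEigenfunction D L Φ) :
    series W * (shift D Φ + PowerSeries.C Φ) = 2 * primSeries W Φ := by
  ext m
  have h1 : ∑ p ∈ antidiagonal m, fn (PowerSeries.coeff p.1 (series W)) * transfer hD W p.2 =
      (∑ p ∈ antidiagonal m, normShift hD W p.1 * (cayleyCoeff p.2 • del p.2)) * dressInv W := by
    simp only [transfer, normShift, mul_sum, sum_mul]
    rw [sum_antidiagonal_assoc fun a b c => fn (PowerSeries.coeff a (series W)) *
      mapCoeff (shiftHom hD b) W * (cayleyCoeff c • del c) * dressInv W]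
    simp only [mul_assoc]
  -- This is (1 - z∂)(1 + z∂)⁻¹ = 2(1 + z∂)⁻¹ - 1.
  have h2 : ∑ p ∈ antidiagonal m, normShift hD W p.1 * (cayleyCoeff p.2 • del p.2) =
      (2 : ℤ) • (∑ p ∈ antidiagonal m, normShift hD W p.1 * ((-1 : ℤ) ^ p.2 • del p.2)) -
        normShift hD W m := by
    have h3 : normShift hD W m = ∑ p ∈ antidiagonal m,
        if p.2 = 0 then normShift hD W p.1 else 0 := by
      rw [sum_eq_single (m, 0)]
      · rw [if_pos rfl]
      · intro p hp hne
        rw [HasAntidiagonal.mem_antidiagonal] at hp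
        refine if_neg fun h => hne (by ext <;> simp only <;> omega)
      · intro h
        exact absurd (HasAntidiagonal.mem_antidiagonal.2 (by simp)) h
    rw [h3, smul_sum, ← sum_sub_distrib]
    refine sum_congr rfl fun p _ => ?_
    rw [cayleyCoeff]
    split_ifs with hp
    · rw [hp, pow_zero, one_smul, Nat.cast_zero, ← one_def, mul_one, two_zsmul, add_sub_cancel_right]
    · rw [sub_zero, mul_smul_comm, mul_smul_comm, smul_smul]
  -- The remainder Q has negative order and W⁻¹Φ has order at most 0, so Q does not reach the
  -- constant term. What remains is 2(1 + z∂)⁻¹W⁻¹Φ, read off by `coeff_primSeries`, and -wΦ.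
  have h4 := hW.ordLE_normShift_conv hD hτ m
  set Q := ∑ p ∈ antidiagonal m, normShift hD W p.1 * ((-1 : ℤ) ^ p.2 • del p.2) -
      (-1 : ℤ) ^ m • del m with hQ
  rw [sub_eq_iff_eq_add.1 hQ.symm] at h2
  have h5 : (dressInv W * fn Φ).OrdLE 0 :=
    ((ordLE_dressInv hW.ordLE).mul (ordLE_fn Φ)).mono (by norm_num)
  have h6 : (dressInv W * fn Φ).coeff 0 = Φ := by
    have := coeff_mul_top (ordLE_dressInv hW.ordLE) (ordLE_fn Φ)
    rw [add_zero] at this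
    rw [this, coeff_zero_dressInv hW.ordLE hW.coeff_zero, coeff_fn, if_pos rfl, one_mul]
  have h7 := coeff_mul_top (hW.ordLE_normShift hD m) h5
  rw [add_zero, h6, hW.coeff_zero_normShift] at h7
  have h8 : (Q * (dressInv W * fn Φ)).coeff 0 = 0 := (h4.mul h5) 0 (by norm_num)
  have h9 := congrArg (fun P => app P Φ) h1
  simp only [h2] at h9
  rw [app, app, mul_assoc, sub_mul, coeff_sub, h7, smul_mul_assoc, coeff_zsmul, add_mul, coeff_add,
    h8, zero_add, smul_mul_assoc, coeff_zsmul, ← coeff_primSeries, sum_mul, coeff_sum] at h9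
  have h10 : PowerSeries.coeff m (series W * shift D Φ) =
      ∑ p ∈ antidiagonal m, (fn (PowerSeries.coeff p.1 (series W)) * transfer hD W p.2 *
        fn Φ).coeff 0 := by
    rw [PowerSeries.coeff_mul]
    refine sum_congr rfl fun p _ => ?_
    rw [mul_assoc, coeff_fn_mul, ← hW.app_transfer h0 hD hΦ]; rfl
  rw [mul_add, map_add, h10, h9, PowerSeries.coeff_mul_C, sub_add_cancel,
    show (2 : A⟦X⟧) = PowerSeries.C 2 from (map_ofNat PowerSeries.C 2).symm, PowerSeries.coeff_C_mul, zsmul_eq_mul]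
  norm_num

end spectral

end

section

open PDO Finset
variable [DiffAlg A]
local notation "δ" => (DiffAlg.der : Derivation ℚ A A)

/-! ### Squared eigenfunction potentials under the shift, and the series of GW. -/

section potential

theorem series_add (P Q : PDO A) : series (P + Q) = series P + series Q := by
  ext m; simp [coeff_series]

theorem series_sub (P Q : PDO A) : series (P - Q) = series P - series Q := by
  ext m; simp [coeff_series]

theorem series_sum {ι : Type*} (s : Finset ι) (P : ι → PDO A) :
    series (∑ a ∈ s, P a) = ∑ a ∈ s, series (P a) := by
  ext m; simp [coeff_series]

theorem series_fn_mul (f : A) (P : PDO A) : series (fn f * P) = PowerSeries.C f * series P := by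
  ext m; simp [coeff_series]

/-- Converts constant terms of operators factored through W⁻¹Φ into products of series, where the
identities become commutative algebra. -/
theorem coeff_mul_del_dressInv {W P : PDO A} (hW : W.OrdLE 0) (hP : P.OrdLE 0) (Φ : A) (N : ℕ) :
    (P * del N * (dressInv W * fn Φ)).coeff 0 =
      PowerSeries.coeff N (series P * negVar (primSeries W Φ)) := by
  have h5 : (dressInv W * fn Φ).OrdLE 0 :=
    ((ordLE_dressInv hW).mul (ordLE_fn Φ)).mono (by norm_num)
  -- The tail of P below ∂^(-N) is too low to contribute to the constant term, so P may be replaced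
  -- by a finite sum.
  set Q := P - ∑ p ∈ antidiagonal N, fn (P.coeff (-(p.1 : ℤ))) * del (-(p.1 : ℤ)) with hQ
  have hQord : Q.OrdLE (-(N : ℤ) - 1) := by
    intro i hi
    rw [hQ, coeff_sub, coeff_sum]
    rcases lt_or_ge 0 i with hi0 | hi0
    · rw [hP i hi0, zero_sub, neg_eq_zero]
      refine sum_eq_zero fun p _ => ?_
      rw [coeff_fn_mul, coeff_del, if_neg (by omega), mul_zero]
    · obtain ⟨k, hk⟩ := Int.eq_ofNat_of_zero_le (show 0 ≤ -i by omega)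
      obtain rfl : i = -(k : ℤ) := by omega
      rw [sum_eq_single (k, N - k)]
      · rw [coeff_fn_mul, coeff_del, if_pos rfl, mul_one, sub_self]
      · intro p hp hne
        rw [HasAntidiagonal.mem_antidiagonal] at hp
        rw [coeff_fn_mul, coeff_del, if_neg, mul_zero]
        intro h
        exact hne (by ext <;> simp only <;> omega)
      · intro h
        exact absurd (HasAntidiagonal.mem_antidiagonal.2 (by simp only; omega)) h
  have h1 : P = Q + ∑ p ∈ antidiagonal N, fn (P.coeff (-(p.1 : ℤ))) * del (-(p.1 : ℤ)) := by
    rw [hQ, sub_add_cancel]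
  have h2 : (Q * del N * (dressInv W * fn Φ)).coeff 0 = 0 :=
    ((hQord.mul (ordLE_del N)).mul h5) 0 (by omega)
  rw [h1, add_mul, add_mul, coeff_add, h2, zero_add, sum_mul, sum_mul, coeff_sum, ← h1,
    PowerSeries.coeff_mul]
  refine sum_congr rfl fun p hp => ?_
  rw [HasAntidiagonal.mem_antidiagonal] at hp
  rw [coeff_series, coeff_negVar, coeff_primSeries, mul_assoc, mul_assoc, coeff_fn_mul, ← mul_assoc,
    del_mul_del, show -(p.1 : ℤ) + N = p.2 by omega, zsmul_eq_mul, ← mul_assoc ((-1 : A) ^ _)]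
  push_cast
  rw [← mul_pow, neg_one_mul, neg_neg, one_pow, one_mul]

variable {D : ℕ → Derivation ℚ A A} {W L : PDO A} (h0 : D 0 = DiffAlg.der)
  (hD : ∀ m n f, D m (D n f) = D n (D m f)) (hW : IsDressing D W L)

/-- The flow generator on a function whose derivatives are the odd coefficients of `H`. -/
theorem flowGen_C {f : A} {H : A⟦X⟧} (h : ∀ n, D n f = PowerSeries.coeff (2 * n + 1) H) :
    flowGen D (PowerSeries.C f) = negVar H - H := by
  ext m
  rw [coeff_flowGen, sum_eq_single (m, 0), map_sub, coeff_negVar, PowerSeries.coeff_zero_C]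
  · simp only
    by_cases hm : Odd m
    · obtain ⟨n, rfl⟩ := hm
      rw [flow_odd, Derivation.smul_apply, h, Odd.neg_one_pow ⟨n, rfl⟩, neg_two_qsmul,
        zsmul_eq_mul]
      push_cast
      ring
    · rw [flow_even D hm, (Nat.not_odd_iff_even.1 hm).neg_one_pow, one_mul, sub_self]; rfl
  · intro p hp hne
    rw [HasAntidiagonal.mem_antidiagonal] at hp
    rw [PowerSeries.coeff_C, if_neg, map_zero]
    intro h0
    exact hne (by ext <;> simp only <;> omega)
  · intro h
    exact absurd (HasAntidiagonal.mem_antidiagonal.2 (by simp)) h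

include h0 hW in
theorem IsDressing.der_eigenfunction {Φ : A} (hΦ : IsEigenfunction D L Φ) (n : ℕ) :
    D n Φ = PowerSeries.coeff (2 * n + 1) (series W * negVar (primSeries W Φ)) := by
  rw [(isEigenfunction_iff h0 L Φ).1 hΦ, hW.B_eq h0, app_plus, hW.lax_pow h0, app,
    ← coeff_mul_del_dressInv hW.ordLE hW.ordLE, mul_assoc (W * _)]

theorem del_neg_mul_fn_der (f : A) (P : PDO A) :
    del (-1) * fn (δ f) * P = fn f * P - del (-1) * fn f * del 1 * P := by
  have h := del_mul_fn f
  rw [← sub_eq_iff_eq_add'.2 h, mul_sub, ← mul_assoc, del_neg_mul_del, one_mul, sub_mul]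
  simp only [mul_assoc]

theorem series_del_neg_mul (f : A) (W : PDO A) : series (del (-1) * fn (δ f) * W) =
    PowerSeries.C f * series W - primSeries W f := by
  rw [del_neg_mul_fn_der, series_sub, series_fn_mul, primSeries]

include h0 in
theorem isSEP_iff {Φ Ψ S : A} : IsSEP D L Φ Ψ S ↔ ∀ n, D n S =
    (del (-1) * fn Ψ * B D L n * fn Φ * del (-1)).coeff (-1) := by
  simp only [IsSEP, h0, res, ← PDO.mul_def, mul_assoc]

include h0 hW in
-- In the residue, B may be replaced by L^(2n+1) = W∂^(2n+1)W⁻¹, since the negative part contributes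
-- only order at most -3.
theorem IsDressing.der_potential {Φ Ψ S : A} (hS : IsSEP D L Φ (δ Ψ) S) (n : ℕ) :
    D n S = PowerSeries.coeff (2 * n + 1)
      ((PowerSeries.C Ψ * series W - primSeries W Ψ) * negVar (primSeries W Φ)) := by
  have hm := (((((ordLE_del (A := A) (-1)).mul (ordLE_fn (δ Ψ))).mul
    (ordLE_minus (L ^ (2 * n + 1)))).mul (ordLE_fn Φ)).mul (ordLE_del (-1))) (-1) (by norm_num)
  have h1 : (del (-1) * fn (δ Ψ) * B D L n * fn Φ * del (-1)).coeff (-1) =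
      (del (-1) * fn (δ Ψ) * L ^ (2 * n + 1) * fn Φ * del (-1)).coeff (-1) := by
    conv_rhs => rw [← plus_add_minus (L ^ (2 * n + 1)), mul_add, add_mul, add_mul, coeff_add, hm,
      add_zero, ← hW.B_eq h0]
  rw [(isSEP_iff h0).1 hS, h1, hW.lax_pow h0, ← series_del_neg_mul,
    ← coeff_mul_del_dressInv hW.ordLE, coeff_mul_del]
  · simp only [mul_assoc]; norm_num
  · exact (((ordLE_del (-1)).mul (ordLE_fn _)).mul hW.ordLE).mono (by norm_num)

include h0 in
theorem isBSEP_iff {Φ₁ Φ₂ Ω : A} : IsBSEP D L Φ₁ Φ₂ Ω ↔ ∃ S S' : A, IsSEP D L Φ₂ (δ Φ₁) S ∧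
    IsSEP D L Φ₁ (δ Φ₂) S' ∧ Ω = S - S' := by
  simp only [IsBSEP, h0]

variable {τ : A} (hτ : IsTauOf D W τ)

include h0 hW hD hτ in
-- The right side has constant term Ω, so it suffices that it solves the flow equation. This reduces
-- to the cancellation `key` between the flows of Ω, Φ₁ and Φ₂, all quadratic in w, the series of
-- ∂⁻¹Φ∂W and their images under z ↦ -z.
theorem IsDressing.shift_potential {Φ₁ Φ₂ Ω : A} (hΦ₁ : IsEigenfunction D L Φ₁)
    (hΦ₂ : IsEigenfunction D L Φ₂) (hΩ : IsBSEP D L Φ₂ Φ₁ Ω) :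
    shift D Ω = PowerSeries.C Ω + (PowerSeries.C Φ₁ * shift D Φ₂ - PowerSeries.C Φ₂ * shift D Φ₁) := by
  have hr₁ := hW.series_mul_shift h0 hD hτ hΦ₁
  have hr₂ := hW.series_mul_shift h0 hD hτ hΦ₂
  have hmul : ∀ F G : A⟦X⟧, negVar (F * G) = negVar F * negVar G := fun F G => map_mul _ F G
  have hsub : ∀ F G : A⟦X⟧, negVar (F - G) = negVar F - negVar G := fun F G => map_sub _ F G
  have hC : ∀ f : A, negVar (PowerSeries.C f) = PowerSeries.C f := by
    intro f
    ext m
    rw [coeff_negVar, PowerSeries.coeff_C]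
    split_ifs with hm <;> simp [hm]
  have hneg : ∀ {F : A⟦X⟧} {Φ : A}, series W * (F + PowerSeries.C Φ) = 2 * primSeries W Φ →
      negVar (series W) * (negVar F + PowerSeries.C Φ) = 2 * negVar (primSeries W Φ) := by
    intro F Φ h
    have h2 := congrArg negVar h
    simp only [negVar, map_mul, map_add, map_ofNat] at h2 ⊢
    rwa [show PowerSeries.rescale (-1 : A) (PowerSeries.C Φ) = PowerSeries.C Φ from hC Φ] at h2
  have hs₁ := hneg hr₁
  have hs₂ := hneg hr₂
  have hnn : ∀ F : A⟦X⟧, negVar (negVar F) = F := by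
    intro F
    ext m
    rw [coeff_negVar, coeff_negVar, ← mul_assoc, ← mul_pow, neg_one_mul, neg_neg, one_pow, one_mul]
  have he₁ := flowGen_C (hW.der_eigenfunction h0 hΦ₁)
  have he₂ := flowGen_C (hW.der_eigenfunction h0 hΦ₂)
  have hΩ' : ∀ n, D n Ω = PowerSeries.coeff (2 * n + 1)
      ((PowerSeries.C Φ₂ * series W - primSeries W Φ₂) * negVar (primSeries W Φ₁) -
      (PowerSeries.C Φ₁ * series W - primSeries W Φ₁) * negVar (primSeries W Φ₂)) := by
    obtain ⟨S, S', hS, hS', rfl⟩ := (isBSEP_iff h0).1 hΩ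
    intro n
    rw [map_sub, map_sub, hW.der_potential h0 hS, hW.der_potential h0 hS']
  have heΩ := flowGen_C hΩ'
  simp only [hmul, hsub, hC, hnn] at he₁ he₂ heΩ
  have key : flowGen D (PowerSeries.C Ω) + flowGen D (PowerSeries.C Φ₁) * shift D Φ₂ -
      flowGen D (PowerSeries.C Φ₂) * shift D Φ₁ = 0 := by
    rw [he₁, he₂, heΩ]
    -- The factor 4 lets each series of ∂⁻¹Φ∂W appear as 2r, to be replaced by w (TΦ + Φ). The signs
    -- of z are treated alike.
    refine nsmul_cancel (m := 4) (by norm_num) ?_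
    rw [smul_zero, nsmul_eq_mul]
    push_cast
    generalize primSeries W Φ₁ = r₁ at *
    generalize primSeries W Φ₂ = r₂ at *
    generalize negVar r₁ = s₁ at *
    generalize negVar r₂ = s₂ at *
    generalize negVar (series W) = v at *
    generalize series W = w at *
    calc _ = (2 * PowerSeries.C Φ₂ * v - 2 * s₂) * (2 * r₁) -
          (2 * PowerSeries.C Φ₁ * v - 2 * s₁) * (2 * r₂) -
          ((2 * PowerSeries.C Φ₂ * w - 2 * r₂) * (2 * s₁) -
            (2 * PowerSeries.C Φ₁ * w - 2 * r₁) * (2 * s₂)) +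
          2 * (v * (2 * r₁) - w * (2 * s₁)) * shift D Φ₂ -
          2 * (v * (2 * r₂) - w * (2 * s₂)) * shift D Φ₁ := by ring
      _ = 0 := by rw [← hr₁, ← hr₂, ← hs₁, ← hs₂]; ring
  refine (isFlow_shift hD Ω).ext ?_ ?_
  · intro m
    have hθ : ∀ (a f : A), m • PowerSeries.coeff m (PowerSeries.C a * shift D f) =
        PowerSeries.coeff m (PowerSeries.C a * flowGen D (shift D f)) := by
      intro a f
      rw [PowerSeries.coeff_C_mul, PowerSeries.coeff_C_mul, ← isFlow_shift hD, mul_smul_comm]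
    have h1 : flowGen D (PowerSeries.C Ω +
        (PowerSeries.C Φ₁ * shift D Φ₂ - PowerSeries.C Φ₂ * shift D Φ₁)) =
        PowerSeries.C Φ₁ * flowGen D (shift D Φ₂) - PowerSeries.C Φ₂ * flowGen D (shift D Φ₁) := by
      rw [flowGen_add, flowGen_sub, flowGen_mul, flowGen_mul]
      linear_combination key
    have h2 : m • PowerSeries.coeff m (PowerSeries.C Ω) = 0 := by
      rw [PowerSeries.coeff_C]
      split_ifs with h <;> simp [h]
    rw [h1, map_add, map_sub, map_sub, smul_add, smul_sub, hθ, hθ, h2, zero_add]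
  · simp only [map_add, map_sub, PowerSeries.coeff_C_mul, coeff_zero_shift,
      PowerSeries.coeff_zero_C]
    ring

variable {ι : Type*} [Fintype ι] {Φ₁ Φ₂ Ω : ι → A}

include h0 in
theorem ghost_eq : ghost D Φ₁ Φ₂ = ∑ a, (fn (Φ₂ a) * (del (-1) * fn (δ (Φ₁ a))) -
    fn (Φ₁ a) * (del (-1) * fn (δ (Φ₂ a)))) := by
  simp only [ghost, h0, ← PDO.mul_def, ← mul_assoc, fn_mul_del]

include h0 hW hD hτ in
/-- The series of the ghost flow of `W`. -/
theorem IsDressing.series_ghost_mul (hΦ₁ : ∀ a, IsEigenfunction D L (Φ₁ a))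
    (hΦ₂ : ∀ a, IsEigenfunction D L (Φ₂ a)) (hΩ : ∀ a, IsBSEP D L (Φ₂ a) (Φ₁ a) (Ω a)) :
    series (ghost D Φ₁ Φ₂ * W) = series W *
      (shift D ((1 / 2 : ℚ) • ∑ a, Ω a) - PowerSeries.C ((1 / 2 : ℚ) • ∑ a, Ω a)) := by
  have hhalf : (1 / 2 : ℚ) • ∑ a, Ω a + (1 / 2 : ℚ) • ∑ a, Ω a = ∑ a, Ω a := by
    rw [← add_smul]; norm_num
  have h1 : (2 : ℕ) • (shift D ((1 / 2 : ℚ) • ∑ a, Ω a) -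
      PowerSeries.C ((1 / 2 : ℚ) • ∑ a, Ω a)) =
      shift D (∑ a, Ω a) - PowerSeries.C (∑ a, Ω a) := by
    rw [← hhalf, shift_add hD, map_add, two_nsmul, hhalf]
    abel
  refine nsmul_cancel (m := 2) two_ne_zero ?_
  rw [← mul_smul_comm, h1, shift_sum hD, map_sum, ← sum_sub_distrib, mul_sum, ghost_eq h0, sum_mul,
    series_sum, smul_sum]
  refine sum_congr rfl fun a _ => ?_
  rw [hW.shift_potential h0 hD hτ (hΦ₁ a) (hΦ₂ a) (hΩ a), sub_mul, mul_assoc (fn (Φ₂ a)),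
    mul_assoc (fn (Φ₁ a)), series_sub,
    series_fn_mul, series_fn_mul, series_del_neg_mul, series_del_neg_mul, nsmul_eq_mul]
  push_cast
  linear_combination PowerSeries.C (Φ₂ a) * hW.series_mul_shift h0 hD hτ (hΦ₁ a) -
    PowerSeries.C (Φ₁ a) * hW.series_mul_shift h0 hD hτ (hΦ₂ a)

end potential

end

section

open PDO Finset
variable [DiffAlg A]
local notation "δ" => (DiffAlg.der : Derivation ℚ A A)

/-! ### Linearized Sato equations and constraint for the ghost flow. -/

section ghost

theorem isDressing_of_ring {D : ℕ → Derivation ℚ A A} (h0 : D 0 = DiffAlg.der) {W L : PDO A}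
    (hW : W.OrdLE 0) (hW0 : W.coeff 0 = 1) (hL : L * W = W * del 1)
    (hs : ∀ n, mapDer (D n) W = -(minus (L ^ (2 * n + 1)) * W))
    (hc : adj δ W * (del 1 * W) = del 1) : IsDressing D W L where
  coeff_zero := hW0
  coeff_pos := hW
  lax := by rw [h0]; exact hL
  sato n := by rw [h0, pow_eq]; exact hs n
  constraint := by rw [h0]; exact hc

theorem minus_mul_del_neg_mul_fn {P : PDO A} (hP : P.IsDiff) (f : A) :
    minus (P * del (-1) * fn f) = fn (P.coeff 0) * del (-1) * fn f := by
  have h1 : (P * del (-1) - fn (P.coeff 0) * del (-1)).IsDiff := by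
    intro i hi
    rw [coeff_sub, coeff_mul_del, coeff_fn_mul, coeff_del]
    rcases eq_or_ne i (-1) with rfl | h
    · simp
    · rw [hP _ (by omega), if_neg h, mul_zero, sub_zero]
  have h2 := minus_eq_zero (h1.mul (isDiff_fn f))
  rw [sub_mul, minus_sub, sub_eq_zero] at h2
  rw [h2, minus_eq_self]
  exact (((ordLE_fn _).mul (ordLE_del (-1))).mul (ordLE_fn f)).mono (by norm_num)

/-- Let X be the negative part. Then ∂X is differential and of order at most 0, hence a function. -/
theorem minus_del_neg_mul {P : PDO A} (hP : P.IsDiff) :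
    minus (del (-1) * P) = del (-1) * fn ((del (-1) * P).coeff (-1)) := by
  set X := minus (del (-1) * P) with hX
  have h1 : del 1 * X = P - del 1 * plus (del (-1) * P) := by
    rw [eq_sub_iff_add_eq', ← mul_add, plus_add_minus, ← mul_assoc, del_mul_del_neg, one_mul]
  have h2 : (del 1 * X).IsDiff := by
    rw [h1]; exact hP.sub (isDiff_del_one.mul (isDiff_plus _))
  have h3 : (del 1 * X).OrdLE 0 := ((ordLE_del 1).mul (ordLE_minus _)).mono (by norm_num)
  have h4 : del 1 * X = fn ((del (-1) * P).coeff (-1)) := by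
    ext i
    rw [coeff_fn]
    split_ifs with hi
    · subst hi
      rw [coeff_del_one_mul, hX, coeff_minus, coeff_minus]
      norm_num
    · rcases lt_or_gt_of_ne hi with hi | hi
      · exact h2 i hi
      · exact h3 i hi
  rw [← h4, ← mul_assoc, del_neg_mul_del, one_mul]

variable {D : ℕ → Derivation ℚ A A} {W L : PDO A} (h0 : D 0 = DiffAlg.der)
  (hD : ∀ m n f, D m (D n f) = D n (D m f)) (hW : IsDressing D W L)

theorem minus_fn_mul (f : A) (P : PDO A) : minus (fn f * P) = fn f * minus P := by
  ext i
  simp only [coeff_minus, coeff_fn_mul]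
  split_ifs <;> simp

include h0 hW in
-- The adjoint turns the residue into B^*(ψ'), and B^*∂ = -∂B.
theorem IsDressing.coeff_del_neg_mul_fn_mul_B (ψ : A) (n : ℕ) :
    (del (-1) * (fn (δ ψ) * B D L n)).coeff (-1) = -δ (app (B D L n) ψ) := by
  have h1 := res_adj (del (-1) * (fn (δ ψ) * B D L n))
  rw [adj_mul, adj_mul, adj_del_neg_one, adj_fn, mul_neg, coeff_neg, neg_inj, coeff_mul_del] at h1
  have h2 : (adj δ (B D L n)).IsDiff := by rw [hW.B_eq h0, adj_plus]; exact isDiff_plus _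
  have h3 : app (adj δ (B D L n) * del 1) ψ = app (adj δ (B D L n)) (δ ψ) := by
    rw [app_mul h2 isDiff_del_one, app_del_one]
  rw [hW.adj_B h0] at h3
  have h4 : app (-(del 1 * B D L n)) ψ = -δ (app (B D L n) ψ) := by
    rw [← app_del_one, ← app_mul isDiff_del_one (hW.isDiff_B h0 n), app, neg_mul, coeff_neg]; rfl
  rw [← h1, ← h4, h3, app]
  norm_num

include h0 hW hD in
-- Both sides equal (Bφ)∂⁻¹ψ' + φ∂⁻¹(Bψ)': on the left by Leibniz, on the right since the negative
-- parts come from Bφ and B^*ψ' = -(Bψ)'.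
theorem IsDressing.mapDer_term {φ ψ : A} (hφ : IsEigenfunction D L φ)
    (hψ : IsEigenfunction D L ψ) (n : ℕ) : mapDer (D n) (fn φ * (del (-1) * fn (δ ψ))) =
      minus (B D L n * (fn φ * (del (-1) * fn (δ ψ))) -
        fn φ * (del (-1) * fn (δ ψ)) * B D L n) := by
  have hd : ∀ f, D n (δ f) = δ (D n f) := fun f => by rw [← h0, hD]
  have h1 : minus (B D L n * (fn φ * (del (-1) * fn (δ ψ)))) =
      fn (app (B D L n) φ) * (del (-1) * fn (δ ψ)) := by
    have := minus_mul_del_neg_mul_fn ((hW.isDiff_B h0 n).mul (isDiff_fn φ)) (δ ψ)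
    simp only [mul_assoc] at this
    exact this
  have h2 : minus (fn φ * (del (-1) * fn (δ ψ)) * B D L n) =
      -(fn φ * (del (-1) * fn (δ (app (B D L n) ψ)))) := by
    rw [mul_assoc, mul_assoc, minus_fn_mul,
      minus_del_neg_mul ((isDiff_fn (δ ψ)).mul (hW.isDiff_B h0 n)),
      hW.coeff_del_neg_mul_fn_mul_B h0, fn_neg, mul_neg, mul_neg]
  rw [minus_sub, h1, h2, sub_neg_eq_add, mapDer_mul hd, mapDer_mul hd, mapDer_fn, mapDer_fn,
    mapDer_del, zero_mul, zero_add, hd, (isEigenfunction_iff h0 L φ).1 hφ,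
    (isEigenfunction_iff h0 L ψ).1 hψ]

variable {ι : Type*} [Fintype ι] {Φ₁ Φ₂ : ι → A}

theorem minus_sum (s : Finset ι) (P : ι → PDO A) :
    minus (∑ a ∈ s, P a) = ∑ a ∈ s, minus (P a) := by
  ext i
  simp only [coeff_minus, coeff_sum]
  split_ifs <;> simp

include h0 hW hD in
theorem IsDressing.mapDer_ghost (hΦ₁ : ∀ a, IsEigenfunction D L (Φ₁ a))
    (hΦ₂ : ∀ a, IsEigenfunction D L (Φ₂ a)) (n : ℕ) : mapDer (D n) (ghost D Φ₁ Φ₂) =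
      minus (B D L n * ghost D Φ₁ Φ₂ - ghost D Φ₁ Φ₂ * B D L n) := by
  rw [ghost_eq h0, mapDer_sum, mul_sum, sum_mul, ← sum_sub_distrib, minus_sum]
  refine sum_congr rfl fun a _ => ?_
  rw [mapDer_sub, hW.mapDer_term h0 hD (hΦ₂ a) (hΦ₁ a), hW.mapDer_term h0 hD (hΦ₁ a) (hΦ₂ a),
    ← minus_sub]
  congr 1
  noncomm_ring

include h0 in
theorem ordLE_ghost : (ghost D Φ₁ Φ₂).OrdLE (-1) := by
  have h : ∀ f g : A, (fn f * (del (-1) * fn g)).OrdLE (-1) := fun f g =>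
    ((ordLE_fn f).mul ((ordLE_del (-1)).mul (ordLE_fn g))).mono (by norm_num)
  rw [ghost_eq h0]
  exact OrdLE.sum fun a _ => (h _ _).sub (h _ _)

/-- The operator `f ∂⁻¹ g - g ∂⁻¹ f`. -/
def wedge (f g : A) : PDO A := fn f * (del (-1) * fn g) - fn g * (del (-1) * fn f)

theorem adj_wedge (f g : A) : adj δ (wedge f g) = wedge f g := by
  rw [wedge, adj_sub, adj_mul, adj_mul, adj_mul, adj_mul, adj_fn, adj_fn, adj_del_neg_one]
  simp only [mul_neg, neg_mul, mul_assoc]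
  abel

include h0 in
theorem ghost_eq_wedge : ghost D Φ₁ Φ₂ = (∑ a, wedge (Φ₁ a) (Φ₂ a)) * del 1 := by
  rw [ghost_eq h0, sum_mul]
  refine sum_congr rfl fun a _ => ?_
  have h : ∀ f : A, del (-1) * fn (δ f) = fn f - del (-1) * fn f * del 1 := fun f => by
    simpa using del_neg_mul_fn_der f 1
  rw [h, h, wedge, mul_sub, mul_sub, sub_mul, fn_comm (Φ₁ a)]
  simp only [mul_assoc]
  abel

include h0 in
-- G = K∂ with K self-adjoint. This is the first-order form of W^*∂W = ∂.
theorem adj_ghost_mul : adj δ (ghost D Φ₁ Φ₂) * del 1 = -(del 1 * ghost D Φ₁ Φ₂) := by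
  have h : adj δ (∑ a, wedge (Φ₁ a) (Φ₂ a)) = ∑ a, wedge (Φ₁ a) (Φ₂ a) := by
    rw [← adjHom_apply, map_sum]
    exact sum_congr rfl fun a _ => adj_wedge _ _
  rw [ghost_eq_wedge h0, adj_mul, h, adj_del_one, neg_mul, neg_mul, mul_assoc]

include h0 hW hD in
-- The ε-component of Sato's equation. Writing L^(2n+1) = B + M with M its negative part, [G, M] has
-- negative order and so survives the projection, while [B, G]₋ is the flow of G.
theorem IsDressing.mapDer_ghost_mul (hΦ₁ : ∀ a, IsEigenfunction D L (Φ₁ a))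
    (hΦ₂ : ∀ a, IsEigenfunction D L (Φ₂ a)) (n : ℕ) :
    mapDer (D n) (ghost D Φ₁ Φ₂ * W) = -(minus (L ^ (2 * n + 1)) * (ghost D Φ₁ Φ₂ * W) +
      minus (ghost D Φ₁ Φ₂ * L ^ (2 * n + 1) - L ^ (2 * n + 1) * ghost D Φ₁ Φ₂) * W) := by
  have hd : ∀ f, D n (δ f) = δ (D n f) := fun f => by rw [← h0, hD]
  set G := ghost D Φ₁ Φ₂ with hG
  have hGo : G.OrdLE (-1) := ordLE_ghost h0
  set M := minus (L ^ (2 * n + 1)) with hM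
  have h1 : minus (G * L ^ (2 * n + 1) - L ^ (2 * n + 1) * G) =
      -minus (B D L n * G - G * B D L n) + (G * M - M * G) := by
    have h2 : G * L ^ (2 * n + 1) - L ^ (2 * n + 1) * G =
        (G * M - M * G) - (B D L n * G - G * B D L n) := by
      conv_lhs => rw [← plus_add_minus (L ^ (2 * n + 1)), ← hM, ← hW.B_eq h0]
      noncomm_ring
    have h3 : (G * M - M * G).OrdLE (-1) :=
      ((hGo.mul (ordLE_minus _)).mono (by norm_num)).sub
        (((ordLE_minus _).mul hGo).mono (by norm_num))
    rw [h2, minus_sub, minus_eq_self h3]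
    abel
  rw [h1, mapDer_mul hd, hG, hW.mapDer_ghost h0 hD hΦ₁ hΦ₂, ← hG, hW.sato_eq h0, ← hM]
  noncomm_ring

end ghost

end

section

open PDO Finset
variable [DiffAlg A]
local notation "δ" => (DiffAlg.der : Derivation ℚ A A)

/-! ### First-order deformations over the dual numbers. -/

section dual

/-- Makes the operator calculus and the uniqueness of the shift available over A[ε]. -/
instance instDiffAlgDual : DiffAlg A[ε] := ⟨dualDer DiffAlg.der⟩

/-- The `1`-component of a dual number, as an additive map. -/
def fstAdd : A[ε] →+ A where
  toFun := TrivSqZeroExt.fst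
  map_zero' := TrivSqZeroExt.fst_zero
  map_add' := TrivSqZeroExt.fst_add

/-- The `ε`-component of a dual number, as an additive map. -/
def sndAdd : A[ε] →+ A where
  toFun := TrivSqZeroExt.snd
  map_zero' := TrivSqZeroExt.snd_zero
  map_add' := TrivSqZeroExt.snd_add

omit [Algebra ℚ A] [DiffAlg A] in
@[simp] theorem fst_eps (a b : A) : (eps a b).fst = a := by simp [eps]

omit [Algebra ℚ A] [DiffAlg A] in
@[simp] theorem snd_eps (a b : A) : (eps a b).snd = b := by simp [eps]

theorem eps_mul (a b a' b' : A) : eps a b * eps a' b' = eps (a * a') (a * b' + b * a') := by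
  ext <;> simp

theorem eps_zero : eps (0 : A) 0 = 0 := by
  ext <;> simp

theorem dualDer_eps (d : Derivation ℚ A A) (a b : A) : dualDer d (eps a b) = eps (d a) (d b) := by
  change eps (d (eps a b).fst) (d (eps a b).snd) = _
  rw [fst_eps, snd_eps]

theorem iterate_dualDer_eps (d : Derivation ℚ A A) (k : ℕ) (a b : A) :
    (dualDer d)^[k] (eps a b) = eps (d^[k] a) (d^[k] b) := by
  induction k with
  | zero => rfl
  | succ k ih => rw [Function.iterate_succ_apply', ih, dualDer_eps, Function.iterate_succ_apply',
      Function.iterate_succ_apply']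

theorem zsmul_eps (n : ℤ) (a b : A) : n • eps a b = eps (n • a) (n • b) := by
  ext <;> simp

theorem PDO.coeff_dual (P Q : PDO A) (i : ℤ) :
    (dual P Q).coeff i = eps (P.coeff i) (Q.coeff i) := rfl

theorem PDO.OrdLE.dual {P Q : PDO A} {N : ℤ} (hP : P.OrdLE N) (hQ : Q.OrdLE N) :
    (PDO.dual P Q).OrdLE N := fun i hi => by
  rw [coeff_dual, hP i hi, hQ i hi, eps_zero]

theorem PDO.dual_mul (P Q P' Q' : PDO A) :
    dual P Q * dual P' Q' = dual (P * P') (P * Q' + Q * P') := by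
  ext1 m
  have hterm : ∀ p : ℤ × ℕ, Ring.choose p.1 p.2 • ((dual P Q).coeff p.1 *
      (dualDer δ)^[p.2] ((dual P' Q').coeff (m - p.1 + p.2))) =
      eps (Ring.choose p.1 p.2 • (P.coeff p.1 * δ^[p.2] (P'.coeff (m - p.1 + p.2))))
        (Ring.choose p.1 p.2 • (P.coeff p.1 * δ^[p.2] (Q'.coeff (m - p.1 + p.2))) +
          Ring.choose p.1 p.2 • (Q.coeff p.1 * δ^[p.2] (P'.coeff (m - p.1 + p.2)))) := by
    intro p
    rw [coeff_dual, coeff_dual, iterate_dualDer_eps, eps_mul, zsmul_eps, smul_add]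
  have hfin := comp_finite (dualDer δ) (dual P Q) (dual P' Q') m
  have h1 : (dual P Q * dual P' Q').coeff m = ∑ᶠ p : ℤ × ℕ, Ring.choose p.1 p.2 •
      ((dual P Q).coeff p.1 * (dualDer δ)^[p.2] ((dual P' Q').coeff (m - p.1 + p.2))) := rfl
  rw [h1, coeff_dual, coeff_add]
  simp only [coeff_mul_eq_finsum]
  rw [← finsum_add_distrib (comp_finite δ P Q' m) (comp_finite δ Q P' m)]
  ext
  · rw [fst_eps]
    refine (fstAdd.map_finsum hfin).trans (finsum_congr fun p => ?_)
    rw [hterm]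
    exact fst_eps _ _
  · rw [snd_eps]
    refine (sndAdd.map_finsum hfin).trans (finsum_congr fun p => ?_)
    rw [hterm]
    exact snd_eps _ _

theorem PDO.dual_neg (P Q : PDO A) : -dual P Q = dual (-P) (-Q) := by
  ext i <;> simp [coeff_dual]

theorem PDO.dual_del (n : ℤ) : (dual (del n) 0 : PDO A[ε]) = del n := by
  ext1 i
  rw [coeff_dual, coeff_del, coeff_del, coeff_zero']
  split_ifs <;> ext <;> simp

theorem PDO.dual_one : (dual 1 0 : PDO A[ε]) = 1 := dual_del 0

theorem PDO.minus_dual (P Q : PDO A) : minus (dual P Q) = dual (minus P) (minus Q) := by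
  ext1 i
  rw [coeff_dual, coeff_minus, coeff_minus, coeff_minus, coeff_dual]
  split_ifs
  · rfl
  · exact eps_zero.symm

theorem PDO.mapDer_dual (d : Derivation ℚ A A) (P Q : PDO A) :
    mapDer (dualDer d) (dual P Q) = dual (mapDer d P) (mapDer d Q) := by
  ext1 i
  rw [coeff_mapDer, coeff_dual, coeff_dual, dualDer_eps, coeff_mapDer, coeff_mapDer]

theorem eps_sum {ι : Type*} (s : Finset ι) (f g : ι → A) :
    ∑ a ∈ s, eps (f a) (g a) = eps (∑ a ∈ s, f a) (∑ a ∈ s, g a) := by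
  ext
  · rw [fst_eps]
    exact (map_sum (fstAdd (A := A)) _ s).trans (sum_congr rfl fun _ _ => fst_eps _ _)
  · rw [snd_eps]
    exact (map_sum (sndAdd (A := A)) _ s).trans (sum_congr rfl fun _ _ => snd_eps _ _)

theorem PDO.adj_dual (P Q : PDO A) :
    adj (dualDer δ) (dual P Q) = dual (adj δ P) (adj δ Q) := by
  obtain ⟨M, hM⟩ := exists_ordLE P
  obtain ⟨N, hN⟩ := exists_ordLE Q
  have hP := hM.mono (le_max_left M N)
  have hQ := hN.mono (le_max_right M N)
  ext1 m
  have hK : max M N < m + ((max M N - m).toNat + 1 : ℕ) := by push_cast; omega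
  refine (coeff_adj (hP.dual hQ) m _ hK).trans ?_
  rw [coeff_dual, coeff_adj hP m _ hK, coeff_adj hQ m _ hK, ← eps_sum]
  refine sum_congr rfl fun k _ => ?_
  rw [coeff_dual, ← zsmul_eps, ← zsmul_eps, ← iterate_dualDer_eps]
  rfl

/-- The commutator with G is a derivation of the operator ring. -/
theorem PDO.dual_pow (L G : PDO A) (k : ℕ) :
    dual L (G * L - L * G) ^ k = dual (L ^ k) (G * L ^ k - L ^ k * G) := by
  induction k with
  | zero => rw [pow_zero, pow_zero, mul_one, one_mul, sub_self, dual_one]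
  | succ k ih =>
    rw [pow_succ, ih, dual_mul, pow_succ]
    congr 1
    noncomm_ring

variable {D : ℕ → Derivation ℚ A A} {W L : PDO A} (h0 : D 0 = DiffAlg.der)
  (hD : ∀ m n f, D m (D n f) = D n (D m f)) (hW : IsDressing D W L)

include hD in
theorem dualDer_comm (m n : ℕ) (x : A[ε]) :
    dualDer (D m) (dualDer (D n) x) = dualDer (D n) (dualDer (D m) x) := by
  have hx : x = eps x.fst x.snd := by ext <;> simp
  rw [hx]
  simp only [dualDer_eps, hD m n]

include hD in
theorem coeff_shift_dual (a b : A) (m : ℕ) :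
    PowerSeries.coeff m (shift (fun n => dualDer (D n)) (eps a b)) =
      eps (PowerSeries.coeff m (shift D a)) (PowerSeries.coeff m (shift D b)) := by
  have hfl : ∀ j (a b : A), flow (fun n => dualDer (D n)) j (eps a b) =
      eps (flow D j a) (flow D j b) := by
    intro j a b
    by_cases hj : Odd j
    · obtain ⟨n, rfl⟩ := hj
      rw [flow_odd, flow_odd, Derivation.smul_apply, Derivation.smul_apply, Derivation.smul_apply,
        dualDer_eps]
      ext <;> simp
    · rw [flow_even _ hj, flow_even _ hj]
      exact eps_zero.symm
  have hF : IsFlow (fun n => dualDer (D n)) (PowerSeries.mk fun m =>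
      eps (PowerSeries.coeff m (shift D a)) (PowerSeries.coeff m (shift D b))) := by
    intro m
    rw [coeff_flowGen, PowerSeries.coeff_mk, ← natCast_zsmul, zsmul_eps, natCast_zsmul,
      natCast_zsmul, isFlow_shift hD, isFlow_shift hD, coeff_flowGen, coeff_flowGen, ← eps_sum]
    exact sum_congr rfl fun p _ => by rw [PowerSeries.coeff_mk, hfl]
  rw [(isFlow_shift (dualDer_comm hD) (eps a b)).ext hF, PowerSeries.coeff_mk]
  rw [PowerSeries.coeff_mk, coeff_zero_shift, coeff_zero_shift, coeff_zero_shift]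

variable {ι : Type*} [Fintype ι] {Φ₁ Φ₂ Ω : ι → A}

include h0 hW hD in
theorem IsDressing.dual (hΦ₁ : ∀ a, IsEigenfunction D L (Φ₁ a))
    (hΦ₂ : ∀ a, IsEigenfunction D L (Φ₂ a)) :
    IsDressing (fun n => dualDer (D n)) (PDO.dual W (ghost D Φ₁ Φ₂ * W))
      (PDO.dual L (ghost D Φ₁ Φ₂ * L - L * ghost D Φ₁ Φ₂)) := by
  have hG := ordLE_ghost (Φ₁ := Φ₁) (Φ₂ := Φ₂) h0
  have hGW : (ghost D Φ₁ Φ₂ * W).OrdLE (-1) := (hG.mul hW.ordLE).mono (by norm_num)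
  have hadj := adj_ghost_mul (Φ₁ := Φ₁) (Φ₂ := Φ₂) h0
  have hs := hW.mapDer_ghost_mul h0 hD hΦ₁ hΦ₂
  set G := ghost D Φ₁ Φ₂
  refine isDressing_of_ring (congrArg dualDer h0) (hW.ordLE.dual (hGW.mono (by norm_num))) ?_ ?_
    (fun n => ?_) ?_
  · rw [coeff_dual, hW.coeff_zero, hGW 0 (by norm_num)]
    ext <;> simp
  · rw [← dual_del, dual_mul, dual_mul, hW.lax_eq h0, mul_zero, zero_add]
    congr 1
    rw [sub_mul, mul_assoc G L W, hW.lax_eq h0]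
    noncomm_ring
  · rw [mapDer_dual, dual_pow, minus_dual, dual_mul, dual_neg, hs, hW.sato_eq h0]
  · change adj (dualDer δ) _ * _ = _
    rw [adj_dual, ← dual_del, dual_mul, dual_mul, hW.constraint_eq h0, zero_mul, add_zero]
    congr 1
    rw [adj_mul]
    have h1 : adj δ W * adj δ G * (del 1 * W) = -(adj δ W * (del 1 * (G * W))) := by
      rw [mul_assoc, ← mul_assoc (adj δ G), hadj]
      noncomm_ring
    rw [h1, add_neg_cancel]

variable {τ : A} (hτ : IsTauOf D W τ)

include h0 hW hD hτ in
theorem IsDressing.isTauOf_dual (hΦ₁ : ∀ a, IsEigenfunction D L (Φ₁ a))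
    (hΦ₂ : ∀ a, IsEigenfunction D L (Φ₂ a)) (hΩ : ∀ a, IsBSEP D L (Φ₂ a) (Φ₁ a) (Ω a))
    {c : A} (hc : IsConst D c) :
    IsTauOf (fun n => dualDer (D n)) (PDO.dual W (ghost D Φ₁ Φ₂ * W))
      (eps τ (((1 / 2 : ℚ) • ∑ a, Ω a + c) * τ)) := by
  have hser := hW.series_ghost_mul h0 hD hτ hΦ₁ hΦ₂ hΩ
  set h := (1 / 2 : ℚ) • ∑ a, Ω a
  refine ⟨?_, ?_⟩
  · rw [TrivSqZeroExt.isUnit_iff_isUnit_fst, fst_eps]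
    exact hτ.1
  -- The ε-component: T((h + c)τ) = (Th + c)τw, and Th - h is supplied by the series of GW.
  · have h1 : shift D ((h + c) * τ) = PowerSeries.C τ * series (ghost D Φ₁ Φ₂ * W) +
        PowerSeries.C ((h + c) * τ) * series W := by
      rw [shift_mul hD, shift_add hD, shift_const hD hc, hτ.2, hser, map_mul, map_add]
      ring
    ext1 m
    rw [coeff_shift_dual hD, h1, hτ.2, PowerSeries.coeff_C_mul, PowerSeries.coeff_C_mul, map_add,
      PowerSeries.coeff_C_mul, PowerSeries.coeff_C_mul, coeff_series, coeff_series, coeff_series,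
      coeff_dual, eps_mul]

theorem IsTauOf.const_mul (hD : ∀ m n f, D m (D n f) = D n (D m f)) (hτ : IsTauOf D W τ) {C : A}
    (hC : IsConst D C) (hu : IsUnit C) : IsTauOf D W (C * τ) := by
  refine ⟨hu.mul hτ.1, ?_⟩
  rw [shift_mul hD, shift_const hD hC, hτ.2, map_mul, mul_assoc]

end dual

end

section

open PDO Finset
variable [DiffAlg A]
local notation "δ" => (DiffAlg.der : Derivation ℚ A A)

/-! ### The quadratic identity for a∂⁻¹b - b∂⁻¹a. -/

section baecklund

theorem del_neg_mul_fn_der_mul_del_neg (f : A) :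
    del (-1) * (fn (δ f) * del (-1)) = fn f * del (-1) - del (-1) * fn f := by
  have h := del_neg_mul_fn_der f (del (-1))
  rw [mul_assoc, mul_assoc, mul_assoc, del_mul_del_neg, mul_one] at h
  exact h

/-- The symmetrization of `∂⁻¹ x ∂ y ∂⁻¹`. -/
theorem two_nsmul_sandwich (x y : A) :
    (2 : ℕ) • (del (-1) * (fn x * (del 1 * (fn y * del (-1))))) =
      fn (x * y) * del (-1) + del (-1) * fn (x * y) +
        del (-1) * (fn (x * δ y - δ x * y) * del (-1)) := by
  have h1 : fn x * (del 1 * (fn y * del (-1))) =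
      fn (x * y) + fn (x * δ y) * del (-1) := by
    rw [← mul_assoc (del 1), del_mul_fn, add_mul, mul_assoc (fn y), del_mul_del_neg, mul_one,
      mul_add, fn_mul_fn, ← mul_assoc, fn_mul_fn]
  have h2 : fn (x * y) * del (-1) = del (-1) * fn (x * y) +
      del (-1) * (fn (x * δ y) * del (-1)) + del (-1) * (fn (δ x * y) * del (-1)) := by
    have h3 := del_neg_mul_fn_der_mul_del_neg (x * y)
    rw [Derivation.leibniz, fn_add, add_mul, mul_add, smul_eq_mul, smul_eq_mul, mul_comm y,
      eq_sub_iff_add_eq] at h3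
    rw [← h3]
    abel
  rw [h1, two_nsmul, h2, fn_sub, sub_mul, mul_sub, mul_add]
  abel

/-- The quadratic identity behind the orthogonality of the binary Darboux operator. -/
theorem wedge_quadratic {a b g γ : A} (hγ : γ * g = 1)
    (hg : (2 : ℕ) • δ g = a * δ b - b * δ a) :
    fn γ * wedge a b - wedge a b * fn γ =
      wedge a b * (fn γ * (del 1 * (fn γ * wedge a b))) := by
  have hdγ : (2 : ℕ) • δ γ = -(γ * γ * (a * δ b - b * δ a)) := by
    have h1 : δ γ * g + γ * δ g = 0 := by
      have := congrArg δ hγ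
      rw [Derivation.leibniz, Derivation.map_one_eq_zero, smul_eq_mul, smul_eq_mul] at this
      rw [← this]; ring
    rw [← hg, nsmul_eq_mul, nsmul_eq_mul]
    linear_combination 2 * γ * h1 - 2 * δ γ * hγ
  have hs : ∀ x y : A, (2 : ℕ) • (del (-1) * (fn x * (fn γ * (del 1 *
      (fn γ * (fn y * del (-1))))))) = fn (γ * γ * x * y) * del (-1) + del (-1) * fn (γ * γ * x * y) +
        del (-1) * (fn (γ * γ * (x * δ y - δ x * y)) * del (-1)) := by
    intro x y
    have h := two_nsmul_sandwich (x * γ) (γ * y)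
    rw [show x * γ * (γ * y) = γ * γ * x * y by ring,
      show x * γ * δ (γ * y) - δ (x * γ) * (γ * y) = γ * γ * (x * δ y - δ x * y) by
        simp only [Derivation.leibniz, smul_eq_mul]; ring] at h
    rw [← h, ← fn_mul_fn, ← fn_mul_fn]
    simp only [mul_assoc]
  have hbb := hs b b
  have haa := hs a a
  have hba := hs b a
  have hab := hs a b
  -- For equal functions the antisymmetric term of the sandwich vanishes. For the mixed pairs the
  -- hypothesis on g turns it into ±2γ', and ∂⁻¹γ'∂⁻¹ = γ∂⁻¹ - ∂⁻¹γ.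
  rw [show γ * γ * (b * δ b - δ b * b) = 0 by ring, fn_zero, zero_mul, mul_zero, add_zero] at hbb
  rw [show γ * γ * (a * δ a - δ a * a) = 0 by ring, fn_zero, zero_mul, mul_zero, add_zero] at haa
  have hq := del_neg_mul_fn_der_mul_del_neg γ
  have hba' : γ * γ * (b * δ a - δ b * a) = (2 : ℕ) • δ γ := by rw [hdγ]; ring
  have hab' : γ * γ * (a * δ b - δ a * b) = -((2 : ℕ) • δ γ) := by rw [hdγ]; ring
  have h2 : ∀ x : A, del (-1) * (fn ((2 : ℕ) • x) * del (-1)) =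
      (2 : ℕ) • (del (-1) * (fn x * del (-1)) : PDO A) := by
    intro x
    rw [two_nsmul, two_nsmul, fn_add, add_mul, mul_add]
  rw [hba', h2, hq] at hba
  rw [hab', fn_neg, neg_mul, mul_neg, h2, hq] at hab
  have hexp : wedge a b * (fn γ * (del 1 * (fn γ * wedge a b))) =
      fn a * (del (-1) * (fn b * (fn γ * (del 1 * (fn γ * (fn a * del (-1)))))) * fn b) -
      fn a * (del (-1) * (fn b * (fn γ * (del 1 * (fn γ * (fn b * del (-1)))))) * fn a) -
      fn b * (del (-1) * (fn a * (fn γ * (del 1 * (fn γ * (fn a * del (-1)))))) * fn b) +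
      fn b * (del (-1) * (fn a * (fn γ * (del 1 * (fn γ * (fn b * del (-1)))))) * fn a) := by
    simp only [wedge]
    noncomm_ring
  have hinj : ∀ P Q : PDO A, (2 : ℕ) • P = (2 : ℕ) • Q → P = Q := by
    intro P Q h
    ext i
    refine nsmul_cancel (m := 2) two_ne_zero ?_
    rw [← coeff_nsmul, h, coeff_nsmul]
  apply hinj
  have hm : ∀ (x y : A) (P : PDO A), (2 : ℕ) • (fn x * (P * fn y)) = fn x * ((2 : ℕ) • P * fn y) := by
    intro x y P
    rw [smul_mul_assoc, mul_smul_comm]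
  rw [hexp, smul_add, smul_sub, smul_sub, smul_sub, hm, hm, hm, hm, hba, hab, haa, hbb]
  have hf : ∀ x y z : A, fn x * (fn y * del (-1) * fn z) = fn (x * y) * (del (-1) * fn z) := by
    intro x y z
    rw [← fn_mul_fn]; simp only [mul_assoc]
  have hf' : ∀ x y z : A, fn x * (del (-1) * fn y * fn z) = fn x * (del (-1) * fn (y * z)) := by
    intro x y z
    rw [← fn_mul_fn]; simp only [mul_assoc]
  have hl : ∀ x y z : A, fn x * (fn y * (del (-1) * fn z)) = fn (x * y) * (del (-1) * fn z) := by
    intro x y z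
    rw [← fn_mul_fn, mul_assoc]
  have hr : ∀ x y z : A, fn x * (del (-1) * fn y) * fn z = fn x * (del (-1) * fn (y * z)) := by
    intro x y z
    rw [← fn_mul_fn]; simp only [mul_assoc]
  simp only [add_mul, mul_add, smul_mul_assoc, mul_smul_comm, sub_mul, mul_sub, wedge,
    neg_mul, mul_neg, hf, hf', hl, hr, smul_sub]
  rw [show a * (γ * γ * b * a) = b * (γ * γ * a * a) by ring,
    show γ * γ * b * a * b = γ * γ * b * b * a by ring,
    show a * (γ * γ * b * b) = b * (γ * γ * a * b) by ring,
    show γ * γ * a * a * b = γ * γ * a * b * a by ring, mul_comm a γ, mul_comm b γ]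
  abel

end baecklund

end

section

open PDO Finset
variable [DiffAlg A]
local notation "δ" => (DiffAlg.der : Derivation ℚ A A)

/-! ### The binary Darboux operator V = 1 + g⁻¹G and its remainder. -/

section darboux

theorem app_mul_fn (P : PDO A) (f g : A) : app (P * fn f) g = app P (f * g) := by
  rw [app, mul_assoc, fn_mul_fn]; rfl

/-- The residue `Res(∂⁻¹ ψ' P f ∂⁻¹)` that defines the squared eigenfunction potentials. -/
def sepRes (P : PDO A) (f ψ : A) : A := (del (-1) * fn (δ ψ) * P * fn f * del (-1)).coeff (-1)

/-- Integration by parts, ∂⁻¹ψ' = ψ - ∂⁻¹ψ∂, leaves a residue that is antisymmetric in f and ψ by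
taking adjoints. -/
theorem sepRes_add_swap {P : PDO A} (hP : adj δ P * del 1 = -(del 1 * P)) (f ψ : A) :
    sepRes P f ψ + sepRes P ψ f = ψ * app P f + f * app P ψ := by
  set ρ : A → A → A := fun ψ f =>
    (del (-1) * (fn ψ * (del 1 * (P * (fn f * del (-1)))))).coeff (-1) with hρ
  have h1 : ∀ f ψ, sepRes P f ψ = ψ * app P f - ρ ψ f := by
    intro f ψ
    have h := del_neg_mul_fn_der ψ (P * (fn f * del (-1)))
    simp only [mul_assoc] at h
    rw [sepRes, mul_assoc, mul_assoc, mul_assoc, h, coeff_sub, coeff_fn_mul,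
      ← mul_assoc P, coeff_mul_del]
    simp only [hρ, app, mul_assoc]
    norm_num
  have h2 : ρ f ψ = -ρ ψ f := by
    have h := res_adj (del (-1) * (fn ψ * (del 1 * (P * (fn f * del (-1))))))
    simp only [hρ]
    rw [← h]
    congr 1
    simp only [adj_mul, adj_fn, adj_del_one, adj_del_neg_one, mul_assoc, neg_mul, mul_neg, neg_neg]
    rw [← mul_assoc (adj δ P), hP]
    simp only [neg_mul, mul_neg, mul_assoc]
    rw [neg_neg]
  rw [h1, h1, h2]
  ring

/-- Replace ∂⁻¹uf by h - ∂⁻¹h∂. The last term contributes the residue of Pφ∂⁻¹h. -/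
theorem coeff_zero_mul_primitive {P : PDO A} (hP : P.IsDiff) {φ u f h : A} (hh : δ h = u * f) :
    (P * (fn φ * (del (-1) * fn u)) * fn f).coeff 0 = app P (φ * h) - app P φ * h := by
  have h1 := del_neg_mul_fn_der h 1
  rw [mul_one, mul_one, mul_one, hh] at h1
  have h2 : P * (fn φ * (del (-1) * fn u)) * fn f =
      P * fn (φ * h) - P * fn φ * del (-1) * fn h * del 1 := by
    rw [mul_assoc, mul_assoc, mul_assoc (del (-1)), fn_mul_fn, h1, mul_sub, mul_sub, ← fn_mul_fn]
    simp only [mul_assoc]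
  have h3 : (P * fn φ * del (-1) * fn h).coeff (-1) = app P φ * h := by
    have h4 := congrArg (fun Q => Q.coeff (-1)) (minus_mul_del_neg_mul_fn (hP.mul (isDiff_fn φ)) h)
    simp only [coeff_minus] at h4
    rw [if_pos (by norm_num), mul_assoc (fn _), coeff_fn_mul] at h4
    have h5 := coeff_mul_top (ordLE_del (A := A) (-1)) (ordLE_fn h)
    rw [add_zero] at h5
    rw [h4, h5, coeff_del, if_pos rfl, coeff_fn, if_pos rfl, one_mul]; rfl
  rw [h2, coeff_sub, coeff_mul_del, zero_sub, h3]; rfl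

/-- The generator of the ghost flow of a single pair. -/
def pairGen (a b : A) : PDO A := fn b * (del (-1) * fn (δ a)) - fn a * (del (-1) * fn (δ b))

theorem pairGen_swap (a b : A) : pairGen b a = -pairGen a b := (neg_sub _ _).symm

theorem pairGen_eq (a b : A) : pairGen a b = wedge a b * del 1 := by
  have h : ∀ f : A, del (-1) * fn (δ f) = fn f - del (-1) * fn f * del 1 := fun f => by
    simpa using del_neg_mul_fn_der f 1
  rw [pairGen, h, h, wedge, mul_sub, mul_sub, sub_mul, fn_comm a]
  simp only [mul_assoc]
  abel

/-- `[g, P] + g' - [P, G]_+`, where `G` is the generator of a pair and `g'` a function. -/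
def darbouxRem (P : PDO A) (a b g g' : A) : PDO A :=
  fn g * P - P * fn g + fn g' - plus (P * pairGen a b - pairGen a b * P)

theorem darbouxRem_swap (P : PDO A) (a b g g' : A) :
    darbouxRem P b a (-g) (-g') = -darbouxRem P a b g g' := by
  have h : plus (P * pairGen b a - pairGen b a * P) =
      -plus (P * pairGen a b - pairGen a b * P) := by
    rw [pairGen_swap, neg_eq_zero_sub, neg_eq_zero_sub, mul_sub, sub_mul, mul_zero, zero_mul,
      zero_sub, zero_sub, neg_sub_neg, ← neg_sub, neg_eq_zero_sub, plus_sub]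
    congr 1
    ext i; rw [coeff_plus, coeff_zero', ite_self]
  rw [darbouxRem, darbouxRem, h, fn_neg, fn_neg]
  noncomm_ring

/-- With suitable primitives, (g + G)a = 0. The primitives chosen in G enter the commutator with P
only through potentials, which the hypothesis on g' matches. -/
theorem app_darbouxRem {P : PDO A} (hP : P.IsDiff) (hPadj : adj δ P * del 1 = -(del 1 * P))
    {a b g g' : A} (hg : (2 : ℕ) • δ g = a * δ b - b * δ a)
    (hg' : (2 : ℕ) • g' = sepRes P a b - sepRes P b a) : app (darbouxRem P a b g g') a = 0 := by
  -- k and l are primitives of a'a and b'a, normalized so that bk - al = -ga.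
  set k := (1 / 2 : ℚ) • (a * a) with hk
  set l := (1 / 2 : ℚ) • (a * b) + g with hl
  have hhalf : ∀ x : A, (2 : ℕ) • ((1 / 2 : ℚ) • x) = x := by
    intro x
    rw [← Nat.cast_smul_eq_nsmul ℚ, smul_smul]; norm_num
  have hk2 : 2 * k = a * a := by rw [← hhalf (a * a), nsmul_eq_mul]; norm_num [hk]
  have hl2 : 2 * l = a * b + 2 * g := by
    rw [← hhalf (a * b), nsmul_eq_mul, hl]; push_cast; ring
  have hδk : δ k = δ a * a := by
    refine nsmul_cancel (m := 2) two_ne_zero ?_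
    rw [← map_nsmul, hk, hhalf, Derivation.leibniz, two_nsmul, smul_eq_mul, mul_comm a]
  have hδl : δ l = δ b * a := by
    refine nsmul_cancel (m := 2) two_ne_zero ?_
    rw [hl, map_add, smul_add, hg, ← map_nsmul, hhalf, Derivation.leibniz, smul_eq_mul,
      smul_eq_mul, two_nsmul]
    ring
  have h1 : (P * pairGen a b * fn a).coeff 0 =
      (app P (b * k) - app P b * k) - (app P (a * l) - app P a * l) := by
    rw [pairGen, mul_sub, sub_mul, coeff_sub, coeff_zero_mul_primitive hP hδk,
      coeff_zero_mul_primitive hP hδl]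
  have h2 : (pairGen a b * P * fn a).coeff 0 = b * sepRes P a a - a * sepRes P a b := by
    have h3 : ∀ x y : A, (fn x * (del (-1) * fn (δ y)) * P * fn a).coeff 0 = x * sepRes P a y := by
      intro x y
      rw [sepRes, coeff_mul_del, mul_assoc, mul_assoc, coeff_fn_mul]
      simp only [mul_assoc]
      norm_num
    rw [pairGen, sub_mul, sub_mul, coeff_sub, h3, h3]
  have h3 : app (darbouxRem P a b g g') a = g * app P a - app P (g * a) + g' * a -
      ((P * pairGen a b * fn a).coeff 0 - (pairGen a b * P * fn a).coeff 0) := by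
    rw [darbouxRem, app_sub, app_plus, app_add, app_sub, app_fn_mul, app_mul_fn, app_fn, app_sub]
    rfl
  have h4 : app P (b * k) - app P (a * l) = -app P (g * a) := by
    have : b * k - a * l = 0 - g * a := by
      refine nsmul_cancel (m := 2) two_ne_zero ?_
      rw [nsmul_eq_mul, nsmul_eq_mul]
      push_cast
      linear_combination b * hk2 - a * hl2
    rw [← app_sub_right, this, app_sub_right, app, fn_zero, mul_zero, coeff_zero', zero_sub]
  have h5 := sepRes_add_swap hPadj a a
  have h6 := sepRes_add_swap hPadj a b
  have h7 : sepRes P a a = a * app P a := by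
    refine nsmul_cancel (m := 2) two_ne_zero ?_
    rw [two_nsmul, two_nsmul, h5]
  rw [nsmul_eq_mul] at hg'
  push_cast at hg'
  rw [h3, h1, h2, h7]
  refine nsmul_cancel (m := 2) two_ne_zero ?_
  rw [nsmul_eq_mul, smul_zero]
  push_cast
  linear_combination -2 * h4 + a * hg' + app P b * hk2 - app P a * hl2 - a * h6

variable {a b g γ : A}

/-- The binary Darboux operator `1 + g⁻¹ G`. -/
def darboux (γ a b : A) : PDO A := 1 + fn γ * pairGen a b

theorem ordLE_pairGen (a b : A) : (pairGen a b).OrdLE (-1) := by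
  have h : ∀ f g : A, (fn f * (del (-1) * fn g)).OrdLE (-1) := fun f g =>
    ((ordLE_fn f).mul ((ordLE_del (-1)).mul (ordLE_fn g))).mono (by norm_num)
  exact (h _ _).sub (h _ _)

theorem ordLE_fn_mul_pairGen (γ a b : A) : (fn γ * pairGen a b).OrdLE (-1) :=
  ((ordLE_fn γ).mul (ordLE_pairGen a b)).mono (by norm_num)

theorem ordLE_darboux (γ a b : A) : (darboux γ a b).OrdLE 0 :=
  ordLE_one.add ((ordLE_fn_mul_pairGen γ a b).mono (by norm_num))

theorem coeff_zero_darboux (γ a b : A) : (darboux γ a b).coeff 0 = 1 := by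
  rw [darboux, coeff_add, ordLE_fn_mul_pairGen γ a b 0 (by norm_num), add_zero, coeff_one,
    if_pos rfl]

theorem adj_darboux (γ a b : A) : adj δ (darboux γ a b) = 1 - del 1 * wedge a b * fn γ := by
  rw [darboux, adj_add, adj_mul, pairGen_eq, adj_mul, adj_wedge, adj_fn, adj_del_one, ← fn_one,
    adj_fn]
  noncomm_ring

/-- With K = a∂⁻¹b - b∂⁻¹a, V = 1 + γK∂ and V^* = 1 - ∂Kγ. The defect is ∂(γK - Kγ - Kγ∂γK)∂. -/
theorem adj_darboux_mul (hγ : γ * g = 1) (hg : (2 : ℕ) • δ g = a * δ b - b * δ a) :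
    adj δ (darboux γ a b) * (del 1 * darboux γ a b) = del 1 := by
  have h : del 1 * (fn γ * wedge a b - wedge a b * fn γ) * del 1 =
      del 1 * (wedge a b * (fn γ * (del 1 * (fn γ * wedge a b)))) * del 1 := by
    rw [wedge_quadratic hγ hg]
  rw [adj_darboux, darboux, pairGen_eq]
  calc _ = del 1 + (del 1 * (fn γ * wedge a b - wedge a b * fn γ) * del 1 -
        del 1 * (wedge a b * (fn γ * (del 1 * (fn γ * wedge a b)))) * del 1) := by noncomm_ring
    _ = del 1 := by rw [h, sub_self, add_zero]

theorem dressInv_darboux (γ a b : A) :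
    dressInv (darboux γ a b) = 1 - wedge a b * fn γ * del 1 := by
  rw [dressInv, adj_darboux, mul_sub, sub_mul, mul_one, del_neg_mul_del]
  simp only [mul_assoc]
  rw [← mul_assoc (del (-1)) (del 1), del_neg_mul_del, one_mul]

/-- The only possible negative term of Rx∂⁻¹ is R(x)∂⁻¹. -/
theorem isDiff_mul_wedge {R : PDO A} (hR : R.IsDiff) (ha : app R a = 0) (hb : app R b = 0) :
    (R * wedge a b).IsDiff := by
  have h : ∀ x y : A, app R x = 0 → (R * (fn x * (del (-1) * fn y))).IsDiff := by
    intro x y hx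
    have h1 : (R * fn x * del (-1)).IsDiff := by
      intro i hi
      rw [coeff_mul_del]
      rcases eq_or_ne i (-1) with rfl | h
      · exact hx
      · exact (hR.mul (isDiff_fn x)) _ (by omega)
    have h2 := h1.mul (isDiff_fn y)
    simpa only [mul_assoc] using h2
  rw [wedge, mul_sub]
  exact (h a b ha).sub (h b a hb)

end darboux

end

section

open PDO Finset
variable [DiffAlg A]
local notation "δ" => (DiffAlg.der : Derivation ℚ A A)

/-! ### Binary Darboux transforms of dressing operators and tau functions. -/

section transform

variable {D : ℕ → Derivation ℚ A A} {W L : PDO A} (h0 : D 0 = DiffAlg.der)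
  (hD : ∀ m n f, D m (D n f) = D n (D m f)) (hW : IsDressing D W L)
  {a b g γ : A} (hγ : γ * g = 1) (ha : IsEigenfunction D L a) (hb : IsEigenfunction D L b)

include h0 in
theorem pairGen_eq_ghost (a b : A) :
    pairGen a b = ghost D (fun _ : Unit => a) (fun _ : Unit => b) := by
  rw [ghost_eq h0, Fintype.sum_unique, pairGen]

theorem fn_mul_darboux (hγ : γ * g = 1) : fn g * darboux γ a b = fn g + pairGen a b := by
  rw [darboux, mul_add, mul_one, ← mul_assoc, fn_mul_fn, mul_comm g, hγ, fn_one, one_mul]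

include h0 hD hW hγ ha hb in
theorem IsDressing.fn_mul_mapDer_darboux (n : ℕ) :
    fn g * (mapDer (D n) (darboux γ a b) + darboux γ a b * B D L n) =
      (B D L n * fn g - fn (D n g)) * darboux γ a b + darbouxRem (B D L n) a b g (D n g) := by
  have hd : ∀ f, D n (δ f) = δ (D n f) := fun f => by rw [← h0, hD]
  have h1 := fn_mul_darboux (a := a) (b := b) hγ
  have h2 : mapDer (D n) (pairGen a b) = minus (B D L n * pairGen a b - pairGen a b * B D L n) := by
    rw [pairGen_eq_ghost h0]
    exact hW.mapDer_ghost h0 hD (fun _ => ha) (fun _ => hb) n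
  have h3 := congrArg (mapDer (D n)) h1
  rw [mapDer_mul hd, mapDer_add, mapDer_fn, h2] at h3
  have h4 := plus_add_minus (B D L n * pairGen a b - pairGen a b * B D L n)
  rw [darbouxRem, mul_add, ← mul_assoc (fn g) (darboux γ a b), h1, sub_mul, mul_assoc (B D L n), h1,
    eq_sub_of_add_eq' h3, eq_sub_of_add_eq' h4]
  noncomm_ring

include h0 hD hW hγ ha hb in
-- By `IsDressing.fn_mul_mapDer_darboux`, only the remainder times V⁻¹ could fail to be
-- differential. As V⁻¹ = 1 - Kγ∂ and the remainder kills a and b, it is differential. The case of b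
-- follows by swapping a, b and the sign of g.
theorem IsDressing.exists_isDiff_darboux (hg : (2 : ℕ) • δ g = a * δ b - b * δ a) (n : ℕ)
    (hg' : (2 : ℕ) • D n g = sepRes (B D L n) a b - sepRes (B D L n) b a) :
    ∃ P : PDO A, P.IsDiff ∧
      P * darboux γ a b = mapDer (D n) (darboux γ a b) + darboux γ a b * B D L n := by
  have hB := hW.isDiff_B h0 n
  have hBadj := hW.adj_B h0 n
  have hR : (darbouxRem (B D L n) a b g (D n g)).IsDiff :=
    (((isDiff_fn g).mul hB).sub (hB.mul (isDiff_fn g))).add (isDiff_fn _) |>.sub (isDiff_plus _)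
  have hRa := app_darbouxRem hB hBadj hg hg'
  have hRb : app (darbouxRem (B D L n) a b g (D n g)) b = 0 := by
    have h := app_darbouxRem (a := b) (b := a) (g := -g) (g' := -D n g) hB hBadj
      (by rw [map_neg, smul_neg, hg, neg_sub]) (by rw [smul_neg, hg', neg_sub])
    rwa [darbouxRem_swap, app, neg_mul, coeff_neg, neg_eq_zero] at h
  have hinv := dressInv_mul (adj_darboux_mul hγ hg)
  refine ⟨fn γ * (B D L n * fn g - fn (D n g) +
    darbouxRem (B D L n) a b g (D n g) * dressInv (darboux γ a b)), ?_, ?_⟩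
  · refine (isDiff_fn γ).mul (((hB.mul (isDiff_fn g)).sub (isDiff_fn _)).add ?_)
    rw [dressInv_darboux, mul_sub, mul_one, ← mul_assoc, ← mul_assoc]
    exact hR.sub (((isDiff_mul_wedge hR hRa hRb).mul (isDiff_fn γ)).mul isDiff_del_one)
  · rw [mul_assoc, add_mul, mul_assoc (darbouxRem _ _ _ _ _), hinv, mul_one,
      ← hW.fn_mul_mapDer_darboux h0 hD hγ ha hb, ← mul_assoc, fn_mul_fn, hγ, fn_one, one_mul]

include h0 hD hW hγ ha hb in
/-- The binary Darboux transform of a dressing operator. -/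
theorem IsDressing.darboux_mul (hg : (2 : ℕ) • δ g = a * δ b - b * δ a)
    (hg' : ∀ n, (2 : ℕ) • D n g = sepRes (B D L n) a b - sepRes (B D L n) b a) :
    IsDressing D (darboux γ a b * W) (darboux γ a b * L * dressInv (darboux γ a b)) := by
  have hP := fun n => hW.exists_isDiff_darboux h0 hD hγ ha hb hg n (hg' n)
  have hV := ordLE_darboux γ a b
  have hV0 := coeff_zero_darboux γ a b
  have hadj := adj_darboux_mul hγ hg
  have hVd : ∀ n, (mapDer (D n) (darboux γ a b)).OrdLE (-1) := fun n => by
    rw [darboux, mapDer_add, mapDer_one, zero_add]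
    exact (ordLE_fn_mul_pairGen γ a b).mapDer _
  set V := darboux γ a b
  have hi := dressInv_mul hadj
  have hi' := mul_dressInv hV hV0 hadj
  have hpow : ∀ k : ℕ, (V * L * dressInv V) ^ k = V * L ^ k * dressInv V := by
    intro k
    induction k with
    | zero => rw [pow_zero, pow_zero, mul_one, hi']
    | succ k ih =>
      rw [pow_succ, ih, pow_succ, mul_assoc, ← mul_assoc (dressInv V), ← mul_assoc (dressInv V), hi,
        one_mul]
      simp only [mul_assoc]
  have hc := coeff_mul_top hV hW.ordLE
  rw [add_zero, hV0, hW.coeff_zero, one_mul] at hc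
  refine isDressing_of_ring h0 ((hV.mul hW.ordLE).mono (by norm_num)) hc ?_ (fun n => ?_) ?_
  · rw [mul_assoc, ← mul_assoc (dressInv V), hi, one_mul, mul_assoc, hW.lax_eq h0, mul_assoc]
  · have hd : ∀ f, D n (δ f) = δ (D n f) := fun f => by rw [← h0, hD]
    obtain ⟨P, hPd, hPV⟩ := hP n
    -- The new power of the Lax operator differs from P by an operator of negative order, so P is
    -- its differential part.
    have h1 : (V * L * dressInv V) ^ (2 * n + 1) - P =
        (V * minus (L ^ (2 * n + 1)) - mapDer (D n) V) * dressInv V := by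
      have h2 : P = (mapDer (D n) V + V * B D L n) * dressInv V := by
        rw [← hPV, mul_assoc, hi', mul_one]
      have h3 := plus_add_minus (L ^ (2 * n + 1))
      rw [← hW.B_eq h0] at h3
      rw [hpow, h2, ← h3, ← sub_mul]
      congr 1
      rw [h3]
      nth_rewrite 1 [← h3]
      noncomm_ring
    have h4 : ((V * minus (L ^ (2 * n + 1)) - mapDer (D n) V) * dressInv V).OrdLE (-1) :=
      ((((hV.mul (ordLE_minus _)).mono (by norm_num)).sub (hVd n)).mul
        (ordLE_dressInv hV)).mono (by norm_num)
    have h5 : minus ((V * L * dressInv V) ^ (2 * n + 1)) =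
        (V * minus (L ^ (2 * n + 1)) - mapDer (D n) V) * dressInv V := by
      rw [← minus_eq_self h4, ← h1, minus_sub, minus_eq_zero hPd, sub_zero]
    rw [h5, mapDer_mul hd, hW.sato_eq h0, mul_assoc, ← mul_assoc (dressInv V), hi, one_mul]
    noncomm_ring
  · rw [adj_mul, mul_assoc, ← mul_assoc (del 1), ← mul_assoc (adj δ V), hadj, hW.constraint_eq h0]

variable {τ C Ω : A} (hτ : IsTauOf D W τ)

include h0 hD hW hτ ha hb in
theorem IsDressing.isTau_pair (hΩ : IsBSEP D L b a Ω) (hC : IsConst D C)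
    (hu : IsUnit (C + (1 / 2 : ℚ) • Ω)) : IsTau D (C * τ + ((1 / 2 : ℚ) • Ω) * τ) := by
  -- The coefficient of z in the shift formula for Ω, since Tf = f - 2zf' + ….
  have hdΩ : δ Ω = a * δ b - b * δ a := by
    have h1 := congrArg (PowerSeries.coeff 1) (hW.shift_potential h0 hD hτ ha hb hΩ)
    have h2 : ∀ f : A, PowerSeries.coeff 1 (shift D f) = -((2 : ℕ) • δ f) := by
      intro f
      have h := isFlow_shift hD f 1
      rw [one_smul, coeff_flowGen, sum_eq_single (1, 0)] at h
      · rw [h, coeff_zero_shift, flow_odd D 0, Derivation.smul_apply, h0, neg_smul, ← Nat.cast_smul_eq_nsmul ℚ]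
        norm_num
      · intro p hp hne
        have hp' := HasAntidiagonal.mem_antidiagonal.1 hp
        have hp0 : p.1 = 0 := by
          by_contra hc
          exact hne (by ext <;> simp only <;> omega)
        rw [hp0, flow_zero]; rfl
      · intro h
        exact absurd (HasAntidiagonal.mem_antidiagonal.2 (by simp)) h
    rw [map_add, map_sub, PowerSeries.coeff_C_mul, PowerSeries.coeff_C_mul, h2, h2, h2,
      PowerSeries.coeff_C, if_neg one_ne_zero, zero_add] at h1
    refine nsmul_cancel (m := 2) two_ne_zero ?_
    rw [← neg_inj, h1]
    simp only [nsmul_eq_mul]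
    ring
  have hhalf : ∀ d : Derivation ℚ A A, d C = 0 → (2 : ℕ) • d (C + (1 / 2 : ℚ) • Ω) = d Ω := by
    intro d hd
    rw [map_add, hd, zero_add, d.map_smul, ← Nat.cast_smul_eq_nsmul ℚ, smul_smul]
    norm_num
  obtain ⟨γ, hγ⟩ := hu.exists_left_inv
  have hg' : ∀ n, (2 : ℕ) • D n (C + (1 / 2 : ℚ) • Ω) =
      sepRes (B D L n) a b - sepRes (B D L n) b a := by
    intro n
    obtain ⟨S, S', hS, hS', rfl⟩ := (isBSEP_iff h0).1 hΩ
    rw [hhalf _ (hC n), map_sub, (isSEP_iff h0).1 hS, (isSEP_iff h0).1 hS']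
    rfl
  refine ⟨_, _, hW.darboux_mul h0 hD hγ ha hb ((hhalf δ (h0 ▸ hC 0)).trans hdΩ) hg', ?_⟩
  rw [← add_mul]
  refine ⟨hu.mul hτ.1, ?_⟩
  have hser := hW.series_ghost_mul h0 hD hτ (ι := Unit) (fun _ => ha) (fun _ => hb)
    (Ω := fun _ => Ω) (fun _ => hΩ)
  rw [← pairGen_eq_ghost h0, Fintype.sum_unique] at hser
  have hC' := congrArg (PowerSeries.C (R := A)) hγ
  rw [map_mul, map_add, map_one] at hC'
  rw [shift_mul hD, shift_add hD, shift_const hD hC, hτ.2, darboux, add_mul (1 : PDO A), one_mul,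
    series_add, mul_assoc (fn γ), series_fn_mul, hser, map_mul, map_add]
  linear_combination (-(PowerSeries.C τ * series W * (shift D ((1 / 2 : ℚ) • Ω) -
    PowerSeries.C ((1 / 2 : ℚ) • Ω)))) * hC'

end transform

end

section

open PDO Finset
variable [DiffAlg A]
local notation "δ" => (DiffAlg.der : Derivation ℚ A A)

/-! ### The ghost flow on tau functions and the rescaling by constants. -/

section tau

variable {D : ℕ → Derivation ℚ A A} {W L : PDO A} (h0 : D 0 = DiffAlg.der)
  (hD : ∀ m n f, D m (D n f) = D n (D m f)) (hW : IsDressing D W L)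
  {τ : A} (hτ : IsTauOf D W τ) {ι : Type*} [Fintype ι] {Φ₁ Φ₂ Ω : ι → A}

include h0 hD hW hτ in
theorem IsDressing.exists_const_of_ghost (hΦ₁ : ∀ a, IsEigenfunction D L (Φ₁ a))
    (hΦ₂ : ∀ a, IsEigenfunction D L (Φ₂ a)) (hΩ : ∀ a, IsBSEP D L (Φ₂ a) (Φ₁ a) (Ω a))
    {d : Derivation ℚ A A} (hd : ∀ n f, d (D n f) = D n (d f))
    (hdW : mapDer d W = ghost D Φ₁ Φ₂ * W) :
    ∃ c, IsConst D c ∧ d τ = ((1 / 2 : ℚ) • ∑ a, Ω a + c) * τ := by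
  have hser := hW.series_ghost_mul h0 hD hτ hΦ₁ hΦ₂ hΩ
  set h := (1 / 2 : ℚ) • ∑ a, Ω a
  obtain ⟨σ, hσ⟩ := hτ.1.exists_left_inv
  have hσ' := congrArg (PowerSeries.C (R := A)) hσ
  rw [map_mul, map_one] at hσ'
  have h1 : shift D (d τ) = PowerSeries.C (d τ) * series W +
      PowerSeries.C τ * series (ghost D Φ₁ Φ₂ * W) := by
    ext1 m
    have hd' : ∀ n f, (d : A →+ A) (D n f) = D n ((d : A →+ A) f) := hd
    refine (coeff_shift_comm hD hd' τ m).trans ?_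
    change d _ = _
    rw [hτ.2, PowerSeries.coeff_C_mul, Derivation.leibniz, map_add, PowerSeries.coeff_C_mul,
      PowerSeries.coeff_C_mul, ← hdW, coeff_series, coeff_series, coeff_mapDer, smul_eq_mul,
      smul_eq_mul]
    ring
  have h2 : shift D σ * shift D τ = 1 := by
    rw [← shift_mul hD, hσ, shift_const hD isConst_one, map_one]
  -- Divide T(dτ) = (dτ)w + τw(Th - h) by Tτ = τw, where σ = τ⁻¹.
  have h3 : shift D (d τ * σ - h) = PowerSeries.C (d τ * σ - h) := by
    rw [shift_sub hD, shift_mul hD, h1, hser, map_sub, map_mul]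
    rw [hτ.2] at h2
    linear_combination (PowerSeries.C (d τ) * PowerSeries.C σ + (shift D h - PowerSeries.C h)) * h2 -
      PowerSeries.C (d τ) * shift D σ * series W * hσ'
  refine ⟨d τ * σ - h, isConst_of_shift hD h3, ?_⟩
  linear_combination -d τ * hσ

theorem isConst_of_mul_eq_one {C C' : A} (hC : IsConst D C) (h : C' * C = 1) : IsConst D C' := by
  intro n
  have h1 := congrArg (D n) h
  rw [Derivation.leibniz, hC n, smul_zero, zero_add, Derivation.map_one_eq_zero, smul_eq_mul] at h1
  linear_combination C' * h1 - D n C' * h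

theorem PDO.mul_fn_const {c : A} (hc : δ c = 0) (P : PDO A) : P * fn c = fn c * P := by
  obtain ⟨N, hN⟩ := exists_ordLE P
  ext m
  rw [coeff_fn_mul, fn, coeff_mul_monomial hN 0 c m ((N - m).toNat + 1) (by push_cast; omega),
    sum_range_succ', sum_eq_zero]
  · simp [mul_comm]
  · intro k _
    rw [Function.iterate_succ_apply, hc, iterate_map_zero, mul_zero, smul_zero]

theorem IsEigenfunction.const_mul (h0 : D 0 = DiffAlg.der) {c Φ : A} (hc : IsConst D c)
    (h : IsEigenfunction D L Φ) : IsEigenfunction D L (c * Φ) := by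
  have hc0 : δ c = 0 := h0 ▸ hc 0
  rw [isEigenfunction_iff h0] at h ⊢
  intro n
  rw [Derivation.leibniz, hc n, smul_zero, add_zero, h n, smul_eq_mul, app, app, ← fn_mul_fn,
    ← mul_assoc, PDO.mul_fn_const hc0, mul_assoc, coeff_fn_mul]

theorem IsSEP.const_mul_left (h0 : D 0 = DiffAlg.der) {c Φ Ψ S : A} (hc : IsConst D c)
    (h : IsSEP D L Φ Ψ S) : IsSEP D L (c * Φ) Ψ (c * S) := by
  have hc0 : δ c = 0 := h0 ▸ hc 0
  rw [isSEP_iff h0] at h ⊢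
  intro n
  rw [Derivation.leibniz, hc n, smul_zero, add_zero, h n, smul_eq_mul, ← fn_mul_fn, ← mul_assoc,
    PDO.mul_fn_const hc0]
  simp only [mul_assoc, coeff_fn_mul]

theorem IsSEP.const_mul_right (h0 : D 0 = DiffAlg.der) {c Φ Ψ S : A} (hc : IsConst D c)
    (h : IsSEP D L Φ Ψ S) : IsSEP D L Φ (c * Ψ) (c * S) := by
  have hc0 : δ c = 0 := h0 ▸ hc 0
  rw [isSEP_iff h0] at h ⊢
  intro n
  rw [Derivation.leibniz, hc n, smul_zero, add_zero, h n, smul_eq_mul, ← fn_mul_fn, ← mul_assoc,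
    PDO.mul_fn_const hc0]
  simp only [mul_assoc, coeff_fn_mul]

theorem IsBSEP.const_mul_left (h0 : D 0 = DiffAlg.der) {c Φ₁ Φ₂ Ω : A} (hc : IsConst D c)
    (h : IsBSEP D L Φ₁ Φ₂ Ω) : IsBSEP D L (c * Φ₁) Φ₂ (c * Ω) := by
  obtain ⟨S, S', hS, hS', rfl⟩ := h
  refine ⟨c * S, c * S', ?_, hS'.const_mul_left h0 hc, mul_sub _ _ _⟩
  rw [Derivation.leibniz, hc 0, smul_zero, add_zero]
  exact hS.const_mul_right h0 hc

include h0 hD hW hτ in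
-- Cτ + εhτ = C(τ + εC⁻¹hτ). The factor C⁻¹ is absorbed into Φ₂, and C multiplies a tau function
-- without changing its dressing operator.
theorem IsDressing.isTau_dual (hΦ₁ : ∀ a, IsEigenfunction D L (Φ₁ a))
    (hΦ₂ : ∀ a, IsEigenfunction D L (Φ₂ a)) (hΩ : ∀ a, IsBSEP D L (Φ₂ a) (Φ₁ a) (Ω a))
    {C : A} (hC : IsConst D C) (hu : IsUnit C) :
    IsTau (fun n => dualDer (D n)) (eps (C * τ) (((1 / 2 : ℚ) • ∑ a, Ω a) * τ)) := by
  obtain ⟨C', hC'⟩ := hu.exists_left_inv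
  have hc := isConst_of_mul_eq_one hC hC'
  have hΦ₂' : ∀ a, IsEigenfunction D L (C' * Φ₂ a) := fun a => (hΦ₂ a).const_mul h0 hc
  have hΩ' : ∀ a, IsBSEP D L (C' * Φ₂ a) (Φ₁ a) (C' * Ω a) := fun a => (hΩ a).const_mul_left h0 hc
  have h1 := (hW.isTauOf_dual h0 hD hτ hΦ₁ hΦ₂' hΩ' (c := 0) fun n => map_zero _).const_mul
    (C := eps C 0) (dualDer_comm hD) (fun n => by
      rw [dualDer_eps, hC n, map_zero, eps_zero])
    (by rw [TrivSqZeroExt.isUnit_iff_isUnit_fst, fst_eps]; exact hu)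
  refine ⟨_, _, hW.dual h0 hD hΦ₁ hΦ₂', ?_⟩
  rw [eps_mul, zero_mul, add_zero, add_zero, ← mul_sum, ← mul_smul_comm, ← mul_assoc, ← mul_assoc,
    mul_comm C C', hC', one_mul] at h1
  exact h1

end tau

end

end BKP

end

theorem mainTheorem2 {A : Type*} [CommRing A] [Algebra ℚ A]
    (D : ℕ → Derivation ℚ A A) (hD : ∀ m n f, D m (D n f) = D n (D m f))
    (W L : PDO A) (hW : IsDressing D W L) (τ : A) (hτ : IsTauOf D W τ)
    {ι : Type*} [Fintype ι] (Φ₁ Φ₂ : ι → A)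
    (hΦ₁ : ∀ a, IsEigenfunction D L (Φ₁ a)) (hΦ₂ : ∀ a, IsEigenfunction D L (Φ₂ a))
    (Ω : ι → A) (hΩ : ∀ a, IsBSEP D L (Φ₂ a) (Φ₁ a) (Ω a)) :
    (∀ δ : Derivation ℚ A A, (∀ n f, δ (D n f) = D n (δ f)) →
      mapDer δ W = comp (D 0) (ghost D Φ₁ Φ₂) W →
        ∃ c, IsConst D c ∧ δ τ = ((1 / 2 : ℚ) • ∑ a, Ω a + c) * τ) ∧
    (IsDressing (fun n => dualDer (D n))
        (dual W (comp (D 0) (ghost D Φ₁ Φ₂) W))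
        (dual L (comp (D 0) (ghost D Φ₁ Φ₂) L - comp (D 0) L (ghost D Φ₁ Φ₂))) ∧
      ∀ c, IsConst D c →
        IsTauOf (fun n => dualDer (D n)) (dual W (comp (D 0) (ghost D Φ₁ Φ₂) W))
          (eps τ (((1 / 2 : ℚ) • ∑ a, Ω a + c) * τ))) ∧
    (∀ C, IsConst D C → IsUnit C →
      IsTau (fun n => dualDer (D n)) (eps (C * τ) (((1 / 2 : ℚ) • ∑ a, Ω a) * τ))) ∧
    (∀ a C, IsConst D C → IsUnit (C + (1 / 2 : ℚ) • Ω a) →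
      IsTau D (C * τ + ((1 / 2 : ℚ) • Ω a) * τ)) := by
  -- With ∂ = `D 0`, the operator product is by definition the composition in the statement.
  let _ : DiffAlg A := ⟨D 0⟩
  have h0 : D 0 = DiffAlg.der := rfl
  refine ⟨fun δ hδ hA => ?_, ⟨hW.dual h0 hD hΦ₁ hΦ₂, fun c hc =>
    hW.isTauOf_dual h0 hD hτ hΦ₁ hΦ₂ hΩ hc⟩, fun C hC hu => ?_, fun a C hC hu =>
      hW.isTau_pair h0 hD (hΦ₁ a) (hΦ₂ a) hτ (hΩ a) hC hu⟩
  · exact hW.exists_const_of_ghost h0 hD hτ hΦ₁ hΦ₂ hΩ hδ hA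
  · exact hW.isTau_dual h0 hD hτ hΦ₁ hΦ₂ hΩ hC hu
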